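/- Let $p$ be an odd prime, let $k$ be a field of characteristic $0$ containing a primitive $p$-th root of unity, let $n\ge 2$, let $a_1,\dots,a_n\in k^\times$, and put $G=\mu_p^n$. **Conventions.** All line bundles below are $G$-equivariant and carry a $G$-invariant $p$-form $\varphi_L\colon L^{\otimes p}\to\mathcal O$; the trivial bundle $\mathcal O$ carries the form $t\mapsto t^p$ and the trivial action, and tensor products carry the product form. For $1\le i\le n$ let $H_i$ be the trivial line bundle on $\operatorname{Spec}k$ with the form $t\mapsto a_it^p$, on which the $i$-th factor of $\mu_p^n$ acts by multiplication and the other factors act trivially. $\mathbb P(V)$ is the bundle of lines in $V$. The tautological line bundle $\mathbb L$ of $\mathbb P(\mathcal O\oplus L)$ carries the form induced by $(t,u)\mapsto t^p-\varphi_L(u)$. Pullbacks are omitted from the notation. **The variety $S$ and the line bundle $J$.** For a variety $S'$ with line bundles $H'_1,\dots,H'_r$, put $Q_0=S'$, $K_0=\mathcal O$ and, for $1\le i\le r$, let $P_i=P_i(S';H'_1,\dots,H'_i)$ be the product over $S'$ of $p-1$ copies of the $\mathbb P^1$-bundle $\mathbb P(\mathcal O\oplus(H'_i\otimes K_{i-1}))\to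 Q_{i-1}$, let $\mathbb L^{\boxtimes}$ be the external tensor product on $P_i$ of the $p-1$ tautological line bundles, and put $Q_i=Q_{i-1}\times_{S'}P_i$, $K_i=K_{i-1}\boxtimes\mathbb L^{\boxtimes}$. Start with $S_n=\operatorname{Spec}k$ and $J_n=H_{n-1}$. For $m=n,n-1,\dots,2$ put $Y_0=S_m$, $L_0=J_m$, and $L_{-1}=H_n$ if $m=n$, $L_{-1}=H_{m-1}$ if $m<n$; for $1\le r\le p$ put $$Y_r=P_{m-1}(Y_{r-1};H_1,\dots,H_{m-2},L_{r-1}),\qquad L_r=L_{r-2}\otimes\mathbb L^{\boxtimes};$$ then put $S_{m-1}=Y_p$, $J_{m-1}=L_p$. Let $S=S_1$ and $J=J_1$. **The norm hypersurface.** Let $\mathcal A=\bigoplus_{i=0}^{p-1}J^{\otimes i}$ be the Kummer algebra of $J$ over $S$ (locally $\mathcal O_S[u]/(u^p-\varphi_J(u))$ for a generator $u$ of $J$), with norm $N\colon\mathcal A\to\mathcal O_S$. For $w\in k$ let $$Q_w=\{[\beta:t]\in\mathbb P(\mathcal A\oplus\mathcal O)\;:\;N(\beta)=t^pw\}.$$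 The group $G$ acts on $Q_w$ and on $\mathbb P(\mathcal A)$. **Terminology.** An action of $G$ on a variety over a field $F$ is *nice* if the fixed locus is $0$-dimensional and consists of $F$-rational points. Two $G$-varieties $X,Y$ over $k$ are *$G$-fixed point equivalent over* a separable extension $K/k$ if $\mathrm{Fix}_G X$ and $\mathrm{Fix}_G Y$ are $0$-dimensional and lie in the smooth loci of $X$ and $Y$, all points of $\mathrm{Fix}_G X_K$ and $\mathrm{Fix}_G Y_K$ are $K$-rational, and there is a bijection $\mathrm{Fix}_G X_K\to\mathrm{Fix}_G Y_K$ under which the tangent spaces at corresponding points are isomorphic as representations of $G$ over $K$. **Theorem.** Let $w\in k$, $w\neq0$, and let $\ell=k(\sqrt[p]{w})$. Then: 1. $\mathrm{Fix}_G Q_w$ is $0$-dimensional, the residue field of each of its points is $k$-isomorphic to $\ell$, and $G$ acts nicely on $Q_w\otimes_k\ell$; in particular $G$ acts nicely on $Q_w$ itself if $w$ is a $p$-th power in $k$. 2. $\mathrm{Fix}_G Q_w$ does not meet the singular locus of $Q_w$. 3. $Q_w$ and $\mathbb P(\mathcal A)$ are $G$-fixed point equivalent over $\ell$. -/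

import Mathlib

open CategoryTheory CategoryTheory.Limits AlgebraicGeometry

universe u

noncomputable section

namespace NormVar

section Geometry

variable {K : Type u} [Field K] {G : Type u} [Group G]

/-- The structure map from the base field to the local ring at a point. -/
def structureMap (X : Over (Spec (.of K))) (x : X.left) : K →+* X.left.presheaf.stalk x :=
  ((Scheme.ΓSpecIso (.of K)).inv ≫ X.hom.appTop ≫ X.left.presheaf.germ ⊤ x trivial).hom

instance (X : Over (Spec (.of K))) (x : X.left) : Algebra K (X.left.presheaf.stalk x) :=
  (structureMap X x).toAlgebra

instance (X : Over (Spec (.of K))) (x : X.left) : Algebra K (X.left.residueField x) :=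
  ((X.left.residue x).hom.comp (structureMap X x)).toAlgebra

/-- The fixed points of `G` (a constant group) on `X`: the points `x` such that every `g` maps `x`
to itself and acts trivially on the residue field, that is, `g ∘ x = x` as morphisms
`Spec κ(x) ⟶ X`. -/
def fixedLocus (X : Action (Over (Spec (.of K))) G) : Set X.V.left :=
  {x | ∀ g, X.V.left.fromSpecResidueField x ≫ (X.ρ g).left = X.V.left.fromSpecResidueField x}

/-- The residue field at `x` is the base field. -/
def IsRationalPoint (X : Over (Spec (.of K))) (x : X.left) : Prop :=
  Function.Bijective (algebraMap K (X.left.residueField x))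

/-- The action is nice: the fixed locus is zero-dimensional and consists of rational points. -/
structure IsNice (X : Action (Over (Spec (.of K))) G) : Prop where
  dim : topologicalKrullDim (fixedLocus X) = 0
  rational : ∀ x ∈ fixedLocus X, IsRationalPoint X.V x

/-- The smooth locus: the points that have an open neighbourhood which is smooth over `K`. -/
def smoothSet (X : Over (Spec (.of K))) : Set X.left :=
  {x | ∃ U : X.left.Opens, x ∈ U ∧ Smooth (U.ι ≫ X.hom)}

/-- The base change of a `K`-scheme with `G`-action to an extension field `L`. -/
def baseChange (K L : Type u) [Field K] [Field L] [Algebra K L]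
    (X : Action (Over (Spec (.of K))) G) : Action (Over (Spec (.of L))) G :=
  ((Over.pullback (Spec.map (CommRingCat.ofHom (algebraMap K L)))).mapAction G).obj X

section Tangent

variable (X : Action (Over (Spec (.of K))) G)

theorem apply_of_mem_fixedLocus {x : X.V.left} (hx : x ∈ fixedLocus X) (g : G) :
    (X.ρ g).left x = x := by
  let s : Spec (X.V.left.residueField x) := IsLocalRing.closedPoint (X.V.left.residueField x)
  have h : (X.V.left.fromSpecResidueField x ≫ (X.ρ g).left) s =
      X.V.left.fromSpecResidueField x s := congrArg (fun f => f s) (hx g)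
  rwa [Scheme.Hom.comp_apply, Scheme.fromSpecResidueField_apply] at h

/-- The action of `g` on the local ring at a fixed point -/
def stalkAct (x : fixedLocus X) (g : G) :
    X.V.left.presheaf.stalk (x : X.V.left) →+* X.V.left.presheaf.stalk (x : X.V.left) :=
  (X.V.left.presheaf.stalkSpecializes
    (specializes_of_eq (apply_of_mem_fixedLocus X x.2 g)) ≫
      (X.ρ g).left.stalkMap x.1).hom

theorem stalkAct_germ (x : fixedLocus X) (g : G) (U : X.V.left.Opens) (hx : x.1 ∈ U)
    (s : Γ(X.V.left, U)) :
    stalkAct X x g (X.V.left.presheaf.germ U x.1 hx s) =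
      X.V.left.presheaf.germ ((X.ρ g).left ⁻¹ᵁ U) x.1
        (by change (X.ρ g).left x.1 ∈ U; rwa [apply_of_mem_fixedLocus X x.2 g])
        ((X.ρ g).left.app U s) := by
  have h : X.V.left.presheaf.germ U x.1 hx ≫ X.V.left.presheaf.stalkSpecializes
      (specializes_of_eq (apply_of_mem_fixedLocus X x.2 g)) ≫ (X.ρ g).left.stalkMap x.1 =
      (X.ρ g).left.app U ≫ X.V.left.presheaf.germ ((X.ρ g).left ⁻¹ᵁ U) x.1
        (by change (X.ρ g).left x.1 ∈ U; rwa [apply_of_mem_fixedLocus X x.2 g]) := by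
    rw [TopCat.Presheaf.germ_stalkSpecializes_assoc, Scheme.Hom.germ_stalkMap]
  exact congrArg (fun f => f.hom s) h

instance (x : fixedLocus X) (g : G) : IsLocalHom (stalkAct X x g) := by
  have e : X.V.left.presheaf.stalkSpecializes
      (specializes_of_eq (apply_of_mem_fixedLocus X x.2 g)) =
      (X.V.left.presheaf.stalkCongr (Inseparable.of_eq (apply_of_mem_fixedLocus X x.2 g).symm)).hom :=
    rfl
  rw [stalkAct, e]
  infer_instance

/-- The pullback along `g` on the local ring at a fixed point, as a map of `K`-algebras. -/
def stalkActHom (x : fixedLocus X) (g : G) :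
    X.V.left.presheaf.stalk (x : X.V.left) →ₐ[K] X.V.left.presheaf.stalk (x : X.V.left) where
  __ := stalkAct X x g
  commutes' r := by
    change stalkAct X x g (X.V.left.presheaf.germ ⊤ x.1 trivial
      (X.V.hom.appTop ((Scheme.ΓSpecIso (.of K)).inv r))) = X.V.left.presheaf.germ ⊤ x.1 trivial
      (X.V.hom.appTop ((Scheme.ΓSpecIso (.of K)).inv r))
    refine (stalkAct_germ X x g ⊤ trivial _).trans ?_
    have h : X.V.hom.appTop ≫ (X.ρ g).left.appTop = X.V.hom.appTop := by
      rw [← Scheme.Hom.comp_appTop, Over.w]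
    exact congrArg (fun f => X.V.left.presheaf.germ ⊤ x.1 trivial
      (f.hom ((Scheme.ΓSpecIso (.of K)).inv r))) h

/-- The tangent space at a fixed point, the `K`-dual of `𝔪 / 𝔪 ^ 2` (it is used at rational points). -/
abbrev TangentSpace (x : fixedLocus X) : Type u :=
  Module.Dual K (IsLocalRing.CotangentSpace (X.V.left.presheaf.stalk (x : X.V.left)))

/-- The pullback along `g` on `𝔪 / 𝔪 ^ 2`. -/
def cotangentAct (x : fixedLocus X) (g : G) :
    IsLocalRing.CotangentSpace (X.V.left.presheaf.stalk (x : X.V.left)) →ₗ[K]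
      IsLocalRing.CotangentSpace (X.V.left.presheaf.stalk (x : X.V.left)) :=
  Ideal.mapCotangent _ _ (stalkActHom X x g)
    fun y hy => map_nonunit (stalkAct X x g) y hy

theorem germ_congr {Y : Scheme.{u}} {f f' : Y ⟶ Y} (e : f = f') (U : Y.Opens) (y : Y)
    (h : f y ∈ U) (s : Γ(Y, U)) :
    Y.presheaf.germ (f ⁻¹ᵁ U) y h (f.app U s) =
      Y.presheaf.germ (f' ⁻¹ᵁ U) y (by subst e; exact h) (f'.app U s) := by
  subst e; rfl

theorem stalkAct_one (x : fixedLocus X) (s : X.V.left.presheaf.stalk (x : X.V.left)) :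
    stalkAct X x 1 s = s := by
  obtain ⟨U, hU, s, rfl⟩ := X.V.left.presheaf.exists_germ_eq s
  rw [stalkAct_germ]
  have h : (X.ρ 1).left = 𝟙 X.V.left := by rw [map_one]; rfl
  exact (germ_congr h U _ _ s).trans rfl

theorem stalkAct_mul (x : fixedLocus X) (g h : G) (s : X.V.left.presheaf.stalk (x : X.V.left)) :
    stalkAct X x (g * h) s = stalkAct X x h (stalkAct X x g s) := by
  obtain ⟨U, hU, s, rfl⟩ := X.V.left.presheaf.exists_germ_eq s
  rw [stalkAct_germ, stalkAct_germ, stalkAct_germ]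
  have h : (X.ρ (g * h)).left = (X.ρ h).left ≫ (X.ρ g).left := by rw [map_mul]; rfl
  exact (germ_congr h U _ _ s).trans rfl

/-- The representation of `G` on the tangent space at a fixed point, by the differentials of the
elements of `G`. -/
def tangentRep (x : fixedLocus X) : Representation K G (TangentSpace X x) where
  toFun g := (cotangentAct X x g).dualMap
  map_one' := by
    ext φ v
    obtain ⟨v, rfl⟩ := Ideal.toCotangent_surjective _ v
    refine congrArg φ (congrArg (Ideal.toCotangent _) (Subtype.ext ?_))
    exact stalkAct_one X x v
  map_mul' g h := by
    ext φ v
    obtain ⟨v, rfl⟩ := Ideal.toCotangent_surjective _ v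
    refine congrArg φ (congrArg (Ideal.toCotangent _) (Subtype.ext ?_))
    exact stalkAct_mul X x g h v

end Tangent

/-- `X` and `Y` are `G`-fixed point equivalent, over the separable extension `L` of `K`: the fixed
loci are zero-dimensional and lie in the smooth loci, over `L` all fixed points are rational, and
there is a bijection between the fixed points over `L` under which the tangent spaces are isomorphic
as representations of `G` over `L`. -/
def FixedPointEquivalentOver (K L : Type u) [Field K] [Field L] [Algebra K L]
    (X Y : Action (Over (Spec (.of K))) G) : Prop :=
  topologicalKrullDim (fixedLocus X) = 0 ∧ topologicalKrullDim (fixedLocus Y) = 0 ∧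
  fixedLocus X ⊆ smoothSet X.V ∧ fixedLocus Y ⊆ smoothSet Y.V ∧
  Algebra.IsSeparable K L ∧
  (∀ x ∈ fixedLocus (baseChange K L X), IsRationalPoint (baseChange K L X).V x) ∧
  (∀ y ∈ fixedLocus (baseChange K L Y), IsRationalPoint (baseChange K L Y).V y) ∧
  ∃ e : fixedLocus (baseChange K L X) ≃ fixedLocus (baseChange K L Y),
    ∀ x, Nonempty ((tangentRep _ x).Equiv (tangentRep _ (e x)))

end Geometry


/-- Data for gluing a scheme: a ring `B` with `D`-homogeneous parts `H d`, and homogeneous elements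
`f c` of degree `w c`. The condition `units` says that every degree is the degree of a unit of the
localization `B[1 / f c]`; the scheme is glued from the spectra of the degree zero parts
of these localizations (the quotient of `⋃ D(f c) ⊆ Spec B` by the torus with character group `D`). -/
structure GradedCharts (k : Type u) [Field k] where
  B : Type u
  [ring : CommRing B]
  [alg : Algebra k B]
  D : Type
  [grp : AddCommGroup D]
  H : D → Submodule k B
  one_mem : (1 : B) ∈ H 0
  mul_mem : ∀ {d e : D} {x y : B}, x ∈ H d → y ∈ H e → x * y ∈ H (d + e)
  C : Type
  [dec : DecidableEq C]
  f : C → B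
  w : C → D
  f_mem : ∀ c, f c ∈ H (w c)
  units : ∀ (c : C) (d : D), ∃ (m : ℕ) (x y : B),
    x ∈ H (m • w c - d) ∧ y ∈ H (m • w c + d) ∧ x * y = f c ^ (2 * m)

attribute [instance] GradedCharts.ring GradedCharts.alg GradedCharts.grp GradedCharts.dec

namespace GradedCharts

variable {k : Type u} [Field k] (X : GradedCharts k)

def den (s : Finset X.C) : X.B := ∏ c ∈ s, X.f c

def deg (s : Finset X.C) : X.D := ∑ c ∈ s, X.w c

theorem pow_mem {d : X.D} {x : X.B} (hx : x ∈ X.H d) (m : ℕ) : x ^ m ∈ X.H (m • d) := by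
  induction m with
  | zero => simpa using X.one_mem
  | succ m ih => rw [pow_succ, succ_nsmul]; exact X.mul_mem ih hx

theorem den_mem (s : Finset X.C) : X.den s ∈ X.H (X.deg s) := by
  classical
  induction s using Finset.induction_on with
  | empty => simpa [den, deg] using X.one_mem
  | insert c s hc ih =>
    rw [den, deg, Finset.prod_insert hc, Finset.sum_insert hc]
    exact X.mul_mem (X.f_mem c) ih

theorem mem_of_eq {d e : X.D} {x : X.B} (hx : x ∈ X.H d) (h : d = e) : x ∈ X.H e := h ▸ hx

abbrev Loc (s : Finset X.C) : Type u := Localization.Away (X.den s)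

theorem algebraMap_smul_loc (s : Finset X.C) (r : k) (b : X.B) :
    algebraMap X.B (X.Loc s) (r • b) = r • algebraMap X.B (X.Loc s) b := by
  rw [Algebra.smul_def, map_mul, ← IsScalarTower.algebraMap_apply, ← Algebra.smul_def]

/-- The homogeneous elements of degree `d` of the localization of `B` at `∏ c ∈ s, f c`. -/
def HasDeg (s : Finset X.C) (d : X.D) (z : X.Loc s) : Prop :=
  ∃ (m : ℕ) (a : X.B), a ∈ X.H (m • X.deg s + d) ∧
    z * algebraMap X.B (X.Loc s) (X.den s) ^ m = algebraMap X.B (X.Loc s) a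

variable {X}

theorem HasDeg.of_eq {s : Finset X.C} {d e : X.D} {z : X.Loc s} (h : X.HasDeg s d z)
    (hde : d = e) : X.HasDeg s e z := hde ▸ h

theorem HasDeg.mul {s : Finset X.C} {d e : X.D} {z z' : X.Loc s} (h : X.HasDeg s d z)
    (h' : X.HasDeg s e z') : X.HasDeg s (d + e) (z * z') := by
  obtain ⟨m, a, ha, h⟩ := h
  obtain ⟨m', a', ha', h'⟩ := h'
  refine ⟨m + m', a * a', X.mem_of_eq (X.mul_mem ha ha') ?_, ?_⟩
  · rw [add_nsmul]; abel
  · rw [map_mul, ← h, ← h', pow_add]; ring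

theorem HasDeg.add {s : Finset X.C} {d : X.D} {z z' : X.Loc s} (h : X.HasDeg s d z)
    (h' : X.HasDeg s d z') : X.HasDeg s d (z + z') := by
  obtain ⟨m, a, ha, h⟩ := h
  obtain ⟨m', a', ha', h'⟩ := h'
  refine ⟨m + m', a * X.den s ^ m' + a' * X.den s ^ m, ?_, ?_⟩
  · refine add_mem (X.mem_of_eq (X.mul_mem ha (X.pow_mem (X.den_mem s) m')) ?_)
      (X.mem_of_eq (X.mul_mem ha' (X.pow_mem (X.den_mem s) m)) ?_) <;>
    · rw [add_nsmul]; abel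
  · rw [map_add, map_mul, map_mul, ← h, ← h', pow_add, map_pow, map_pow]; ring

theorem hasDeg_algebraMap (s : Finset X.C) {d : X.D} {b : X.B} (hb : b ∈ X.H d) :
    X.HasDeg s d (algebraMap X.B (X.Loc s) b) :=
  ⟨0, b, X.mem_of_eq hb (by simp), by simp⟩

theorem HasDeg.pow {s : Finset X.C} {d : X.D} {z : X.Loc s} (h : X.HasDeg s d z) (m : ℕ) :
    X.HasDeg s (m • d) (z ^ m) := by
  induction m with
  | zero =>
    rw [pow_zero, ← map_one (algebraMap X.B (X.Loc s))]
    exact (hasDeg_algebraMap s X.one_mem).of_eq (zero_smul _ _).symm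
  | succ m ih => rw [pow_succ, succ_nsmul]; exact ih.mul h

theorem hasDeg_inv (s : Finset X.C) :
    X.HasDeg s (-X.deg s) (IsLocalization.Away.invSelf (X.den s)) := by
  refine ⟨1, 1, X.mem_of_eq X.one_mem (by simp), ?_⟩
  rw [pow_one, map_one, mul_comm]
  exact IsLocalization.Away.mul_invSelf _

theorem den_mul_inv (s : Finset X.C) :
    algebraMap X.B (X.Loc s) (X.den s) * IsLocalization.Away.invSelf (X.den s) = 1 :=
  IsLocalization.Away.mul_invSelf _

variable (X)

/-- The degree zero part of the localization of `B` at `∏ c ∈ s, f c`, the coordinate ring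
of the intersection of the charts in `s`. -/
def chartRing (s : Finset X.C) : Subalgebra k (X.Loc s) where
  carrier := {z | X.HasDeg s 0 z}
  mul_mem' h h' := (h.mul h').of_eq (add_zero 0)
  add_mem' h h' := h.add h'
  algebraMap_mem' r := by
    change X.HasDeg s 0 _
    rw [IsScalarTower.algebraMap_apply k X.B (X.Loc s)]
    refine hasDeg_algebraMap s ?_
    rw [Algebra.algebraMap_eq_smul_one]
    exact Submodule.smul_mem _ _ X.one_mem

theorem den_sdiff {s t : Finset X.C} (hst : s ⊆ t) : X.den s * X.den (t \ s) = X.den t := by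
  rw [den, den, den, mul_comm, Finset.prod_sdiff hst]

theorem deg_sdiff {s t : Finset X.C} (hst : s ⊆ t) : X.deg s + X.deg (t \ s) = X.deg t := by
  rw [deg, deg, deg, add_comm, Finset.sum_sdiff hst]

/-- Graded algebra maps which multiply each `f c` by a unit; they act on all charts. -/
structure IsScaling (φ : X.B →ₐ[k] X.B) : Prop where
  mem : ∀ {d : X.D} {x : X.B}, x ∈ X.H d → φ x ∈ X.H d
  map_f : ∀ c, ∃ r : kˣ, φ (X.f c) = r • X.f c

variable {X}

theorem IsScaling.id : X.IsScaling (AlgHom.id k X.B) :=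
  ⟨fun h => h, fun _ => ⟨1, by simp⟩⟩

theorem IsScaling.map_den {φ : X.B →ₐ[k] X.B} (h : X.IsScaling φ) (s : Finset X.C) :
    ∃ r : kˣ, φ (X.den s) = r • X.den s := by
  choose r hr using h.map_f
  refine ⟨∏ c ∈ s, r c, ?_⟩
  rw [den, map_prod, Finset.prod_congr rfl fun c _ => hr c]
  classical
  induction s using Finset.induction_on with
  | empty => simp
  | insert c s hc ih =>
    rw [Finset.prod_insert hc, Finset.prod_insert hc, Finset.prod_insert hc, ih,
      smul_mul_smul_comm]

theorem loc_den {s t : Finset X.C} (hst : s ⊆ t) : algebraMap X.B (X.Loc t) (X.den s) *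
    algebraMap X.B (X.Loc t) (X.den (t \ s)) = algebraMap X.B (X.Loc t) (X.den t) := by
  rw [← map_mul, X.den_sdiff hst]

theorem isUnit_den {s t : Finset X.C} (hst : s ⊆ t) :
    IsUnit (algebraMap X.B (X.Loc t) (X.den s)) :=
  isUnit_of_mul_isUnit_left (loc_den hst ▸
    IsLocalization.Away.algebraMap_isUnit (S := X.Loc t) (X.den t))

theorem IsScaling.isUnit {φ : X.B →ₐ[k] X.B} (h : X.IsScaling φ) {s t : Finset X.C}
    (hst : s ⊆ t) :
    IsUnit ((IsScalarTower.toAlgHom k X.B (X.Loc t)).comp φ (X.den s)) := by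
  obtain ⟨r, hr⟩ := h.map_den s
  rw [AlgHom.comp_apply, hr, Units.smul_def, map_smul, Algebra.smul_def]
  exact (r.isUnit.map _).mul (isUnit_den hst)

def locMap {φ : X.B →ₐ[k] X.B} (h : X.IsScaling φ) {s t : Finset X.C} (hst : s ⊆ t) :
    X.Loc s →ₐ[k] X.Loc t :=
  IsLocalization.Away.liftAlgHom (X.den s) (h.isUnit hst)

theorem locMap_algebraMap {φ : X.B →ₐ[k] X.B} (h : X.IsScaling φ) {s t : Finset X.C}
    (hst : s ⊆ t) (b : X.B) :
    locMap h hst (algebraMap X.B (X.Loc s) b) = algebraMap X.B (X.Loc t) (φ b) := by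
  simp [locMap]

theorem HasDeg.locMap {φ : X.B →ₐ[k] X.B} (h : X.IsScaling φ) {s t : Finset X.C} (hst : s ⊆ t)
    {d : X.D} {z : X.Loc s} (hz : X.HasDeg s d z) : X.HasDeg t d (locMap h hst z) := by
  obtain ⟨m, a, ha, hz⟩ := hz
  obtain ⟨r, hr⟩ := h.map_den s
  refine ⟨m, ((r⁻¹ ^ m : kˣ) : k) • (φ a * X.den (t \ s) ^ m), ?_, ?_⟩
  · refine Submodule.smul_mem _ _ (X.mem_of_eq (X.mul_mem (h.mem ha) (X.pow_mem (X.den_mem _) m)) ?_)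
    rw [← X.deg_sdiff hst, smul_add]; abel
  · have := congrArg (GradedCharts.locMap h hst) hz
    rw [map_mul, map_pow, locMap_algebraMap, locMap_algebraMap, hr, Units.smul_def,
      X.algebraMap_smul_loc, smul_pow, mul_smul_comm] at this
    have hrr : ((r⁻¹ ^ m : kˣ) : k) * (r : k) ^ m = 1 := by
      rw [← Units.val_pow_eq_pow_val, ← Units.val_mul, ← mul_pow, inv_mul_cancel, one_pow,
        Units.val_one]
    rw [X.algebraMap_smul_loc, map_mul, ← this, ← loc_den hst, map_pow, smul_mul_assoc,
      smul_smul, hrr, one_smul]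
    ring

theorem locMap_id (s : Finset X.C) (z : X.Loc s) :
    locMap (IsScaling.id (X := X)) (le_refl s) z = z := by
  have : locMap (IsScaling.id (X := X)) (le_refl s) = AlgHom.id k (X.Loc s) := by
    refine IsLocalization.algHom_ext (Submonoid.powers (X.den s)) ?_
    ext b
    exact locMap_algebraMap (IsScaling.id (X := X)) (le_refl s) b
  rw [this]; rfl

theorem locMap_locMap {φ ψ χ : X.B →ₐ[k] X.B} (h : X.IsScaling φ) (h' : X.IsScaling ψ)
    (h'' : X.IsScaling χ) (e : ∀ b, χ b = ψ (φ b)) {s t v : Finset X.C} (hst : s ⊆ t)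
    (htv : t ⊆ v) (z : X.Loc s) :
    locMap h' htv (locMap h hst z) = locMap h'' (hst.trans htv) z := by
  have : (locMap h' htv).comp (locMap h hst) = locMap h'' (hst.trans htv) := by
    refine IsLocalization.algHom_ext (Submonoid.powers (X.den s)) ?_
    ext b
    change locMap h' htv (locMap h hst (algebraMap X.B (X.Loc s) b)) =
      locMap h'' (hst.trans htv) (algebraMap X.B (X.Loc s) b)
    rw [locMap_algebraMap, locMap_algebraMap, locMap_algebraMap, e]
  rw [← this]; rfl

/-- The map induced by `φ` on degree zero parts, combined with restriction from `s` to `t`. -/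
def chartMap {φ : X.B →ₐ[k] X.B} (h : X.IsScaling φ) {s t : Finset X.C} (hst : s ⊆ t) :
    X.chartRing s →ₐ[k] X.chartRing t :=
  ((locMap h hst).comp (X.chartRing s).val).codRestrict (X.chartRing t)
    fun z => HasDeg.locMap h hst z.2

theorem coe_chartMap {φ : X.B →ₐ[k] X.B} (h : X.IsScaling φ) {s t : Finset X.C} (hst : s ⊆ t)
    (z : X.chartRing s) : (chartMap h hst z : X.Loc t) = locMap h hst z := rfl

theorem chartMap_chartMap {φ ψ χ : X.B →ₐ[k] X.B} (h : X.IsScaling φ) (h' : X.IsScaling ψ)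
    (h'' : X.IsScaling χ) (e : ∀ b, χ b = ψ (φ b)) {s t v : Finset X.C} (hst : s ⊆ t)
    (htv : t ⊆ v) :
    (chartMap h' htv).comp (chartMap h hst) = chartMap h'' (hst.trans htv) := by
  ext z
  exact locMap_locMap h h' h'' e hst htv z

variable (X)

abbrev Index : Type := {s : Finset X.C // s.Nonempty}

def chartFunctor : X.Index ⥤ CommAlgCat.{u} k where
  obj s := CommAlgCat.of k (X.chartRing s.1)
  map {s t} h := CommAlgCat.ofHom (chartMap (IsScaling.id (X := X)) (leOfHom h))
  map_id s := by
    refine CommAlgCat.hom_ext ?_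
    ext z
    exact locMap_id s.1 z
  map_comp {s t v} f g := by
    refine CommAlgCat.hom_ext ?_
    exact (chartMap_chartMap (IsScaling.id (X := X)) (IsScaling.id (X := X))
      (IsScaling.id (X := X)) (fun _ => rfl) (leOfHom f) (leOfHom g)).symm

/-- The affine `k`-schemes given by the nonempty finite intersections of charts, with their inclusions. -/
def diagram : X.Indexᵒᵖ ⥤ Over (Spec (.of k)) :=
  X.chartFunctor.op ⋙ algSpec (.of k)

variable {X}

def chartTrans {φ : X.B →ₐ[k] X.B} (h : X.IsScaling φ) : X.chartFunctor ⟶ X.chartFunctor where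
  app s := CommAlgCat.ofHom (chartMap h (le_refl s.1))
  naturality s t f := by
    refine CommAlgCat.hom_ext ?_
    exact (chartMap_chartMap (IsScaling.id (X := X)) h h (fun _ => rfl) (leOfHom f)
      (le_refl t.1)).trans (chartMap_chartMap h (IsScaling.id (X := X)) h (fun _ => rfl)
      (le_refl s.1) (leOfHom f)).symm

def diagramTrans {φ : X.B →ₐ[k] X.B} (h : X.IsScaling φ) : X.diagram ⟶ X.diagram :=
  Functor.whiskerRight (NatTrans.op (chartTrans h)) (algSpec (.of k))

theorem exists_unit {s : Finset X.C} (hs : s.Nonempty) (d : X.D) :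
    ∃ y y' : X.Loc s, y * y' = 1 ∧ X.HasDeg s d y ∧ X.HasDeg s (-d) y' := by
  obtain ⟨c, hc⟩ := hs
  obtain ⟨m, a, b, ha, hb, hab⟩ := X.units c d
  have hcs : {c} ⊆ s := Finset.singleton_subset_iff.2 hc
  -- inverse of `f c` in the localization
  let i : X.Loc s := IsLocalization.Away.invSelf (X.den s) *
    algebraMap X.B (X.Loc s) (X.den (s \ {c}))
  have hi : X.HasDeg s (-X.w c) i := by
    refine ((hasDeg_inv s).mul (hasDeg_algebraMap s (X.den_mem _))).of_eq ?_
    rw [← X.deg_sdiff hcs, deg, Finset.sum_singleton]; abel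
  have hci : algebraMap X.B (X.Loc s) (X.f c) * i = 1 := by
    have := loc_den (t := s) hcs
    have e : X.den {c} = X.f c := Finset.prod_singleton _ _
    rw [e] at this
    rw [← den_mul_inv s, ← this]; ring
  refine ⟨algebraMap X.B (X.Loc s) b * i ^ m, algebraMap X.B (X.Loc s) a * i ^ m, ?_,
    ((hasDeg_algebraMap s hb).mul (hi.pow m)).of_eq ?_,
    ((hasDeg_algebraMap s ha).mul (hi.pow m)).of_eq ?_⟩
  · calc algebraMap X.B (X.Loc s) b * i ^ m * (algebraMap X.B (X.Loc s) a * i ^ m)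
        = algebraMap X.B (X.Loc s) (a * b) * i ^ (2 * m) := by rw [map_mul]; ring
      _ = 1 := by rw [hab, map_pow, ← mul_pow, hci, one_pow]
  · rw [smul_neg]; abel
  · rw [smul_neg]; abel

theorem isLocalization_chartMap {s t : Finset X.C} (hst : s ⊆ t) {y y' : X.Loc s}
    (hyy : y * y' = 1) (hy : X.HasDeg s (X.deg (t \ s)) y)
    (hy' : X.HasDeg s (-X.deg (t \ s)) y') (u : X.chartRing s)
    (hu : (u : X.Loc s) = algebraMap X.B (X.Loc s) (X.den (t \ s)) * y') :
    let _ := (chartMap (IsScaling.id (X := X)) hst).toRingHom.toAlgebra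
    IsLocalization.Away u (X.chartRing t) := by
  let τ := chartMap (IsScaling.id (X := X)) hst
  let _ := τ.toRingHom.toAlgebra
  have hτ : ∀ z : X.chartRing s, ((algebraMap (X.chartRing s) (X.chartRing t) z : X.chartRing t) :
    X.Loc t) = locMap (IsScaling.id (X := X)) hst z := fun _ => rfl
  set lm := locMap (IsScaling.id (X := X)) hst with hlm
  have hlb : ∀ b, lm (algebraMap X.B (X.Loc s) b) = algebraMap X.B (X.Loc t) b :=
    locMap_algebraMap _ hst
  -- inverse of `den (t \ s)` in the bigger localization
  let j : X.Loc t := algebraMap X.B (X.Loc t) (X.den s) * IsLocalization.Away.invSelf (X.den t)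
  have hj : X.HasDeg t (-X.deg (t \ s)) j := by
    refine ((hasDeg_algebraMap t (X.den_mem s)).mul (hasDeg_inv t)).of_eq ?_
    rw [← X.deg_sdiff hst]; abel
  have hgj : algebraMap X.B (X.Loc t) (X.den (t \ s)) * j = 1 := by
    rw [← den_mul_inv t, ← loc_den hst]; ring
  have hlu : lm u = algebraMap X.B (X.Loc t) (X.den (t \ s)) * lm y' := by
    rw [hu, map_mul, hlb]
  have hlyy : lm y * lm y' = 1 := by rw [← map_mul, hyy, map_one]
  refine (isLocalization_iff _ _).2 ⟨?_, ?_, ?_⟩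
  · rintro ⟨_, n, rfl⟩
    rw [map_pow]
    refine IsUnit.pow _ (IsUnit.of_mul_eq_one (⟨lm y * j, ?_⟩ : X.chartRing t) ?_)
    · exact ((hy.locMap (IsScaling.id (X := X)) hst).mul hj).of_eq (add_neg_cancel _)
    · refine Subtype.ext ?_
      change ((algebraMap (X.chartRing s) (X.chartRing t) u : X.chartRing t) : X.Loc t) *
        (lm y * j) = 1
      rw [hτ, hlu]
      calc _ = (algebraMap X.B (X.Loc t) (X.den (t \ s)) * j) * (lm y * lm y') := by ring
        _ = 1 := by rw [hgj, hlyy, one_mul]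
  · rintro ⟨z, m, a, ha, hz⟩
    refine ⟨⟨⟨y' ^ m * algebraMap X.B (X.Loc s) a *
      IsLocalization.Away.invSelf (X.den s) ^ m, ?_⟩, ⟨u ^ m, m, rfl⟩⟩, ?_⟩
    · refine (((hy'.pow m).mul (hasDeg_algebraMap s ha)).mul ((hasDeg_inv s).pow m)).of_eq ?_
      rw [← X.deg_sdiff hst, smul_add, smul_neg, smul_neg]; abel
    · refine Subtype.ext ?_
      rw [hτ]
      change z * ((algebraMap (X.chartRing s) (X.chartRing t) (u ^ m) : X.chartRing t) : X.Loc t)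
        = _
      rw [hτ]
      change z * lm ((u : X.Loc s) ^ m) = lm _
      rw [map_pow, hlu, map_mul, map_mul, hlb, ← hz, ← loc_den hst, map_pow, map_pow]
      have e : algebraMap X.B (X.Loc t) (X.den s) *
          lm (IsLocalization.Away.invSelf (X.den s)) = 1 := by
        rw [← hlb, ← map_mul, den_mul_inv, map_one]
      calc z * (algebraMap X.B (X.Loc t) (X.den (t \ s)) * lm y') ^ m
          = z * (algebraMap X.B (X.Loc t) (X.den (t \ s)) * lm y') ^ m *
            (algebraMap X.B (X.Loc t) (X.den s) *
              lm (IsLocalization.Away.invSelf (X.den s))) ^ m := by rw [e, one_pow, mul_one]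
        _ = _ := by ring
  · intro z₁ z₂ h
    have h : lm z₁ = lm z₂ := congrArg Subtype.val h
    obtain ⟨m₁, a₁, -, h₁⟩ := z₁.2
    obtain ⟨m₂, a₂, -, h₂⟩ := z₂.2
    have e : algebraMap X.B (X.Loc t) (a₁ * X.den s ^ m₂) =
        algebraMap X.B (X.Loc t) (a₂ * X.den s ^ m₁) := by
      rw [← hlb, ← hlb, map_mul (algebraMap X.B (X.Loc s)), map_mul (algebraMap X.B (X.Loc s)),
        ← h₁, ← h₂]
      simp only [map_mul, map_pow, h]
      ring
    obtain ⟨⟨_, n, rfl⟩, hn⟩ := IsLocalization.exists_of_eq (M := Submonoid.powers (X.den t)) e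
    refine ⟨⟨u ^ n, n, rfl⟩, Subtype.ext ?_⟩
    change (u : X.Loc s) ^ n * (z₁ : X.Loc s) = (u : X.Loc s) ^ n * (z₂ : X.Loc s)
    have hn' := congrArg (algebraMap X.B (X.Loc s)) hn
    simp only [map_mul, map_pow, ← h₁, ← h₂, ← X.den_sdiff hst] at hn'
    have hd : IsUnit (algebraMap X.B (X.Loc s) (X.den s)) := isUnit_den (le_refl s)
    refine ((hd.pow (n + m₁ + m₂)).mul_right_inj).1 ?_
    rw [hu]
    linear_combination y' ^ n * hn'

variable (X) in
theorem isOpenImmersion_chartMap {s t : Finset X.C} (hs : s.Nonempty) (hst : s ⊆ t) :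
    IsOpenImmersion (Spec.map (CommRingCat.ofHom
      (chartMap (IsScaling.id (X := X)) hst).toRingHom)) := by
  obtain ⟨y, y', hyy, hy, hy'⟩ := exists_unit hs (X.deg (t \ s))
  let u : X.chartRing s := ⟨algebraMap X.B (X.Loc s) (X.den (t \ s)) * y',
    ((hasDeg_algebraMap s (X.den_mem _)).mul hy').of_eq (add_neg_cancel _)⟩
  let _ := (chartMap (IsScaling.id (X := X)) hst).toRingHom.toAlgebra
  have := isLocalization_chartMap hst hyy hy hy' u rfl
  exact IsOpenImmersion.of_isLocalization u

theorem exists_point {r s t : Finset X.C} (hr : r.Nonempty) (hrs : r ⊆ s) (hrt : r ⊆ t)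
    (x : PrimeSpectrum (X.chartRing r))
    (hs : x ∈ Set.range (PrimeSpectrum.comap
      (chartMap (IsScaling.id (X := X)) hrs).toRingHom))
    (ht : x ∈ Set.range (PrimeSpectrum.comap
      (chartMap (IsScaling.id (X := X)) hrt).toRingHom)) :
    x ∈ Set.range (PrimeSpectrum.comap
      (chartMap (IsScaling.id (X := X)) (hrs.trans Finset.subset_union_left :
        r ⊆ s ∪ t)).toRingHom) := by
  choose y y' hyy hy hy' using fun t : Finset X.C => exists_unit hr (X.deg (t \ r))
  let u (t : Finset X.C) : X.chartRing r := ⟨algebraMap X.B (X.Loc r) (X.den (t \ r)) * y' t,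
    ((hasDeg_algebraMap r (X.den_mem _)).mul (hy' t)).of_eq (add_neg_cancel _)⟩
  have key : ∀ {t : Finset X.C} (h : r ⊆ t), Set.range (PrimeSpectrum.comap
      (chartMap (IsScaling.id (X := X)) h).toRingHom) = PrimeSpectrum.basicOpen (u t) := by
    intro t h
    let _ := (chartMap (IsScaling.id (X := X)) h).toRingHom.toAlgebra
    have := isLocalization_chartMap h (hyy t) (hy t) (hy' t) (u t) rfl
    exact PrimeSpectrum.localization_away_comap_range _ (u t)
  rw [key] at hs ht ⊢
  let v : X.chartRing r := ⟨y' s * y' t * y (s ∪ t) *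
      algebraMap X.B (X.Loc r) (X.den ((s \ r) ∩ (t \ r))),
    ((((hy' s).mul (hy' t)).mul (hy (s ∪ t))).mul (hasDeg_algebraMap r (X.den_mem _))).of_eq (by
      have : X.deg ((s ∪ t) \ r) + X.deg ((s \ r) ∩ (t \ r)) = X.deg (s \ r) + X.deg (t \ r) := by
        rw [Finset.union_sdiff_distrib]; exact Finset.sum_union_inter
      rw [add_assoc, this]; abel)⟩
  have huv : u s * u t = u (s ∪ t) * v := by
    refine Subtype.ext ?_
    have : X.den ((s ∪ t) \ r) * X.den ((s \ r) ∩ (t \ r)) = X.den (s \ r) * X.den (t \ r) := by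
      rw [Finset.union_sdiff_distrib]; exact Finset.prod_union_inter
    have := congrArg (algebraMap X.B (X.Loc r)) this
    rw [map_mul, map_mul] at this
    change algebraMap X.B (X.Loc r) (X.den (s \ r)) * y' s *
      (algebraMap X.B (X.Loc r) (X.den (t \ r)) * y' t) =
      algebraMap X.B (X.Loc r) (X.den ((s ∪ t) \ r)) * y' (s ∪ t) * (y' s * y' t * y (s ∪ t) *
      algebraMap X.B (X.Loc r) (X.den ((s \ r) ∩ (t \ r))))
    linear_combination (-(y' s * y' t)) * this - (y' s * y' t *
      algebraMap X.B (X.Loc r) (X.den ((s ∪ t) \ r)) *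
      algebraMap X.B (X.Loc r) (X.den ((s \ r) ∩ (t \ r)))) * hyy (s ∪ t)
  have hmem : u s * u t ∉ x.asIdeal := fun h => (x.isPrime.mem_or_mem h).elim hs ht
  rw [huv] at hmem
  exact fun h => hmem (Ideal.mul_mem_right _ _ h)

instance {i j : X.Indexᵒᵖ} (f : i ⟶ j) : IsOpenImmersion (X.diagram.map f).left :=
  X.isOpenImmersion_chartMap j.unop.2 (leOfHom f.unop)

instance : (X.diagram ⋙ Over.forget _ ⋙ Scheme.forget).IsLocallyDirected where
  cond := by
    intro i j l fi fj xi xj hx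
    have hi := leOfHom fi.unop
    have hj := leOfHom fj.unop
    let m : X.Indexᵒᵖ := Opposite.op ⟨i.unop.1 ∪ j.unop.1, i.unop.2.mono Finset.subset_union_left⟩
    let mi : m ⟶ i := (homOfLE (Finset.subset_union_left : i.unop.1 ⊆ i.unop.1 ∪ j.unop.1) :
      i.unop ⟶ m.unop).op
    let mj : m ⟶ j := (homOfLE (Finset.subset_union_right : j.unop.1 ⊆ i.unop.1 ∪ j.unop.1) :
      j.unop ⟶ m.unop).op
    obtain ⟨y, hy⟩ := exists_point l.unop.2 hi hj ((X.diagram ⋙ Over.forget _ ⋙ Scheme.forget).map fi xi)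
      ⟨xi, rfl⟩ ⟨xj, hx.symm⟩
    have inj : ∀ {a b : X.Indexᵒᵖ} (f : a ⟶ b), Function.Injective
      ((X.diagram ⋙ Over.forget _ ⋙ Scheme.forget).map f) := fun f =>
        (X.diagram.map f).left.isOpenEmbedding.injective
    have hy1 : (X.diagram ⋙ Over.forget _ ⋙ Scheme.forget).map (mi ≫ fi) y =
      (X.diagram ⋙ Over.forget _ ⋙ Scheme.forget).map fi xi := hy
    refine ⟨m, mi, mj, y, inj fi ?_, inj fj ?_⟩
    · rw [← hy1, Functor.map_comp]; rfl
    · rw [← hx, ← hy1, Subsingleton.elim (mi ≫ fi) (mj ≫ fj), Functor.map_comp]; rfl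

variable (X)

/-- The `k`-scheme glued from the charts. -/
abbrev glued : Over (Spec (.of k)) := colimit X.diagram

variable {X}

/-- The endomorphism of the glued scheme which is given by `φ` on coordinates. -/
def gluedMap {φ : X.B →ₐ[k] X.B} (h : X.IsScaling φ) : X.glued ⟶ X.glued :=
  colimMap (diagramTrans h)

theorem ι_gluedMap {φ : X.B →ₐ[k] X.B} (h : X.IsScaling φ) (i : X.Indexᵒᵖ) :
    colimit.ι X.diagram i ≫ gluedMap h = (diagramTrans h).app i ≫ colimit.ι X.diagram i :=
  ι_colimMap _ _

theorem gluedMap_id (h : X.IsScaling (AlgHom.id k X.B)) : gluedMap h = 𝟙 X.glued := by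
  refine colimit.hom_ext fun i => ?_
  have : (diagramTrans h).app i = 𝟙 _ := by
    have e : (chartTrans h).app i.unop = 𝟙 _ := X.chartFunctor.map_id i.unop
    change (algSpec (.of k)).map ((chartTrans h).app i.unop).op = _
    rw [e]
    exact (algSpec (.of k)).map_id _
  rw [ι_gluedMap, this, Category.id_comp]
  exact (Category.comp_id _).symm

theorem gluedMap_comp {φ ψ χ : X.B →ₐ[k] X.B} (h : X.IsScaling φ) (h' : X.IsScaling ψ)
    (h'' : X.IsScaling χ) (e : ∀ b, χ b = φ (ψ b)) :
    gluedMap h ≫ gluedMap h' = gluedMap h'' := by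
  refine colimit.hom_ext fun i => ?_
  have : (diagramTrans h).app i ≫ (diagramTrans h').app i = (diagramTrans h'').app i := by
    have e : (chartTrans h').app i.unop ≫ (chartTrans h).app i.unop =
        (chartTrans h'').app i.unop :=
      CommAlgCat.hom_ext (chartMap_chartMap h' h h'' e (le_refl _) (le_refl _))
    change (algSpec (.of k)).map ((chartTrans h).app i.unop).op ≫
      (algSpec (.of k)).map ((chartTrans h').app i.unop).op =
      (algSpec (.of k)).map ((chartTrans h'').app i.unop).op
    rw [← e, ← Functor.map_comp, ← op_comp]
  rw [← Category.assoc, ι_gluedMap, Category.assoc, ι_gluedMap, ← Category.assoc, this,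
    ι_gluedMap]

variable (X) in
/-- The action of a commutative group `G` on the glued scheme which is given by `φ g` on coordinates. -/
def gluedAction (G : Type u) [CommGroup G] (φ : G → (X.B →ₐ[k] X.B))
    (h : ∀ g, X.IsScaling (φ g)) (h1 : ∀ b, φ 1 b = b)
    (hm : ∀ g g' b, φ (g * g') b = φ g (φ g' b)) : Action (Over (Spec (.of k))) G where
  V := X.glued
  ρ :=
  { toFun g := gluedMap (h g)
    map_one' := by
      have e : φ 1 = AlgHom.id k X.B := AlgHom.ext h1
      have : ∀ (ψ : X.B →ₐ[k] X.B) (hψ : X.IsScaling ψ), ψ = AlgHom.id k X.B →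
          gluedMap hψ = 𝟙 X.glued := by
        rintro _ hψ rfl
        exact gluedMap_id hψ
      exact this _ _ e
    map_mul' g g' :=
      (gluedMap_comp (h g') (h g) (h (g * g')) fun b => by rw [mul_comm g g', hm]).symm }

end GradedCharts

open MvPolynomial

/-- The group `G = μ_p ^ n`. -/
abbrev MuPow (k : Type u) [Field k] (p n : ℕ) : Type u := Fin n → rootsOfUnity p k

variable {k : Type u} [Field k] {p n : ℕ}

/-- A `G`-equivariant line bundle `⨂ i, e_i ^ deg i ⊗ χ` on a tower of projective bundles: `e_i` is the
tautological line bundle of the `i`-th step of the tower and `chr` is the character `χ` of `G`. -/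
structure LineBundle (k : Type u) [Field k] (p n : ℕ) where
  deg : ℕ → ℤ
  chr : MuPow k p n →* kˣ

namespace LineBundle

/-- The trivial bundle with the trivial action. -/
def trivial : LineBundle k p n := ⟨0, 1⟩

/-- The tensor power of a line bundle. -/
def pow (L : LineBundle k p n) (i : ℕ) : LineBundle k p n := ⟨i • L.deg, L.chr ^ i⟩

theorem chr_pow (L : LineBundle k p n) (g : MuPow k p n) : (L.chr g : k) ^ p = 1 := by
  have : g ^ p = 1 := funext fun i => Subtype.ext ((mem_rootsOfUnity p _).1 (g i).2)
  rw [← Units.val_pow_eq_pow_val, ← map_pow, this, map_one, Units.val_one]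

end LineBundle

/-- A tower of projective bundles over `Spec k`: the `j`-th entry is a list of line bundles `M_{j,a}` on
the previous stage (their degrees in `e_i` are used for `i < j` only), and the
`j`-th stage is the bundle `ℙ(⨁ a, M_{j,a})` of lines in `⨁ a, M_{j,a}`. -/
abbrev Tower (k : Type u) [Field k] (p n : ℕ) : Type u := List (List (LineBundle k p n))

namespace Tower

variable (T : Tower k p n)

def bundle (j a : ℕ) : LineBundle k p n := (T.getD j []).getD a LineBundle.trivial

/-- The multihomogeneous coordinates of a tower: the coordinate `(j, a)` is the component `e_j → M_{j,a}` of the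
inclusion of the tautological line bundle `e_j` in `⨁ a, M_{j,a}`. -/
abbrev Coord : Type := Σ j : Fin T.length, Fin (T.get j).length

abbrev CoordRing : Type u := MvPolynomial T.Coord k

/-- The degree of the coordinate `(j, a)`, normalized so that a function on (the total space of) the line
bundle `∏ e_i ^ d_i`, linear on the fibres, has degree `d`: it is the `j`-th unit vector minus the
degree of `M_{j,a}`. -/
def wt (c : T.Coord) : Fin T.length → ℤ := fun i =>
  if i = c.1 then 1 else if i < c.1 then -(T.bundle c.1 c.2).deg i else 0

/-- The standard charts: one coordinate is invertible at each step. -/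
abbrev Chart : Type := ∀ j : Fin T.length, Fin (T.get j).length

def chartEqn (c : T.Chart) : T.CoordRing := ∏ j, X ⟨j, c j⟩

def chartWt (c : T.Chart) : Fin T.length → ℤ := ∑ j, T.wt ⟨j, c j⟩

theorem chartEqn_mem (c : T.Chart) :
    T.chartEqn c ∈ weightedHomogeneousSubmodule k T.wt (T.chartWt c) :=
  IsWeightedHomogeneous.prod _ _ _ fun j _ => isWeightedHomogeneous_X k T.wt ⟨j, c j⟩

def unitDegrees (c : T.Chart) : AddSubgroup (Fin T.length → ℤ) where
  carrier := {d | ∃ (m : ℕ) (x y : T.CoordRing),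
    x ∈ weightedHomogeneousSubmodule k T.wt (m • T.chartWt c - d) ∧
    y ∈ weightedHomogeneousSubmodule k T.wt (m • T.chartWt c + d) ∧
    x * y = T.chartEqn c ^ (2 * m)}
  zero_mem' := ⟨0, 1, 1, by simpa using isWeightedHomogeneous_one k T.wt,
    by simpa using isWeightedHomogeneous_one k T.wt, by simp⟩
  add_mem' := by
    rintro d e ⟨m, x, y, hx, hy, h⟩ ⟨m', x', y', hx', hy', h'⟩
    refine ⟨m + m', x * x', y * y', ?_, ?_, ?_⟩
    · have := IsWeightedHomogeneous.mul hx hx'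
      rw [mem_weightedHomogeneousSubmodule]
      convert this using 1
      rw [add_nsmul]; abel
    · have := IsWeightedHomogeneous.mul hy hy'
      rw [mem_weightedHomogeneousSubmodule]
      convert this using 1
      rw [add_nsmul]; abel
    · rw [mul_mul_mul_comm, h, h', ← pow_add, mul_add]
  neg_mem' := by
    rintro d ⟨m, x, y, hx, hy, h⟩
    exact ⟨m, y, x, by rwa [sub_neg_eq_add], by rwa [← sub_eq_add_neg], by rw [mul_comm, h]⟩

theorem wt_mem_unitDegrees (c : T.Chart) (j : Fin T.length) :
    T.wt ⟨j, c j⟩ ∈ T.unitDegrees c := by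
  have h1 : T.chartEqn c = X ⟨j, c j⟩ * ∏ i ∈ Finset.univ.erase j, X ⟨i, c i⟩ :=
    (Finset.mul_prod_erase _ _ (Finset.mem_univ j)).symm
  have h2 : T.chartWt c = T.wt ⟨j, c j⟩ + ∑ i ∈ Finset.univ.erase j, T.wt ⟨i, c i⟩ :=
    (Finset.add_sum_erase _ _ (Finset.mem_univ j)).symm
  have h3 : IsWeightedHomogeneous T.wt
      (∏ i ∈ Finset.univ.erase j, (X ⟨i, c i⟩ : T.CoordRing))
      (∑ i ∈ Finset.univ.erase j, T.wt ⟨i, c i⟩) :=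
    IsWeightedHomogeneous.prod _ _ _ fun i _ => isWeightedHomogeneous_X k T.wt ⟨i, c i⟩
  refine ⟨1, ∏ i ∈ Finset.univ.erase j, X ⟨i, c i⟩, T.chartEqn c * X ⟨j, c j⟩, ?_, ?_, ?_⟩
  · rw [mem_weightedHomogeneousSubmodule, one_smul, h2, add_sub_cancel_left]
    exact h3
  · rw [mem_weightedHomogeneousSubmodule, one_smul]
    exact (T.chartEqn_mem c).mul (isWeightedHomogeneous_X k T.wt _)
  · rw [h1]; ring

theorem single_mem_unitDegrees (c : T.Chart) (j : Fin T.length) :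
    (Pi.single j 1 : Fin T.length → ℤ) ∈ T.unitDegrees c := by
  suffices H : ∀ (N : ℕ) (j : Fin T.length), (j : ℕ) = N →
      (Pi.single j 1 : Fin T.length → ℤ) ∈ T.unitDegrees c from H _ j rfl
  intro N
  induction N using Nat.strong_induction_on with
  | _ N ih =>
    intro j hj
    have h : (Pi.single j 1 : Fin T.length → ℤ) = T.wt ⟨j, c j⟩ +
        ∑ i : Fin T.length, (if i < j then (T.bundle j (c j)).deg i else 0) •
          (Pi.single i 1 : Fin T.length → ℤ) := by
      funext i
      rw [Pi.add_apply, Finset.sum_apply, Finset.sum_eq_single i]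
      · rcases lt_trichotomy i j with hij | rfl | hij
        · simp [wt, hij, hij.ne]
        · simp [wt]
        · simp [wt, hij.ne', hij.not_gt]
      · intro i' _ hi'
        simp [Pi.single_eq_of_ne hi'.symm]
      · intro hi
        exact absurd (Finset.mem_univ i) hi
    rw [h]
    refine add_mem (T.wt_mem_unitDegrees c j) (sum_mem fun i _ => ?_)
    split_ifs with hij
    · exact zsmul_mem (ih i (hj ▸ hij) i rfl) _
    · rw [zero_smul]; exact zero_mem _

theorem mem_unitDegrees (c : T.Chart) (d : Fin T.length → ℤ) : d ∈ T.unitDegrees c := by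
  rw [← Finset.univ_sum_single d]
  refine sum_mem fun j _ => ?_
  have := zsmul_mem (T.single_mem_unitDegrees c j) (d j)
  rwa [← Pi.single_smul, smul_eq_mul, mul_one] at this

variable (I : Ideal T.CoordRing)

/-- The charts of the closed subscheme given by a homogeneous ideal `I`. -/
def gradedCharts : GradedCharts k where
  B := T.CoordRing ⧸ I
  D := Fin T.length → ℤ
  H d := (weightedHomogeneousSubmodule k T.wt d).map (Ideal.Quotient.mkₐ k I).toLinearMap
  one_mem := ⟨1, isWeightedHomogeneous_one k T.wt, map_one (Ideal.Quotient.mk I)⟩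
  mul_mem := by
    rintro d e _ _ ⟨x, hx, rfl⟩ ⟨y, hy, rfl⟩
    exact ⟨x * y, IsWeightedHomogeneous.mul hx hy, map_mul (Ideal.Quotient.mk I) _ _⟩
  C := T.Chart
  f c := Ideal.Quotient.mk I (T.chartEqn c)
  w := T.chartWt
  f_mem c := ⟨_, T.chartEqn_mem c, rfl⟩
  units c d := by
    obtain ⟨m, x, y, hx, hy, h⟩ := T.mem_unitDegrees c d
    exact ⟨m, _, _, ⟨x, hx, rfl⟩, ⟨y, hy, rfl⟩, by
      change Ideal.Quotient.mk I x * Ideal.Quotient.mk I y = _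
      rw [← map_mul, h, map_pow]⟩

/-- The action of `G` on the coordinates, the coordinate `(j, a)` being multiplied by
the character of `M_{j,a}`. -/
def act (g : MuPow k p n) : T.CoordRing →ₐ[k] T.CoordRing :=
  aeval fun c => C ((T.bundle c.1 c.2).chr g : k) * X c

theorem act_one (x : T.CoordRing) : T.act 1 x = x := by
  have : T.act 1 = AlgHom.id k _ := by
    refine MvPolynomial.algHom_ext fun c => ?_
    simp [act]
  rw [this]; rfl

theorem act_mul (g g' : MuPow k p n) (x : T.CoordRing) :
    T.act (g * g') x = T.act g (T.act g' x) := by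
  have : T.act (g * g') = (T.act g).comp (T.act g') := by
    refine MvPolynomial.algHom_ext fun c => ?_
    simp [act, algHom_C]
    ring
  rw [this]; rfl

theorem act_mem (g : MuPow k p n) {d : Fin T.length → ℤ} {x : T.CoordRing}
    (hx : x ∈ weightedHomogeneousSubmodule k T.wt d) :
    T.act g x ∈ weightedHomogeneousSubmodule k T.wt d := by
  have hm : ∀ (v : T.Coord →₀ ℕ) (a : k), ∃ b : k, T.act g (monomial v a) = monomial v b := by
    intro v a
    refine ⟨a * v.prod fun c e => ((T.bundle c.1 c.2).chr g : k) ^ e, ?_⟩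
    rw [act, aeval_monomial, monomial_eq, map_mul, algebraMap_eq, mul_assoc]
    simp only [mul_pow, Finsupp.prod, Finset.prod_mul_distrib, map_prod, map_pow]
  rw [x.as_sum, map_sum]
  refine Submodule.sum_mem _ fun v hv => ?_
  obtain ⟨b, hb⟩ := hm v (coeff v x)
  rw [hb]
  exact isWeightedHomogeneous_monomial _ _ _ (hx (mem_support_iff.1 hv))

theorem act_chartEqn (g : MuPow k p n) (c : T.Chart) :
    T.act g (T.chartEqn c) = C ((∏ j : Fin T.length, (T.bundle j (c j)).chr g : kˣ) : k) * T.chartEqn c := by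
  rw [chartEqn, map_prod, Units.coe_prod, map_prod, ← Finset.prod_mul_distrib]
  exact Finset.prod_congr rfl fun j _ => aeval_X _ _

theorem mk_act_chartEqn (g : MuPow k p n) (c : T.Chart) :
    Ideal.Quotient.mk I (T.act g (T.chartEqn c)) =
      (∏ j : Fin T.length, (T.bundle j (c j)).chr g) • Ideal.Quotient.mk I (T.chartEqn c) := by
  rw [act_chartEqn, ← smul_eq_C_mul]
  rfl

theorem isScaling (g : MuPow k p n) (h : I ≤ I.comap (T.act g)) :
    (T.gradedCharts I).IsScaling (Ideal.quotientMapₐ I (T.act g) h) where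
  mem := by
    rintro d _ ⟨x, hx, rfl⟩
    exact ⟨T.act g x, T.act_mem g hx, rfl⟩
  map_f c := ⟨_, T.mk_act_chartEqn I g c⟩

/-- The closed subscheme of the tower given by the ideal `I`, with its `G`-action. -/
def subvariety (h : ∀ g, I ≤ I.comap (T.act g)) : Action (Over (Spec (.of k))) (MuPow k p n) :=
  (T.gradedCharts I).gluedAction (MuPow k p n) (fun g => Ideal.quotientMapₐ I (T.act g) (h g))
    (fun g => T.isScaling I g (h g))
    (by
      intro b
      obtain ⟨x, rfl⟩ := Ideal.Quotient.mk_surjective b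
      exact congrArg (Ideal.Quotient.mk I) (T.act_one x))
    (by
      intro g g' b
      obtain ⟨x, rfl⟩ := Ideal.Quotient.mk_surjective b
      exact congrArg (Ideal.Quotient.mk I) (T.act_mul g g' x))

/-- The last stage of the tower, with its `G`-action. -/
def variety : Action (Over (Spec (.of k))) (MuPow k p n) := T.subvariety ⊥ fun _ => bot_le

/-- Polynomials in variables `X (j, a)` as multihomogeneous polynomials on the tower. -/
def toCoordRing : MvPolynomial (ℕ × ℕ) k →ₐ[k] T.CoordRing :=
  aeval fun v => if h : ∃ h : v.1 < T.length, v.2 < (T.get ⟨v.1, h⟩).length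
    then X ⟨⟨v.1, h.1⟩, ⟨v.2, h.2⟩⟩ else 0

/-- The action of `G` on polynomials in the variables `X (j, a)`. -/
def polyAct (g : MuPow k p n) : MvPolynomial (ℕ × ℕ) k →ₐ[k] MvPolynomial (ℕ × ℕ) k :=
  aeval fun v => C ((T.bundle v.1 v.2).chr g : k) * X v

theorem toCoordRing_polyAct (g : MuPow k p n) (F : MvPolynomial (ℕ × ℕ) k) :
    T.toCoordRing (T.polyAct g F) = T.act g (T.toCoordRing F) := by
  have : (T.toCoordRing).comp (T.polyAct g) = (T.act g).comp T.toCoordRing := by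
    refine MvPolynomial.algHom_ext fun v => ?_
    simp only [AlgHom.comp_apply, polyAct, aeval_X, map_mul, algHom_C, toCoordRing,
      algebraMap_eq]
    split_ifs with h
    · simp [act]
    · simp
  exact congrArg (fun f => f F) this

/-- The hypersurface `F = 0` in the last stage of the tower, for a `G`-invariant `F`. -/
def hypersurface (F : MvPolynomial (ℕ × ℕ) k) (hF : ∀ g, T.polyAct g F = F) :
    Action (Over (Spec (.of k))) (MuPow k p n) :=
  T.subvariety (Ideal.span {T.toCoordRing F}) fun g => by
    rw [Ideal.span_singleton_le_iff_mem, Ideal.mem_comap]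
    rw [← toCoordRing_polyAct, hF]
    exact Ideal.mem_span_singleton_self _

end Tower

/-- An equivariant line bundle `L` with a `G`-invariant `p`-form `φ : L ^ p → 𝒪`. The form is given by a polynomial
in the coordinates, whose degree is `p` times that of `L`; `form_mem` makes it invariant. -/
structure FormedBundle (k : Type u) [Field k] (p n : ℕ) extends LineBundle k p n where
  form : MvPolynomial (ℕ × ℕ) k
  form_mem : form ∈ Algebra.adjoin k
    (Set.range fun v : ℕ × ℕ => (X v : MvPolynomial (ℕ × ℕ) k) ^ p)

namespace FormedBundle

def trivial : FormedBundle k p n := ⟨.trivial, 1, one_mem _⟩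

/-- The tensor product `(L ⊗ M, φ_L ⊗ φ_M)`. -/
def tensor (L M : FormedBundle k p n) : FormedBundle k p n :=
  ⟨⟨L.deg + M.deg, L.chr * M.chr⟩, L.form * M.form, mul_mem L.form_mem M.form_mem⟩

/-- The tautological line bundle of `ℙ(𝒪 ⊕ L)` (at step `N` of a tower), with its canonical `p`-form
`(t₀, t₁) ↦ t₀ ^ p - φ_L(t₁)`. -/
def tautological (N : ℕ) (L : FormedBundle k p n) : FormedBundle k p n :=
  ⟨⟨Pi.single N 1, 1⟩, X (N, 0) ^ p - L.form * X (N, 1) ^ p,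
    sub_mem (Algebra.subset_adjoin ⟨_, rfl⟩)
      (mul_mem L.form_mem (Algebra.subset_adjoin ⟨_, rfl⟩))⟩

/-- The trivial line bundle, on which the `i`-th factor of `μ_p ^ n` acts by multiplication, with
the `p`-form `t ↦ a i * t ^ p`. -/
def ofUnit (a : Fin n → kˣ) (i : Fin n) : FormedBundle k p n :=
  ⟨⟨0, (rootsOfUnity p k).subtype.comp (Pi.evalMonoidHom _ i)⟩, C (a i : k),
    Subalgebra.algebraMap_mem _ (a i : k)⟩

/-- The bundles `H_1, …, H_n` given by the units `a`. -/
def base (a : Fin n → kˣ) (i : ℕ) : FormedBundle k p n :=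
  if h : 1 ≤ i ∧ i ≤ n then ofUnit a ⟨i - 1, by omega⟩ else trivial

end FormedBundle

/-- A construction which takes a tower with last stage `S` to a tower over it with last stage `S'`,
together with a line bundle with `p`-form on `S'`. To form the product of such varieties over `S` one
applies the constructions one after another. -/
abbrev Builder (k : Type u) [Field k] (p n : ℕ) : Type u :=
  Tower k p n → Tower k p n × FormedBundle k p n

/-- The `m`-fold product over the base, with the external tensor product of the line bundles. -/
def power (b : Builder k p n) : ℕ → Builder k p n
  | 0, T => (T, .trivial)
  | m + 1, T =>
    let x := power b m T
    let y := b x.1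
    (y.1, x.2.tensor y.2)

/-- For `X` over `S` with line bundle `K`, the bundle `ℙ(𝒪 ⊕ (H ⊗ K))` over `X`, and its tautological line bundle. -/
def lineStep (b : Builder k p n) (H : FormedBundle k p n) : Builder k p n := fun T =>
  let x := b T
  let L := H.tensor x.2
  (x.1 ++ [[.trivial, L.toLineBundle]], .tautological x.1.length L)

/-- `(Q_r, K_r)`: `Q_0 = S` with the trivial bundle, and `Q_{r+1} = Q_r ×_S P_{r+1}` with
`K_{r+1} = K_r ⊠ 𝕃(1, …, 1)`. -/
def modelQ (H : ℕ → FormedBundle k p n) : ℕ → Builder k p n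
  | 0, T => (T, .trivial)
  | r + 1, T =>
    let x := modelQ H r T
    let y := power (lineStep (modelQ H r) (H (r + 1))) (p - 1) x.1
    (y.1, x.2.tensor y.2)

/-- `P_{r+1}(S; H_1, …, H_{r+1})` is the product over `S` of `p - 1` copies of the `ℙ¹`-bundle
`ℙ(𝒪 ⊕ (H_{r+1} ⊗ K_r))` over `Q_r`, with the external product of the tautological line bundles. -/
def modelP (H : ℕ → FormedBundle k p n) : ℕ → Builder k p n
  | 0, T => (T, .trivial)
  | r + 1, T => power (lineStep (modelQ H r) (H (r + 1))) (p - 1) T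

/-- One step `(Y_{r-1}, L_{r-2}, L_{r-1}) ↦ (Y_r, L_{r-1}, L_r)`, where
`Y_r = P_{m-1}(Y_{r-1}; H_1, …, H_{m-2}, L_{r-1})` and `L_r = L_{r-2} ⊗ 𝕃(1, …, 1)`. -/
def move (H : ℕ → FormedBundle k p n) (m : ℕ)
    (s : Tower k p n × FormedBundle k p n × FormedBundle k p n) :
    Tower k p n × FormedBundle k p n × FormedBundle k p n :=
  let y := modelP (Function.update H (m - 1) s.2.2) (m - 1) s.1
  (y.1, s.2.2, s.2.1.tensor y.2)

/-- The pair `(S_m, J_m)`, for `m = n - j`: `S_n` is a point with `J_n = H_{n-1}`, and `(S_{m-1}, J_{m-1})` is `(Y_p, L_p)` for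
the sequence of `p` steps that starts with `Y_0 = S_m`, `L_0 = J_m` and `L_{-1} = H_n` if `m = n`,
`L_{-1} = H_{m-1}` if `m < n`. -/
def stage (H : ℕ → FormedBundle k p n) : ℕ → Tower k p n × FormedBundle k p n
  | 0 => ([], H (n - 1))
  | j + 1 =>
    let s := stage H j
    let y := (move H (n - j))^[p] (s.1, if j = 0 then H n else H (n - j - 1), s.2)
    (y.1, y.2.2)

/-- The variety `S = S_1` over `Spec k` attached to the symbol `{a_1, …, a_n}`, presented as a tower. -/
def chainS (p : ℕ) (a : Fin n → kˣ) : Tower k p n :=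
  (stage (FormedBundle.base a) (n - 1)).1

/-- The line bundle `J = J_1` on `S`, with its `p`-form. -/
def chainJ (p : ℕ) (a : Fin n → kˣ) : FormedBundle k p n :=
  (stage (FormedBundle.base a) (n - 1)).2

/-- The line bundles `L ^ i`, `0 ≤ i < p`, whose sum is the Kummer algebra of `L`. -/
def kummer (L : LineBundle k p n) : List (LineBundle k p n) := (List.range p).map L.pow

/-- The norm of `∑ i, X (N, i) * u ^ i`, where `u ^ p = γ`: the norm form of a Kummer algebra. -/
def kummerNorm (γ : MvPolynomial (ℕ × ℕ) k) (N p : ℕ) : MvPolynomial (ℕ × ℕ) k :=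
  Algebra.norm (MvPolynomial (ℕ × ℕ) k)
    (∑ i ∈ Finset.range p, algebraMap (MvPolynomial (ℕ × ℕ) k)
      (AdjoinRoot (Polynomial.X ^ p - Polynomial.C γ)) (X (N, i)) *
        AdjoinRoot.root (Polynomial.X ^ p - Polynomial.C γ) ^ i)

section
variable {R : Type*} [CommRing R] (γ : R) (p : ℕ)

theorem root_pow : AdjoinRoot.root (Polynomial.X ^ p - Polynomial.C γ) ^ p =
    AdjoinRoot.of (Polynomial.X ^ p - Polynomial.C γ) γ := by
  have := AdjoinRoot.eval₂_root (Polynomial.X ^ p - Polynomial.C γ)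
  rw [Polynomial.eval₂_sub, Polynomial.eval₂_pow, Polynomial.eval₂_X, Polynomial.eval₂_C] at this
  exact sub_eq_zero.1 this

variable {γ p}

def twist (e : R →+* R) (c : R) (he : e γ = γ) (hc : c ^ p = 1) :
    AdjoinRoot (Polynomial.X ^ p - Polynomial.C γ) →+*
      AdjoinRoot (Polynomial.X ^ p - Polynomial.C γ) :=
  AdjoinRoot.lift ((AdjoinRoot.of _).comp e) (AdjoinRoot.of _ c * AdjoinRoot.root _) (by
    rw [Polynomial.eval₂_sub, Polynomial.eval₂_pow, Polynomial.eval₂_X, Polynomial.eval₂_C,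
      mul_pow, ← map_pow, hc, map_one, one_mul, root_pow, RingHom.comp_apply, he, sub_self])

theorem twist_of (e : R →+* R) (c : R) (he : e γ = γ) (hc : c ^ p = 1) (r : R) :
    twist e c he hc (AdjoinRoot.of _ r) = AdjoinRoot.of _ (e r) :=
  AdjoinRoot.lift_of _

theorem twist_root (e : R →+* R) (c : R) (he : e γ = γ) (hc : c ^ p = 1) :
    twist e c he hc (AdjoinRoot.root _) = AdjoinRoot.of _ c * AdjoinRoot.root _ :=
  AdjoinRoot.lift_root _

theorem twist_twist (e e' : R →+* R) (c c' : R) (he : e γ = γ) (hc : c ^ p = 1)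
    (he' : e' γ = γ) (hc' : c' ^ p = 1) (h : ∀ r, e' (e r) = r) (h' : e' c * c' = 1)
    (z : AdjoinRoot (Polynomial.X ^ p - Polynomial.C γ)) :
    twist e' c' he' hc' (twist e c he hc z) = z := by
  have : (twist e' c' he' hc').comp (twist e c he hc) = RingHom.id _ := by
    refine AdjoinRoot.ringHom_ext ?_ ?_
    · ext r
      simp only [RingHom.comp_apply, twist_of, h, RingHom.id_apply]
    · simp only [RingHom.comp_apply, twist_root, twist_of, map_mul, RingHom.id_apply]
      rw [← mul_assoc, ← map_mul, h', map_one, one_mul]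
  exact congrArg (fun f => f z) this

theorem map_norm (e : R ≃+* R) (c c' : R) (he : (e : R →+* R) γ = γ) (hc : c ^ p = 1) (hc' : c' ^ p = 1)
    (h : e.symm c * c' = 1) (h' : e c' * c = 1)
    (z : AdjoinRoot (Polynomial.X ^ p - Polynomial.C γ)) :
    e (Algebra.norm R z) = Algebra.norm R (twist (e : R →+* R) c he hc z) := by
  have he' : (e.symm : R →+* R) γ = γ := e.symm_apply_eq.2 he.symm
  let E : AdjoinRoot (Polynomial.X ^ p - Polynomial.C γ) ≃+*
      AdjoinRoot (Polynomial.X ^ p - Polynomial.C γ) :=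
    RingEquiv.ofRingHom (twist (e : R →+* R) c he hc) (twist (e.symm : R →+* R) c' he' hc')
      (RingHom.ext fun z => twist_twist _ _ _ _ he' hc' he hc (fun r => e.apply_symm_apply r) h' z)
      (RingHom.ext fun z => twist_twist _ _ _ _ he hc he' hc' (fun r => e.symm_apply_apply r) h z)
  have := Algebra.norm_eq_of_equiv_equiv e E (by
    ext r
    exact (twist_of _ _ he hc r).symm) z
  rw [this, RingEquiv.apply_symm_apply]
  rfl

end

namespace Tower

theorem polyAct_form (T : Tower k p n) (g : MuPow k p n) (L : FormedBundle k p n) :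
    T.polyAct g L.form = L.form := by
  have : (Algebra.adjoin k (Set.range fun v : ℕ × ℕ => (X v : MvPolynomial (ℕ × ℕ) k) ^ p)) ≤
      AlgHom.equalizer (T.polyAct g) (AlgHom.id k _) := by
    rw [Algebra.adjoin_le_iff]
    rintro _ ⟨v, rfl⟩
    change T.polyAct g (X v ^ p) = X v ^ p
    rw [map_pow, polyAct, aeval_X, mul_pow, ← map_pow, LineBundle.chr_pow, map_one, one_mul]
  exact this L.form_mem

theorem polyAct_comp (T : Tower k p n) (g g' : MuPow k p n) (h : g * g' = 1)
    (F : MvPolynomial (ℕ × ℕ) k) : T.polyAct g (T.polyAct g' F) = F := by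
  have : (T.polyAct g).comp (T.polyAct g') = AlgHom.id k _ := by
    refine MvPolynomial.algHom_ext fun v => ?_
    simp only [AlgHom.comp_apply, polyAct, aeval_X, map_mul, algHom_C, algebraMap_eq]
    rw [← mul_assoc, ← map_mul, ← Units.val_mul, ← map_mul, mul_comm g' g, h]
    simp
  exact congrArg (fun f => f F) this

def polyActEquiv (T : Tower k p n) (g : MuPow k p n) :
    MvPolynomial (ℕ × ℕ) k ≃+* MvPolynomial (ℕ × ℕ) k where
  toFun := T.polyAct g
  invFun := T.polyAct g⁻¹
  left_inv := T.polyAct_comp g⁻¹ g (inv_mul_cancel g)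
  right_inv := T.polyAct_comp g g⁻¹ (mul_inv_cancel g)
  map_mul' := map_mul (T.polyAct g)
  map_add' := map_add (T.polyAct g)

theorem polyAct_kummerNorm (T : Tower k p n) (J : FormedBundle k p n) (N : ℕ)
    (hT : ∀ i < p, T.bundle N i = J.pow i) (g : MuPow k p n) :
    T.polyAct g (kummerNorm J.form N p) = kummerNorm J.form N p := by
  have hc : (C ((J.chr g : kˣ)⁻¹ : k) : MvPolynomial (ℕ × ℕ) k) ^ p = 1 := by
    rw [← map_pow, inv_pow, J.chr_pow, inv_one, map_one]
  have hc' : (C (J.chr g : k) : MvPolynomial (ℕ × ℕ) k) ^ p = 1 := by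
    rw [← map_pow, J.chr_pow, map_one]
  have hC : ∀ (g : MuPow k p n) (r : k), T.polyAct g (C r) = C r := fun g r => algHom_C _ _
  have hJ : (J.chr g : k) ≠ 0 := Units.ne_zero _
  have he : (T.polyActEquiv g : MvPolynomial (ℕ × ℕ) k →+* MvPolynomial (ℕ × ℕ) k) J.form =
      J.form := T.polyAct_form g J
  have := map_norm (T.polyActEquiv g) _ _ he hc hc'
    (by
      change T.polyAct g⁻¹ _ * _ = 1
      rw [hC, ← map_mul, inv_mul_cancel₀ hJ, map_one])
    (by
      change T.polyAct g _ * _ = 1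
      rw [hC, ← map_mul, mul_inv_cancel₀ hJ, map_one])
    (∑ i ∈ Finset.range p, algebraMap (MvPolynomial (ℕ × ℕ) k)
      (AdjoinRoot (Polynomial.X ^ p - Polynomial.C J.form)) (X (N, i)) *
        AdjoinRoot.root (Polynomial.X ^ p - Polynomial.C J.form) ^ i)
  refine this.trans (congrArg _ ?_)
  rw [map_sum]
  refine Finset.sum_congr rfl fun i hi => ?_
  rw [map_mul, map_pow, twist_root]
  change twist _ _ he hc (AdjoinRoot.of _ (X (N, i))) * _ = AdjoinRoot.of _ (X (N, i)) * _
  rw [twist_of]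
  change AdjoinRoot.of _ (T.polyAct g (X (N, i))) * _ = _
  rw [polyAct, aeval_X, mul_pow, ← map_pow, ← mul_assoc, ← map_mul, hT i (Finset.mem_range.1 hi)]
  congr 2
  change C (((J.chr ^ i) g : kˣ) : k) * X (N, i) * _ = _
  rw [MonoidHom.pow_apply, Units.val_pow_eq_pow_val, ← map_pow, mul_right_comm, ← map_mul,
    ← mul_pow, mul_inv_cancel₀ hJ, one_pow, map_one, one_mul]

end Tower

/-- `ℙ(𝒜)`, where `𝒜 = ⨁ i, J ^ i` is the Kummer algebra of `J` over `S`. -/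
def projKummer (p : ℕ) (a : Fin n → kˣ) : Action (Over (Spec (.of k))) (MuPow k p n) :=
  Tower.variety (chainS p a ++ [kummer (chainJ p a).toLineBundle])

theorem bundle_last (T : Tower k p n) (Ms : List (LineBundle k p n)) (i : ℕ) :
    Tower.bundle (T ++ [Ms]) T.length i = Ms.getD i .trivial := by
  simp [Tower.bundle]

/-- `Q_w = {[β : t] ∈ ℙ(𝒜 ⊕ 𝒪) | N(β) = t ^ p * w}`. -/
def normHypersurface (p : ℕ) (a : Fin n → kˣ) (w : k) :
    Action (Over (Spec (.of k))) (MuPow k p n) :=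
  Tower.hypersurface
    (chainS p a ++ [kummer (chainJ p a).toLineBundle ++ [LineBundle.trivial]])
    (kummerNorm (chainJ p a).form (chainS p a).length p - C w * X ((chainS p a).length, p) ^ p)
    fun g => by
      rw [map_sub, Tower.polyAct_kummerNorm, map_mul, map_pow]
      · congr 1
        rw [Tower.polyAct, algHom_C, aeval_X, bundle_last]
        simp [kummer, LineBundle.trivial]
      · intro i hi
        rw [bundle_last]
        rw [List.getD_append _ _ _ _ (by simpa [kummer] using hi)]
        simp [kummer, hi]

end NormVar

end

/-!
All varieties here are towers of projective bundles, or hypersurfaces in them, and are glued from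
the standard charts of such towers. On a chart the group `G = μ_p ^ n` acts on the affine
coordinates by characters. A tower is called `Good` if at the origin of every chart the line bundles
whose sum is projectivized in the next step have pairwise different characters. Then all affine
coordinates have nontrivial characters, the fixed points are the origins of the charts, and the
characters on the tangent spaces can be read off from the tower.

*The tower `S`.* `chainS_spec` shows that `S` is good, that the form of `J` does not vanish at the
fixed points, and that the character `χ` of `G` on the fibre of `J` at each of them is not `1`.
The characters of `μ_p ^ n` form a vector space over `𝔽_p`. For `m = n, …, 2`, the characters of
`L_{r-2}` and `L_{r-1}` at a fixed point are independent modulo the span of the characters of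
`H_1, …, H_{m-2}`. The bundle `L_r` differs from `L_{r-2}` by a bundle whose character lies in the
span of those of `H_1, …, H_{m-2}` and `L_{r-1}`, so the invariant is preserved by the exchange
property (`exchange`, `MoveInv.move`, `stage_spec`). The same independence shows that `𝒪` and
`H_i ⊗ K_{i-1}` have different characters, so that each tower is good (`Builder.Spec.lineStep`).

*The bundle `ℙ(𝒜)`.* Over a fixed point of `S` the fixed points of `ℙ(𝒜)` are `[u ^ i]` for
`0 ≤ i < p`, where `u` is a generator of the fibre of `J`, since the powers `χ ^ i` are pairwise
different. The characters along the fibre at `[u ^ i]` are the quotients `χ ^ b / χ ^ i` for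
`b ≠ i`, that is, all `χ ^ a` with `0 < a < p`.

*The norm hypersurface.* In `ℙ(𝒜 ⊕ 𝒪)` the fixed points with `t = 0` are the points `[u ^ i : 0]`.
They do not lie on `Q_w`, since `u ^ i` has nonzero norm (`exists_pt_normChart`). On the chart
`t = 1` the fixed points have `β = β_0`, and the norm equation becomes `β_0 ^ p = w`, so the residue
fields are generated by a `p`-th root of `w` (`FixCharts.residueField_equiv`). The powers `u ^ i`
with `0 < i < p` have trace zero, hence the norm of `β` agrees with `β_0 ^ p` to first order
(`normForm_first_order`), and the tangent space of `Q_w` along the fibre has coordinates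
`β_1, …, β_{p-1}`, with characters `χ ^ a` for `0 < a < p`. The hypersurface is smooth there since
the derivative `p * β_0 ^ (p - 1)` of the equation in the direction of `β_0` does not vanish
(`smooth_normJacobian`, `map_normJacobian_ne_zero`).

*The comparison.* After adjoining a `p`-th root of `w`, both varieties have `p` rational fixed points
over every fixed point of `S`, with the same characters on the tangent spaces
(`exists_fixIndex_equiv`). The structures `FixCoords` and `FixCharts` collect what is needed to
deduce the statements on schemes from such descriptions of the charts.
-/

noncomputable section

namespace NormVar

/-! ### Affine charts of a scheme with group action -/

section

section Charts

variable {K : Type u} [Field K] {G : Type u} [Group G]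

theorem germ_app_congr {X Y : Scheme.{u}} {f f' : Y ⟶ X} (e : f = f') (U : X.Opens) (y : Y)
    (h : f y ∈ U) : f.app U ≫ Y.presheaf.germ (f ⁻¹ᵁ U) y h =
      f'.app U ≫ Y.presheaf.germ (f' ⁻¹ᵁ U) y (by subst e; exact h) := by
  subst e; rfl

/-- Restriction of germs to `Y` along `j` intertwines the maps which `g` and `φ` induce on the
stalks at a fixed point. -/
theorem stalkMap_comm {X Y : Scheme.{u}} (j : Y ⟶ X) (g : X ⟶ X) (φ : Y ⟶ Y)
    (e : j ≫ g = φ ≫ j) (q : Y) (s : g (j q) ⤳ j q) (s' : φ q ⤳ q) :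
    X.presheaf.stalkSpecializes s ≫ g.stalkMap (j q) ≫ j.stalkMap q =
      j.stalkMap q ≫ Y.presheaf.stalkSpecializes s' ≫ φ.stalkMap q := by
  refine TopCat.Presheaf.stalk_hom_ext _ fun U hU => ?_
  have hU' : g (j q) ∈ U := s.mem_open U.2 hU
  have hU'' : φ q ∈ j ⁻¹ᵁ U := s'.mem_open (j ⁻¹ᵁ U).2 hU
  have h1 := Scheme.Hom.germ_stalkMap j (g ⁻¹ᵁ U) q hU'
  have h2 := Scheme.Hom.germ_stalkMap φ (j ⁻¹ᵁ U) q hU''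
  have h4 : X.presheaf.germ U (j q) hU ≫ X.presheaf.stalkSpecializes s =
    X.presheaf.germ U (g (j q)) hU' := TopCat.Presheaf.germ_stalkSpecializes ..
  have h5 : Y.presheaf.germ (j ⁻¹ᵁ U) q hU ≫ Y.presheaf.stalkSpecializes s' =
    Y.presheaf.germ (j ⁻¹ᵁ U) (φ q) hU'' := TopCat.Presheaf.germ_stalkSpecializes ..
  have h6 := Scheme.Hom.germ_stalkMap g U (j q) hU'
  have h7 := Scheme.Hom.germ_stalkMap j U q hU
  rw [reassoc_of% h4, reassoc_of% h6, reassoc_of% h7, h1, reassoc_of% h5, h2]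
  have h3 := germ_app_congr e U q hU'
  rw [Scheme.Hom.comp_app, Scheme.Hom.comp_app] at h3
  exact (Category.assoc _ _ _).symm.trans (h3.trans (Category.assoc _ _ _))

/-- A `G`-stable affine open subscheme of a `G`-scheme over `K`, given by its coordinate algebra.
The map `act g` is the pullback of functions along `g`. -/
structure AffineChart (X : Action (Over (Spec (.of K))) G) where
  A : Type u
  [ring : CommRing A]
  [alg : Algebra K A]
  act : G → A →ₐ[K] A
  j : Spec (.of A) ⟶ X.V.left
  [isOpen : IsOpenImmersion j]
  comp_hom : j ≫ X.V.hom = Spec.map (CommRingCat.ofHom (algebraMap K A))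
  equivariant : ∀ g, j ≫ (X.ρ g).left =
    Spec.map (CommRingCat.ofHom (act g : A →+* A)) ≫ j

attribute [instance] AffineChart.ring AffineChart.alg AffineChart.isOpen

namespace AffineChart

variable {X : Action (Over (Spec (.of K))) G} (U : AffineChart X)

instance (q : Spec (.of U.A)) : q.asIdeal.IsPrime := q.isPrime

/-- The point of the `G`-scheme given by a prime ideal of a chart. -/
abbrev pt (q : Spec (.of U.A)) : X.V.left := U.j q

theorem pt_injective : Function.Injective U.pt := U.j.isOpenEmbedding.injective

/-- The points of a chart at which `G` acts trivially on the residue field. -/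
def fixedPrimes : Set (Spec (.of U.A)) :=
  {q | ∀ g a, U.act g a - a ∈ q.asIdeal}

theorem pt_mem_fixedLocus (q : Spec (.of U.A)) :
    U.pt q ∈ fixedLocus X ↔ q ∈ U.fixedPrimes := by
  refine forall_congr' fun g => ?_
  have h1 := Scheme.Hom.SpecMap_residueFieldMap_fromSpecResidueField U.j q
  rw [← cancel_epi (Spec.map (U.j.residueFieldMap q)), reassoc_of% h1, h1, U.equivariant,
    ← Category.assoc, cancel_mono, ← Scheme.Spec.map_residueFieldIso_inv_eq_fromSpecResidueField,
    Category.assoc, cancel_epi, ← Spec.map_comp, Spec.map_inj]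
  rw [CommRingCat.hom_ext_iff, RingHom.ext_iff]
  refine forall_congr' fun a => ?_
  change algebraMap U.A q.asIdeal.ResidueField (U.act g a) = algebraMap _ _ a ↔ _
  rw [← sub_eq_zero, ← map_sub, Ideal.algebraMap_residueField_eq_zero]

/-- The germ of a function on a chart. -/
def germ (q : Spec (.of U.A)) : CommRingCat.of U.A ⟶ X.V.left.presheaf.stalk (U.pt q) :=
  (Scheme.ΓSpecIso (.of U.A)).inv ≫
    (Spec (.of U.A)).presheaf.germ ⊤ q (TopologicalSpace.Opens.mem_top q) ≫
    inv (U.j.stalkMap q)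

theorem germ_stalkMap (q : Spec (.of U.A)) : U.germ q ≫ U.j.stalkMap q =
    (Scheme.ΓSpecIso (.of U.A)).inv ≫
      (Spec (.of U.A)).presheaf.germ ⊤ q (TopologicalSpace.Opens.mem_top q) := by
  simp [germ]

instance (q : Spec (.of U.A)) : Algebra U.A (X.V.left.presheaf.stalk (U.pt q)) :=
  (U.germ q).hom.toAlgebra

theorem germ_algebraMap (q : Spec (.of U.A)) (r : K) :
    algebraMap U.A (X.V.left.presheaf.stalk (U.pt q)) (algebraMap K U.A r) =
      algebraMap K (X.V.left.presheaf.stalk (U.pt q)) r := by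
  have h : CommRingCat.ofHom (algebraMap K U.A) ≫ U.germ q =
      (Scheme.ΓSpecIso (.of K)).inv ≫ X.V.hom.appTop ≫
        X.V.left.presheaf.germ ⊤ (U.pt q) trivial := by
    rw [← cancel_mono (U.j.stalkMap q), Category.assoc, germ_stalkMap]
    simp only [Category.assoc]
    erw [Scheme.Hom.germ_stalkMap U.j ⊤ q trivial]
    have := congrArg Scheme.Hom.appTop U.comp_hom
    rw [Scheme.Hom.comp_appTop] at this
    erw [reassoc_of% this]
    exact (Scheme.ΓSpecIso_inv_naturality_assoc (CommRingCat.ofHom (algebraMap K U.A))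
      ((Spec (.of U.A)).presheaf.germ ⊤ q (TopologicalSpace.Opens.mem_top q)))
  exact congrArg (fun f => f.hom r) h

instance (q : Spec (.of U.A)) : IsScalarTower K U.A (X.V.left.presheaf.stalk (U.pt q)) :=
  .of_algebraMap_eq fun r => (U.germ_algebraMap q r).symm

instance (q : Spec (.of U.A)) :
    IsLocalization.AtPrime (X.V.left.presheaf.stalk (U.pt q)) q.asIdeal := by
  let e : Localization.AtPrime q.asIdeal ≃+* X.V.left.presheaf.stalk (U.pt q) :=
    ((Spec.stalkIso (CommRingCat.of U.A) q).symm ≪≫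
      (asIso (U.j.stalkMap q)).symm).commRingCatIsoToRingEquiv
  refine IsLocalization.isLocalization_of_algEquiv q.asIdeal.primeCompl
    (AlgEquiv.ofRingEquiv (f := e) fun a => ?_)
  have := Spec.algebraMap_stalkIso_inv (R := .of U.A) q
  have h2 : CommRingCat.ofHom (algebraMap U.A (Localization.AtPrime q.asIdeal)) ≫
      (Spec.stalkIso (CommRingCat.of U.A) q).inv ≫ inv (U.j.stalkMap q) = U.germ q := by
    rw [germ]
    erw [reassoc_of% this]
  exact congrArg (fun f => f.hom a) h2

theorem comap_act {q : Spec (.of U.A)} (hq : q ∈ U.fixedPrimes) (g : G) :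
    PrimeSpectrum.comap (U.act g : U.A →+* U.A) q = q := by
  ext a
  change U.act g a ∈ q.asIdeal ↔ a ∈ q.asIdeal
  exact ⟨fun h => by simpa using q.asIdeal.sub_mem h (hq g a),
    fun h => by simpa using q.asIdeal.add_mem (hq g a) h⟩

theorem stalkAct_algebraMap (q : Spec (.of U.A)) (hq : U.pt q ∈ fixedLocus X) (g : G) (a : U.A) :
    stalkAct X ⟨U.pt q, hq⟩ g (algebraMap U.A (X.V.left.presheaf.stalk (U.pt q)) a) =
      algebraMap U.A (X.V.left.presheaf.stalk (U.pt q)) (U.act g a) := by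
  have hq' := U.comap_act ((U.pt_mem_fixedLocus q).1 hq) g
  let φ : CommRingCat.of U.A ⟶ .of U.A := CommRingCat.ofHom (U.act g : U.A →+* U.A)
  have hφ : Spec.map φ q = q := hq'
  have h : U.germ q ≫ X.V.left.presheaf.stalkSpecializes
      (specializes_of_eq (apply_of_mem_fixedLocus X hq g)) ≫ (X.ρ g).left.stalkMap (U.pt q) =
      φ ≫ U.germ q := by
    rw [← cancel_mono (U.j.stalkMap q)]
    simp only [Category.assoc]
    rw [germ_stalkMap, stalkMap_comm U.j _ (Spec.map φ) (U.equivariant g) q _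
      (specializes_of_eq hφ), ← Category.assoc (U.germ q), germ_stalkMap]
    simp only [Category.assoc]
    rw [TopCat.Presheaf.germ_stalkSpecializes_assoc]
    erw [Scheme.Hom.germ_stalkMap (Spec.map φ) ⊤ q (TopologicalSpace.Opens.mem_top _)]
    exact (Scheme.ΓSpecIso_inv_naturality_assoc φ
      ((Spec (.of U.A)).presheaf.germ ⊤ q (TopologicalSpace.Opens.mem_top q))).symm
  exact congrArg (fun f => f.hom a) h

end AffineChart
end Charts

end

/-! ### Cotangent spaces and diagonal actions -/

section

section Cotangent

variable {K A R : Type*} [Field K] [CommRing A] [Algebra K A] [CommRing R] [IsLocalRing R]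
  [Algebra K R] [Algebra A R] [IsScalarTower K A R] (q : Ideal A) [q.IsPrime]
  [IsLocalization.AtPrime R q] {ι : Type*} {y : ι → A}

theorem algebraMap_mem_maximalIdeal {a : A} (ha : a ∈ q) :
    algebraMap A R a ∈ IsLocalRing.maximalIdeal R :=
  (IsLocalization.AtPrime.to_map_mem_maximal_iff R q a).2 ha

/-- The class in `𝔪 / 𝔪 ^ 2` of the image of an element of `q` in the local ring at `q`. -/
def cotangentClass (a : q) : IsLocalRing.CotangentSpace R :=
  (IsLocalRing.maximalIdeal R).toCotangent
    ⟨algebraMap A R a, algebraMap_mem_maximalIdeal q a.2⟩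

omit [Algebra K R] [IsScalarTower K A R] in
/-- A first order deformation of a rational point extends to the local ring. -/
theorem exists_extend_dualNumber (θ : A →ₐ[K] DualNumber K)
    (hθ : ∀ a, (θ a).fst = 0 ↔ a ∈ q) :
    ∃ Θ : R →+* DualNumber K, (∀ a, Θ (algebraMap A R a) = θ a) ∧
      ∀ z ∈ IsLocalRing.maximalIdeal R, (Θ z).fst = 0 := by
  have hu : ∀ s : q.primeCompl, IsUnit ((θ : A →+* DualNumber K) s) := fun s => by
    rw [TrivSqZeroExt.isUnit_iff_isUnit_fst]
    exact isUnit_iff_ne_zero.2 fun h => s.2 ((hθ s).1 h)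
  refine ⟨IsLocalization.lift hu, fun a => IsLocalization.lift_eq hu a, fun z hz => ?_⟩
  by_contra h
  have hz' : ¬ IsUnit z := hz
  obtain ⟨⟨a, s⟩, has⟩ := IsLocalization.surj q.primeCompl z
  have h1 := congrArg (fun t => (IsLocalization.lift hu t).fst) has
  simp only [map_mul, IsLocalization.lift_eq, TrivSqZeroExt.fst_mul] at h1
  have h2 : a ∈ q := by
    rw [← IsLocalization.AtPrime.to_map_mem_maximal_iff R q a, ← has]
    exact Ideal.mul_mem_right _ _ hz
  have h3 := (hθ a).2 h2
  rw [RingHom.coe_coe] at h1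
  rw [h3] at h1
  exact (mul_eq_zero.1 h1).elim h fun h4 => s.2 ((hθ s).1 h4)

/-- The classes of functions are independent if there are tangent vectors, in the form of maps to
the dual numbers, which are dual to them up to nonzero scalars. -/
theorem linearIndependent_cotangentClass (hy : ∀ i, y i ∈ q)
    (hd : ∀ i, ∃ θ : A →ₐ[K] DualNumber K,
        (∀ a, (θ a).fst = 0 ↔ a ∈ q) ∧ (θ (y i)).snd ≠ 0 ∧ ∀ j, j ≠ i → (θ (y j)).snd = 0) :
    LinearIndependent K fun i => cotangentClass (R := R) q ⟨y i, hy i⟩ := by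
  rw [linearIndependent_iff']
  intro s c hc i hi
  obtain ⟨θ, hθ, h1, h2⟩ := hd i
  obtain ⟨Θ, hΘ, hΘm⟩ := exists_extend_dualNumber (R := R) q θ hθ
  have hsum : ∑ j ∈ s, algebraMap A R (c j • y j) ∈ IsLocalRing.maximalIdeal R ^ 2 := by
    have e : ∑ j ∈ s, c j • cotangentClass (R := R) q ⟨y j, hy j⟩ =
        (IsLocalRing.maximalIdeal R).toCotangent (∑ j ∈ s,
          c j • ⟨algebraMap A R (y j), algebraMap_mem_maximalIdeal q (hy j)⟩) := by
      rw [map_sum]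
      refine Finset.sum_congr rfl fun j _ => ?_
      rfl
    rw [e, Ideal.toCotangent_eq_zero] at hc
    convert hc using 1
    rw [AddSubmonoidClass.coe_finsetSum]
    refine Finset.sum_congr rfl fun j _ => ?_
    rw [Algebra.smul_def, map_mul, ← IsScalarTower.algebraMap_apply, ← Algebra.smul_def]
    rfl
  -- `Θ` maps the maximal ideal to multiples of `ε`, so it kills the square of that ideal
  have hsq : ∀ z ∈ IsLocalRing.maximalIdeal R ^ 2, Θ z = 0 := by
    intro z hz
    rw [pow_two] at hz
    induction hz using Submodule.mul_induction_on' with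
    | mem_mul_mem a ha b hb =>
      ext
      · simp [hΘm a ha]
      · simp [hΘm a ha, hΘm b hb]
    | add a _ b _ ha hb => rw [map_add, ha, hb, add_zero]
  have := congrArg TrivSqZeroExt.snd (hsq _ hsum)
  rw [map_sum, TrivSqZeroExt.snd_sum, Finset.sum_eq_single i] at this
  · rw [hΘ, map_smul, TrivSqZeroExt.snd_smul, TrivSqZeroExt.snd_zero, smul_eq_mul] at this
    exact (mul_eq_zero.1 this).resolve_right h1
  · intro j _ hj
    rw [hΘ, map_smul, TrivSqZeroExt.snd_smul, h2 j hj, smul_zero]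
  · exact fun h => absurd hi h

omit [Algebra K A] [IsScalarTower K A R] in
/-- At a rational point, generators of the maximal ideal span the cotangent space. -/
theorem span_cotangentClass (hy : ∀ i, y i ∈ q)
    (hK : ∀ z : R, ∃ r : K, z - algebraMap K R r ∈ IsLocalRing.maximalIdeal R)
    (hs : IsLocalRing.maximalIdeal R ≤ Ideal.span (Set.range fun i => algebraMap A R (y i))) :
    ⊤ ≤ Submodule.span K (Set.range fun i => cotangentClass (R := R) q ⟨y i, hy i⟩) := by
  rintro v -
  obtain ⟨⟨z, hz⟩, rfl⟩ := Ideal.toCotangent_surjective _ v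
  have key : ∀ z ∈ Ideal.span (Set.range fun i => algebraMap A R (y i)),
      ∃ hz : z ∈ IsLocalRing.maximalIdeal R, (IsLocalRing.maximalIdeal R).toCotangent ⟨z, hz⟩ ∈
        Submodule.span K (Set.range fun i => cotangentClass (R := R) q ⟨y i, hy i⟩) := by
    intro z hz
    induction hz using Submodule.span_induction with
    | mem z hz =>
      obtain ⟨i, rfl⟩ := hz
      exact ⟨algebraMap_mem_maximalIdeal q (hy i), Submodule.subset_span ⟨i, rfl⟩⟩
    | zero => exact ⟨zero_mem _, by
        rw [show (⟨0, zero_mem _⟩ : IsLocalRing.maximalIdeal R) = 0 from rfl, map_zero]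
        exact zero_mem _⟩
    | add a b _ _ ha hb =>
      obtain ⟨ha, ha'⟩ := ha
      obtain ⟨hb, hb'⟩ := hb
      refine ⟨add_mem ha hb, ?_⟩
      rw [show (⟨a + b, add_mem ha hb⟩ : IsLocalRing.maximalIdeal R) = ⟨a, ha⟩ + ⟨b, hb⟩ from rfl,
        map_add]
      exact add_mem ha' hb'
    | smul r a _ ha =>
      obtain ⟨ha, ha'⟩ := ha
      obtain ⟨c, hc⟩ := hK r
      refine ⟨Ideal.mul_mem_left _ _ ha, ?_⟩
      have : (IsLocalRing.maximalIdeal R).toCotangent ⟨r • a, Ideal.mul_mem_left _ _ ha⟩ =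
          c • (IsLocalRing.maximalIdeal R).toCotangent ⟨a, ha⟩ := by
        have e : c • (IsLocalRing.maximalIdeal R).toCotangent ⟨a, ha⟩ =
          (IsLocalRing.maximalIdeal R).toCotangent (c • ⟨a, ha⟩) := rfl
        rw [e, Ideal.toCotangent_eq]
        have : r • a - ((c • (⟨a, ha⟩ : IsLocalRing.maximalIdeal R) :
          IsLocalRing.maximalIdeal R) : R) = (r - algebraMap K R c) * a := by
          change r * a - c • a = _
          rw [Algebra.smul_def, sub_mul]
        change r • a - ((c • (⟨a, ha⟩ : IsLocalRing.maximalIdeal R) :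
          IsLocalRing.maximalIdeal R) : R) ∈ _
        rw [this, pow_two]
        exact Ideal.mul_mem_mul hc ha
      rw [this]
      exact Submodule.smul_mem _ _ ha'
  exact (key z (hs hz)).2

end Cotangent

section Rep

/-- Duals of two diagonal actions with the same characters are isomorphic. -/
theorem nonempty_equiv_dual {K G V W ι ι' : Type*} [Field K] [Group G] [AddCommGroup V] [Module K V]
    [AddCommGroup W] [Module K W] (b : Module.Basis ι K V) (b' : Module.Basis ι' K W)
    (σ : G → V →ₗ[K] V) (τ : G → W →ₗ[K] W) (ρ : Representation K G (Module.Dual K V))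
    (ρ' : Representation K G (Module.Dual K W)) (hρ : ∀ g, ρ g = (σ g).dualMap)
    (hρ' : ∀ g, ρ' g = (τ g).dualMap) (ψ : ι → G → K) (ψ' : ι' → G → K)
    (hσ : ∀ g i, σ g (b i) = ψ i g • b i) (hτ : ∀ g i, τ g (b' i) = ψ' i g • b' i)
    (e : ι ≃ ι') (he : ∀ i, ψ' (e i) = ψ i) : Nonempty (ρ.Equiv ρ') := by
  let f : V ≃ₗ[K] W := b.equiv b' e
  have hf : ∀ g v, f (σ g v) = τ g (f v) := by
    intro g v
    have : (f : V →ₗ[K] W) ∘ₗ σ g = τ g ∘ₗ (f : V →ₗ[K] W) := by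
      refine b.ext fun i => ?_
      simp [f, hσ, hτ, he]
    exact LinearMap.congr_fun this v
  refine ⟨.mk f.symm.dualMap fun g => ?_⟩
  ext φ w
  simp only [LinearMap.comp_apply, hρ, hρ', LinearEquiv.coe_coe, LinearEquiv.dualMap_apply,
    LinearMap.dualMap_apply]
  refine congrArg φ (f.injective ?_)
  rw [hf, f.apply_symm_apply, f.apply_symm_apply]

end Rep

end

/-! ### Residue fields, smoothness and base change of charts -/

section

section Charts

variable {K : Type u} [Field K] {G : Type u} [Group G]

namespace AffineChart

variable {X : Action (Over (Spec (.of K))) G} (U : AffineChart X)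

/-- The value of a function on a chart at a point of the chart. -/
def eval (q : Spec (.of U.A)) : U.A →ₐ[K] X.V.left.residueField (U.pt q) where
  __ := (X.V.left.residue (U.pt q)).hom.comp (algebraMap U.A (X.V.left.presheaf.stalk (U.pt q)))
  commutes' r := congrArg (X.V.left.residue (U.pt q)).hom (U.germ_algebraMap q r)

theorem eval_apply (q : Spec (.of U.A)) (a : U.A) : U.eval q a =
    IsLocalRing.residue _ (algebraMap U.A (X.V.left.presheaf.stalk (U.pt q)) a) := rfl

theorem eval_eq_zero (q : Spec (.of U.A)) (a : U.A) : U.eval q a = 0 ↔ a ∈ q.asIdeal := by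
  rw [eval_apply]
  erw [IsLocalRing.residue_eq_zero_iff]
  exact IsLocalization.AtPrime.to_map_mem_maximal_iff _ q.asIdeal a

theorem exists_eval_mul (q : Spec (.of U.A)) (z : X.V.left.residueField (U.pt q)) :
    ∃ a s, s ∉ q.asIdeal ∧ z * U.eval q s = U.eval q a := by
  obtain ⟨z, rfl⟩ := IsLocalRing.residue_surjective z
  obtain ⟨⟨a, s⟩, h⟩ := IsLocalization.surj q.asIdeal.primeCompl z
  exact ⟨a, s, s.2, congrArg (IsLocalRing.residue _) h⟩

theorem isRationalPoint (q : Spec (.of U.A))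
    (h : ∀ a, ∃ r : K, a - algebraMap K U.A r ∈ q.asIdeal) :
    IsRationalPoint X.V (U.pt q) := by
  have h' : ∀ a, ∃ r : K, U.eval q a = algebraMap K _ r := fun a => by
    obtain ⟨r, hr⟩ := h a
    refine ⟨r, ?_⟩
    rw [← (U.eval q).commutes, ← sub_eq_zero, ← map_sub, eval_eq_zero]
    exact hr
  refine ⟨(algebraMap K _).injective, fun z => ?_⟩
  obtain ⟨a, s, hs, hz⟩ := U.exists_eval_mul q z
  obtain ⟨r, hr⟩ := h' a
  obtain ⟨t, ht⟩ := h' s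
  have hs' : U.eval q s ≠ 0 := fun h => hs ((U.eval_eq_zero q s).1 h)
  refine ⟨r / t, ?_⟩
  rw [map_div₀, ← hr, ← ht, ← hz, mul_div_cancel_right₀ _ hs']

theorem pt_mem_smoothSet (q : Spec (.of U.A)) (h : U.A) (hq : h ∉ q.asIdeal)
    (hs : Algebra.Smooth K (Localization.Away h)) : U.pt q ∈ smoothSet X.V := by
  -- the principal open subscheme of the chart on which `h` is invertible
  let i : Spec (.of (Localization.Away h)) ⟶ Spec (.of U.A) :=
    Spec.map (CommRingCat.ofHom (algebraMap U.A (Localization.Away h)))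
  have hi : IsOpenImmersion i := IsOpenImmersion.of_isLocalization h
  obtain ⟨q', hq'⟩ : q ∈ Set.range i := by
    change q ∈ Set.range (PrimeSpectrum.comap (algebraMap U.A (Localization.Away h)))
    rw [PrimeSpectrum.localization_away_comap_range _ h]
    exact hq
  refine ⟨(i ≫ U.j).opensRange, ⟨q', ?_⟩, ?_⟩
  · rw [← hq']; exact Scheme.Hom.comp_apply i U.j q'
  · have : Smooth (Spec.map (CommRingCat.ofHom (algebraMap K (Localization.Away h)))) := by
      rw [HasRingHomProperty.Spec_iff (P := @Smooth)]
      exact (RingHom.smooth_algebraMap).2 hs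
    have e : (i ≫ U.j).opensRange.ι ≫ X.V.hom = (i ≫ U.j).isoOpensRange.inv ≫
        Spec.map (CommRingCat.ofHom (algebraMap K (Localization.Away h))) := by
      rw [Iso.eq_inv_comp, Scheme.Hom.isoOpensRange_hom_ι_assoc, Category.assoc]
      erw [U.comp_hom]
      rw [← Spec.map_comp, ← CommRingCat.ofHom_comp, ← IsScalarTower.algebraMap_eq]
    rw [e]
    infer_instance

theorem cotangentAct_class (q : Spec (.of U.A)) (hq : U.pt q ∈ fixedLocus X) (g : G)
    (a : q.asIdeal) (ha : U.act g a ∈ q.asIdeal) :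
    cotangentAct X ⟨U.pt q, hq⟩ g (cotangentClass q.asIdeal a) =
      cotangentClass q.asIdeal ⟨U.act g a, ha⟩ :=
  congrArg (Ideal.toCotangent _) (Subtype.ext (U.stalkAct_algebraMap q hq g a))

section BaseChange

variable (L : Type u) [Field L] [Algebra K L]

open TensorProduct

/-- The projection from the base change. -/
def proj (X : Action (Over (Spec (.of K))) G) : (baseChange K L X).V.left ⟶ X.V.left :=
  pullback.fst X.V.hom (Spec.map (CommRingCat.ofHom (algebraMap K L)))

theorem isPullback_proj (X : Action (Over (Spec (.of K))) G) :
    IsPullback (proj L X) (baseChange K L X).V.hom X.V.hom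
      (Spec.map (CommRingCat.ofHom (algebraMap K L))) :=
  IsPullback.of_hasPullback _ _

theorem proj_equivariant (X : Action (Over (Spec (.of K))) G) (g : G) :
    ((baseChange K L X).ρ g).left ≫ proj L X = proj L X ≫ (X.ρ g).left :=
  pullback.lift_fst _ _ _

/-- The projection of the base change of a chart to the chart. -/
def baseChangeIncl : Spec (.of (L ⊗[K] U.A)) ⟶ Spec (.of U.A) :=
  Spec.map (CommRingCat.ofHom (Algebra.TensorProduct.includeRight : U.A →ₐ[K] L ⊗[K] U.A).toRingHom)

theorem isPullback_baseChangeIncl : IsPullback (U.baseChangeIncl L)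
    (Spec.map (CommRingCat.ofHom (algebraMap L (L ⊗[K] U.A)))) (U.j ≫ X.V.hom)
      (Spec.map (CommRingCat.ofHom (algebraMap K L))) := by
  rw [U.comp_hom]
  exact isPullback_SpecMap_of_isPushout _ _ _ _
    (CommRingCat.isPushout_tensorProduct K L U.A).flip

/-- The inclusion of the base change of a chart. -/
def baseChangeEmb : Spec (.of (L ⊗[K] U.A)) ⟶ (baseChange K L X).V.left :=
  (isPullback_proj L X).lift (U.baseChangeIncl L ≫ U.j)
    (Spec.map (CommRingCat.ofHom (algebraMap L (L ⊗[K] U.A))))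
    (by rw [Category.assoc]; exact (U.isPullback_baseChangeIncl L).w)

theorem baseChangeEmb_proj : U.baseChangeEmb L ≫ proj L X = U.baseChangeIncl L ≫ U.j :=
  (isPullback_proj L X).lift_fst _ _ _

theorem baseChangeEmb_hom : U.baseChangeEmb L ≫ (baseChange K L X).V.hom =
    Spec.map (CommRingCat.ofHom (algebraMap L (L ⊗[K] U.A))) :=
  (isPullback_proj L X).lift_snd _ _ _

theorem isPullback_baseChangeEmb :
    IsPullback (U.baseChangeEmb L) (U.baseChangeIncl L) (proj L X) U.j := by
  refine IsPullback.of_right ?_ (U.baseChangeEmb_proj L) (isPullback_proj L X).flip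
  rw [baseChangeEmb_hom]
  exact (U.isPullback_baseChangeIncl L).flip

instance : IsOpenImmersion (U.baseChangeEmb L) :=
  MorphismProperty.of_isPullback (P := @IsOpenImmersion) (U.isPullback_baseChangeEmb L).flip
    U.isOpen

/-- The base change of a chart. -/
def baseChangeChart : AffineChart (baseChange K L X) where
  A := L ⊗[K] U.A
  act g := Algebra.TensorProduct.map (AlgHom.id L L) (U.act g)
  j := U.baseChangeEmb L
  comp_hom := U.baseChangeEmb_hom L
  equivariant g := by
    refine (isPullback_proj L X).hom_ext ?_ ?_
    · rw [Category.assoc, proj_equivariant, reassoc_of% (U.baseChangeEmb_proj L), U.equivariant,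
        Category.assoc, baseChangeEmb_proj, baseChangeIncl, ← Spec.map_comp_assoc,
        ← Spec.map_comp_assoc]
      congr 2
    · have h : ((baseChange K L X).ρ g).left ≫ (baseChange K L X).V.hom =
        (baseChange K L X).V.hom := Over.w _
      rw [Category.assoc, h, Category.assoc, baseChangeEmb_hom, ← Spec.map_comp]
      congr 1
      ext r
      simp

theorem baseChangeChart_proj (q : Spec (.of (U.baseChangeChart L).A)) :
    proj L X ((U.baseChangeChart L).pt q) = U.pt (U.baseChangeIncl L q) :=
  congrArg (fun f => f q) (U.baseChangeEmb_proj L)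

theorem mem_baseChangeIncl (q : Spec (.of (U.baseChangeChart L).A)) (a : U.A) :
    a ∈ (U.baseChangeIncl L q).asIdeal ↔ (1 : L) ⊗ₜ[K] a ∈ q.asIdeal := Iff.rfl

theorem exists_pt_of_proj_eq (z : (baseChange K L X).V.left) (q : Spec (.of U.A))
    (h : proj L X z = U.pt q) : ∃ q', (U.baseChangeChart L).pt q' = z := by
  obtain ⟨q', h, -⟩ := Scheme.exists_preimage_of_isPullback (U.isPullback_baseChangeEmb L) z q h
  exact ⟨q', h⟩

theorem baseChangeIncl_mem_fixedPrimes {q : Spec (.of (U.baseChangeChart L).A)}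
    (h : q ∈ (U.baseChangeChart L).fixedPrimes) : U.baseChangeIncl L q ∈ U.fixedPrimes := by
  intro g a
  rw [mem_baseChangeIncl]
  have := h g ((1 : L) ⊗ₜ[K] a)
  change (Algebra.TensorProduct.map (AlgHom.id L L) (U.act g)) ((1 : L) ⊗ₜ[K] a) - _ ∈ _ at this
  rwa [Algebra.TensorProduct.map_tmul, AlgHom.id_apply, ← TensorProduct.tmul_sub] at this

end BaseChange

end AffineChart
end Charts

end

/-! ### Charts on which the action is diagonalized -/

section

section FixCoords

open Polynomial TensorProduct

variable {K : Type u} [Field K] {G : Type u} [Group G] {X : Action (Over (Spec (.of K))) G}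

/-- Coordinates `y i`, `t` on a chart which diagonalize the action. The `y i` have nontrivial
characters `ψ i` and `t` is invariant, so the fixed locus is given by `y = 0`, and there `f(t) = 0`.
By the field `hom`, the first order neighbourhood of a point with `y = 0` and `f(t) = 0` is
that of the origin in the affine space with coordinates `y i`. -/
structure FixCoords (U : AffineChart X) (f : K[X]) where
  ι : Type
  y : ι → U.A
  t : U.A
  ψ : ι → G → K
  exists_ne_one : ∀ i, ∃ g, ψ i g ≠ 1
  act_y : ∀ g i, U.act g (y i) = ψ i g • y i
  act_t : ∀ g, U.act g t = t
  gen : Algebra.adjoin K (insert t (Set.range y)) = ⊤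
  rel : aeval t f ∈ Ideal.span (Set.range y)
  hom : ∀ (L : Type u) [Field L] [Algebra K L] (b : L), aeval b f = 0 → ∀ v : ι → L,
    ∃ θ : U.A →ₐ[K] DualNumber L, (∀ i, θ (y i) = TrivSqZeroExt.inr (v i)) ∧
      θ t = TrivSqZeroExt.inl b

namespace FixCoords

variable {U : AffineChart X} {f : K[X]} (Φ : FixCoords U f)

theorem mem_fixedPrimes (q : Spec (.of U.A)) :
    q ∈ U.fixedPrimes ↔ ∀ i, Φ.y i ∈ q.asIdeal := by
  constructor
  · intro h i
    obtain ⟨g, hg⟩ := Φ.exists_ne_one i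
    have := h g (Φ.y i)
    rw [Φ.act_y, ← one_smul K (Φ.y i), smul_smul, mul_one, ← sub_smul] at this
    have := Submodule.smul_of_tower_mem q.asIdeal (Φ.ψ i g - 1)⁻¹ this
    rwa [smul_smul, inv_mul_cancel₀ (sub_ne_zero.2 hg), one_smul] at this
  · intro h g a
    have : (U.eval q).comp (U.act g) = U.eval q := by
      refine AlgHom.ext_of_adjoin_eq_top Φ.gen ?_
      rintro _ (rfl | ⟨i, rfl⟩)
      · rw [AlgHom.comp_apply, Φ.act_t]
      · rw [AlgHom.comp_apply, Φ.act_y, map_smul, (U.eval_eq_zero q _).2 (h i), smul_zero]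
    rw [← U.eval_eq_zero, map_sub, sub_eq_zero]
    exact DFunLike.congr_fun this a

theorem aeval_eval_t {q : Spec (.of U.A)} (hq : q ∈ U.fixedPrimes) :
    aeval (U.eval q Φ.t) f = 0 := by
  rw [aeval_algHom_apply, U.eval_eq_zero]
  refine (Ideal.span_le.2 ?_) Φ.rel
  rintro _ ⟨i, rfl⟩
  exact (Φ.mem_fixedPrimes q).1 hq i

/-- At a fixed point the `y i` vanish, so all values of functions are polynomials in the value of
`t`. -/
theorem eval_mem_adjoin {q : Spec (.of U.A)} (hq : q ∈ U.fixedPrimes) (a : U.A) :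
    U.eval q a ∈ Algebra.adjoin K {U.eval q Φ.t} := by
  have : a ∈ Algebra.adjoin K (insert Φ.t (Set.range Φ.y)) := Φ.gen ▸ Algebra.mem_top
  have h : Algebra.adjoin K (insert Φ.t (Set.range Φ.y)) ≤
      (Algebra.adjoin K {U.eval q Φ.t}).comap (U.eval q) := by
    rw [Algebra.adjoin_le_iff]
    rintro _ (rfl | ⟨i, rfl⟩)
    · exact Algebra.subset_adjoin rfl
    · change U.eval q (Φ.y i) ∈ Algebra.adjoin K {U.eval q Φ.t}
      rw [(U.eval_eq_zero q _).2 ((Φ.mem_fixedPrimes q).1 hq i)]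
      exact zero_mem _
  exact h this

/-- The fixed points in a chart form a discrete set, since the algebra given by `y = 0` is generated
by a root of `f` and therefore finite. -/
theorem discreteTopology_quotient (hf : f ≠ 0) :
    DiscreteTopology (PrimeSpectrum (U.A ⧸ Ideal.span (Set.range Φ.y))) := by
  set I := Ideal.span (Set.range Φ.y)
  have ht : IsIntegral K (Ideal.Quotient.mkₐ K I Φ.t) := by
    refine IsAlgebraic.isIntegral ⟨f, hf, ?_⟩
    rw [aeval_algHom_apply]
    exact Ideal.Quotient.eq_zero_iff_mem.2 Φ.rel
  have hfin := Algebra.finite_adjoin_simple_of_isIntegral ht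
  have htop : Algebra.adjoin K {Ideal.Quotient.mkₐ K I Φ.t} = ⊤ := by
    rw [eq_top_iff, ← (AlgHom.range_eq_top _).2 (Ideal.Quotient.mkₐ_surjective K I),
      ← Algebra.map_top, ← Φ.gen, AlgHom.map_adjoin, Algebra.adjoin_le_iff]
    rintro _ ⟨_, rfl | ⟨i, rfl⟩, rfl⟩
    · exact Algebra.subset_adjoin rfl
    · have : Ideal.Quotient.mkₐ K I (Φ.y i) = 0 :=
        Ideal.Quotient.eq_zero_iff_mem.2 (Ideal.subset_span ⟨i, rfl⟩)
      rw [this]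
      exact zero_mem _
  rw [htop] at hfin
  have : Module.Finite K (U.A ⧸ I) := Module.Finite.equiv (Subalgebra.topEquiv.toLinearEquiv)
  have : IsArtinianRing (U.A ⧸ I) := IsArtinianRing.of_finite K _
  infer_instance

include Φ in
/-- A fixed point in the chart is isolated in the fixed locus. -/
theorem exists_isOpen (hf : f ≠ 0) {q : Spec (.of U.A)} (hq : q ∈ U.fixedPrimes) :
    ∃ V : Set X.V.left, IsOpen V ∧ U.pt q ∈ V ∧ ∀ x ∈ V, x ∈ fixedLocus X → x = U.pt q := by
  set I := Ideal.span (Set.range Φ.y) with hI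
  have hd := Φ.discreteTopology_quotient hf
  have hcl := PrimeSpectrum.isClosedEmbedding_comap_of_surjective (U.A ⧸ I)
    (Ideal.Quotient.mk I) Ideal.Quotient.mk_surjective
  have hr : ∀ q : Spec (.of U.A), q ∈ U.fixedPrimes →
      ∃ q', PrimeSpectrum.comap (Ideal.Quotient.mk I) q' = q := by
    intro q hq
    have : q ∈ Set.range (PrimeSpectrum.comap (Ideal.Quotient.mk I)) := by
      rw [range_comap_of_surjective _ _ Ideal.Quotient.mk_surjective,
        Ideal.mk_ker]
      change I ≤ q.asIdeal
      refine Ideal.span_le.2 ?_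
      rintro _ ⟨i, rfl⟩
      exact (Φ.mem_fixedPrimes q).1 hq i
    exact this
  obtain ⟨q₀, rfl⟩ := hr q hq
  obtain ⟨W, hW, hW'⟩ := hcl.isInducing.isOpen_iff.1 (isOpen_discrete {q₀})
  refine ⟨U.j '' W, U.j.isOpenEmbedding.isOpenMap _ hW, ⟨_, ?_, rfl⟩, ?_⟩
  · have : q₀ ∈ PrimeSpectrum.comap (Ideal.Quotient.mk I) ⁻¹' W := hW' ▸ rfl
    exact this
  · rintro _ ⟨q', hq'W, rfl⟩ hx
    obtain ⟨q₁, rfl⟩ := hr q' ((U.pt_mem_fixedLocus q').1 hx)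
    have : q₁ ∈ PrimeSpectrum.comap (Ideal.Quotient.mk I) ⁻¹' W := hq'W
    rw [hW'] at this
    rw [show q₁ = q₀ from this]

/-- A root of `f` in an extension field gives a fixed point. -/
theorem exists_fixedPrime {L : Type u} [Field L] [Algebra K L] {b : L} (hb : aeval b f = 0) :
    ∃ q ∈ U.fixedPrimes, ∃ θ : U.A →ₐ[K] L, θ Φ.t = b ∧ ∀ a, θ a = 0 ↔ a ∈ q.asIdeal := by
  obtain ⟨θ, hy, ht⟩ := Φ.hom L b hb 0
  let θ' : U.A →ₐ[K] L := (TrivSqZeroExt.fstHom K L L).comp θ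
  let q : Spec (.of U.A) := ⟨RingHom.ker θ', RingHom.ker_isPrime _⟩
  refine ⟨q, (Φ.mem_fixedPrimes q).2 fun i => ?_, θ', ?_, fun a => Iff.rfl⟩
  · change TrivSqZeroExt.fst (θ (Φ.y i)) = 0
    rw [hy, TrivSqZeroExt.fst_inr]
  · change TrivSqZeroExt.fst (θ Φ.t) = b
    rw [ht, TrivSqZeroExt.fst_inl]

/-- Every function is constant modulo `t - b` and the `y i`. -/
theorem apply_sub_mem (b : K) (a : U.A) :
    ∃ r : K, a - algebraMap K U.A r ∈
      Ideal.span (insert (Φ.t - algebraMap K U.A b) (Set.range Φ.y)) := by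
  set I := Ideal.span (insert (Φ.t - algebraMap K U.A b) (Set.range Φ.y)) with hI
  have h : Algebra.adjoin K (insert Φ.t (Set.range Φ.y)) ≤
      (⊥ : Subalgebra K (U.A ⧸ I)).comap (Ideal.Quotient.mkₐ K I) := by
    rw [Algebra.adjoin_le_iff]
    rintro _ (rfl | ⟨i, rfl⟩)
    · refine Algebra.mem_bot.2 ⟨b, ?_⟩
      rw [← (Ideal.Quotient.mkₐ K I).commutes]
      exact (Ideal.Quotient.eq.2 (Ideal.subset_span (Set.mem_insert _ _))).symm
    · change Ideal.Quotient.mkₐ K I (Φ.y i) ∈ (⊥ : Subalgebra K (U.A ⧸ I))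
      have : Ideal.Quotient.mkₐ K I (Φ.y i) = 0 :=
        Ideal.Quotient.eq_zero_iff_mem.2 (Ideal.subset_span (Set.mem_insert_of_mem _ ⟨i, rfl⟩))
      rw [this]
      exact zero_mem _
  rw [Φ.gen] at h
  obtain ⟨r, hr⟩ := Algebra.mem_bot.1 (h (Algebra.mem_top (x := a)))
  refine ⟨r, Ideal.Quotient.eq.1 ?_⟩
  rw [← (Ideal.Quotient.mkₐ K I).commutes] at hr
  exact hr.symm

theorem span_le {q : Spec (.of U.A)} (hq : q ∈ U.fixedPrimes) {b : K}
    (hb : U.eval q Φ.t = algebraMap K _ b) :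
    Ideal.span (insert (Φ.t - algebraMap K U.A b) (Set.range Φ.y)) ≤ q.asIdeal := by
  rw [Ideal.span_le]
  rintro _ (rfl | ⟨i, rfl⟩)
  · change _ ∈ q.asIdeal
    rw [← U.eval_eq_zero, map_sub, (U.eval q).commutes, hb, sub_self]
  · exact (Φ.mem_fixedPrimes q).1 hq i

theorem span_eq {q : Spec (.of U.A)} (hq : q ∈ U.fixedPrimes) {b : K}
    (hb : U.eval q Φ.t = algebraMap K _ b) :
    q.asIdeal = Ideal.span (insert (Φ.t - algebraMap K U.A b) (Set.range Φ.y)) := by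
  refine le_antisymm (fun a ha => ?_) (Φ.span_le hq hb)
  obtain ⟨r, hr⟩ := Φ.apply_sub_mem b a
  have h1 : algebraMap K U.A r ∈ q.asIdeal := by
    have := q.asIdeal.sub_mem ha (Φ.span_le hq hb hr)
    rwa [sub_sub_cancel] at this
  rw [← U.eval_eq_zero, (U.eval q).commutes, map_eq_zero] at h1
  rwa [h1, map_zero, sub_zero] at hr

theorem isRationalPoint {q : Spec (.of U.A)} (hq : q ∈ U.fixedPrimes) {b : K}
    (hb : U.eval q Φ.t = algebraMap K _ b) : IsRationalPoint X.V (U.pt q) :=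
  U.isRationalPoint q fun a => (Φ.apply_sub_mem b a).imp fun _ h => Φ.span_le hq hb h

theorem aeval_eq_zero {q : Spec (.of U.A)} (hq : q ∈ U.fixedPrimes) {b : K}
    (hb : U.eval q Φ.t = algebraMap K _ b) : f.eval b = 0 := by
  have := Φ.aeval_eval_t hq
  rwa [hb, aeval_algebraMap_apply, map_eq_zero] at this

/-- At a fixed point the maximal ideal of the local ring is generated by the `y i`, since `b`
is a simple root of `f`. -/
theorem maximalIdeal_le (hf : f.Separable) {q : Spec (.of U.A)} (hq : q ∈ U.fixedPrimes) {b : K}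
    (hb : U.eval q Φ.t = algebraMap K _ b) :
    IsLocalRing.maximalIdeal (X.V.left.presheaf.stalk (U.pt q)) ≤
      Ideal.span (Set.range fun i =>
        algebraMap U.A (X.V.left.presheaf.stalk (U.pt q)) (Φ.y i)) := by
  set R := X.V.left.presheaf.stalk (U.pt q)
  -- `f = (X - b) * h`, where `h` does not vanish at `b`
  obtain ⟨h, hh⟩ := dvd_iff_isRoot.2 (Φ.aeval_eq_zero hq hb)
  have hhb : h.eval b ≠ 0 := by
    intro h0
    obtain ⟨h', rfl⟩ := dvd_iff_isRoot.2 h0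
    have : Squarefree f := hf.squarefree
    have := this (Polynomial.X - C b) ⟨h', by rw [hh, mul_assoc]⟩
    exact not_isUnit_X_sub_C b this
  have hu : IsUnit (algebraMap U.A R (aeval Φ.t h)) := by
    refine IsLocalization.map_units R (⟨aeval Φ.t h, fun hm => hhb ?_⟩ : q.asIdeal.primeCompl)
    replace hm := (U.eval_eq_zero q _).2 hm
    rwa [← aeval_algHom_apply, hb, aeval_algebraMap_apply, map_eq_zero] at hm
  have hspan : ∀ a ∈ Ideal.span (Set.range Φ.y), algebraMap U.A R a ∈
      Ideal.span (Set.range fun i => algebraMap U.A R (Φ.y i)) := by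
    intro a ha
    have := Ideal.mem_map_of_mem (algebraMap U.A R) ha
    rw [Ideal.map_span] at this
    refine Ideal.span_mono ?_ this
    rintro _ ⟨_, ⟨i, rfl⟩, rfl⟩
    exact ⟨i, rfl⟩
  rw [← IsLocalization.AtPrime.map_eq_maximalIdeal q.asIdeal R, Ideal.map_le_iff_le_comap,
    Φ.span_eq hq hb, Ideal.span_le]
  rintro _ (rfl | ⟨i, rfl⟩)
  · have h1 := hspan _ Φ.rel
    have h2 : aeval Φ.t f = (Φ.t - algebraMap K U.A b) * aeval Φ.t h := by
      rw [congrArg (aeval Φ.t) hh, map_mul, map_sub, aeval_X, aeval_C]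
    rw [h2, map_mul] at h1
    exact (Ideal.mul_unit_mem_iff_mem _ hu).1 h1
  · exact Ideal.subset_span ⟨i, rfl⟩

/-- The tangent vector at a fixed point which is dual to `y i`. -/
theorem exists_dualNumber {q : Spec (.of U.A)} (hq : q ∈ U.fixedPrimes) {b : K}
    (hb : U.eval q Φ.t = algebraMap K _ b) (i : Φ.ι) :
    ∃ θ : U.A →ₐ[K] DualNumber K, (∀ a, (θ a).fst = 0 ↔ a ∈ q.asIdeal) ∧
      (θ (Φ.y i)).snd ≠ 0 ∧ ∀ j, j ≠ i → (θ (Φ.y j)).snd = 0 := by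
  classical
  obtain ⟨θ, hy, ht⟩ := Φ.hom K b (by
    rw [coe_aeval_eq_eval]; exact Φ.aeval_eq_zero hq hb) (Pi.single i 1)
  have h1 : Ideal.span (insert (Φ.t - algebraMap K U.A b) (Set.range Φ.y)) ≤
      RingHom.ker ((TrivSqZeroExt.fstHom K K K).comp θ) := by
    rw [Ideal.span_le]
    rintro _ (rfl | ⟨i, rfl⟩)
    · change (θ (Φ.t - algebraMap K U.A b)).fst = 0
      rw [map_sub, ht, θ.commutes]
      exact sub_self b
    · change (θ (Φ.y i)).fst = 0
      rw [hy, TrivSqZeroExt.fst_inr]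
  refine ⟨θ, fun a => ?_, ?_, fun j hj => ?_⟩
  · refine ⟨fun ha => ?_, fun ha => ?_⟩
    · obtain ⟨r, hr⟩ := Φ.apply_sub_mem b a
      have h2 : (θ (a - algebraMap K U.A r)).fst = 0 := h1 hr
      rw [map_sub, θ.commutes, TrivSqZeroExt.fst_sub, ha, zero_sub, neg_eq_zero] at h2
      have h3 : r = 0 := h2
      rw [h3, map_zero, sub_zero] at hr
      exact Φ.span_le hq hb hr
    · rw [Φ.span_eq hq hb] at ha
      exact h1 ha
  · rw [hy]; simp
  · rw [hy]; simp [hj]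

theorem y_mem {q : Spec (.of U.A)} (hq : q ∈ U.fixedPrimes) (i : Φ.ι) : Φ.y i ∈ q.asIdeal :=
  (Φ.mem_fixedPrimes q).1 hq i

/-- The differentials of the `y i` form a basis of the cotangent space at a fixed point. -/
def cotangentBasis (hf : f.Separable) {q : Spec (.of U.A)} (hq : q ∈ U.fixedPrimes) {b : K}
    (hb : U.eval q Φ.t = algebraMap K _ b) :
    Module.Basis Φ.ι K (IsLocalRing.CotangentSpace (X.V.left.presheaf.stalk (U.pt q))) :=
  Module.Basis.mk (v := fun i => cotangentClass q.asIdeal ⟨Φ.y i, Φ.y_mem hq i⟩)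
    (linearIndependent_cotangentClass q.asIdeal (Φ.y_mem hq) (Φ.exists_dualNumber hq hb))
    (span_cotangentClass q.asIdeal (Φ.y_mem hq) (fun z => by
      obtain ⟨r, hr⟩ := (Φ.isRationalPoint hq hb).2 (IsLocalRing.residue _ z)
      refine ⟨r, ?_⟩
      rw [← IsLocalRing.residue_eq_zero_iff, map_sub, sub_eq_zero]
      exact hr.symm) (Φ.maximalIdeal_le hf hq hb))

theorem cotangentAct_basis (hf : f.Separable) {q : Spec (.of U.A)} (hq : q ∈ U.fixedPrimes) {b : K}
    (hb : U.eval q Φ.t = algebraMap K _ b) (g : G) (i : Φ.ι) :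
    cotangentAct X ⟨U.pt q, (U.pt_mem_fixedLocus q).2 hq⟩ g (Φ.cotangentBasis hf hq hb i) =
      Φ.ψ i g • Φ.cotangentBasis hf hq hb i := by
  have h : ∀ i, Φ.cotangentBasis hf hq hb i = cotangentClass q.asIdeal ⟨Φ.y i, Φ.y_mem hq i⟩ :=
    fun i => Module.Basis.mk_apply _ _ i
  have hm : U.act g (Φ.y i) ∈ q.asIdeal := by
    rw [Φ.act_y]
    exact Submodule.smul_of_tower_mem _ _ (Φ.y_mem hq i)
  rw [h, U.cotangentAct_class q _ g _ hm]
  refine congrArg (Ideal.toCotangent _)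
    (Subtype.ext ?_ : _ = Φ.ψ i g • (⟨algebraMap U.A (X.V.left.presheaf.stalk (U.pt q)) (Φ.y i),
      algebraMap_mem_maximalIdeal q.asIdeal (Φ.y_mem hq i)⟩ :
        IsLocalRing.maximalIdeal (X.V.left.presheaf.stalk (U.pt q))))
  change algebraMap U.A (X.V.left.presheaf.stalk (U.pt q)) (U.act g (Φ.y i)) =
    Φ.ψ i g • algebraMap U.A (X.V.left.presheaf.stalk (U.pt q)) (Φ.y i)
  rw [Φ.act_y]
  exact map_smul (IsScalarTower.toAlgHom K U.A (X.V.left.presheaf.stalk (U.pt q))) _ _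

end FixCoords
end FixCoords

end

/-! ### Fixed points from a family of charts -/

section

section FixCharts

open Polynomial TensorProduct

variable {K : Type u} [Field K] {G : Type u} [Group G] {X Y : Action (Over (Spec (.of K))) G}

/-- The base change of the coordinates on a chart. -/
def FixCoords.baseChange {U : AffineChart X} {f : K[X]} (Φ : FixCoords U f)
    (L : Type u) [Field L] [Algebra K L] :
    FixCoords (U.baseChangeChart L) (f.map (algebraMap K L)) where
  ι := Φ.ι
  y i := (1 : L) ⊗ₜ[K] Φ.y i
  t := (1 : L) ⊗ₜ[K] Φ.t
  ψ i g := algebraMap K L (Φ.ψ i g)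
  exists_ne_one i := by
    obtain ⟨g, hg⟩ := Φ.exists_ne_one i
    exact ⟨g, fun h => hg ((algebraMap K L).injective (h.trans (map_one _).symm))⟩
  act_y g i := by
    change (Algebra.TensorProduct.map (AlgHom.id L L) (U.act g)) ((1 : L) ⊗ₜ[K] Φ.y i) =
      algebraMap K L (Φ.ψ i g) • ((1 : L) ⊗ₜ[K] Φ.y i)
    rw [Algebra.TensorProduct.map_tmul, Φ.act_y, AlgHom.id_apply, TensorProduct.tmul_smul,
      algebraMap_smul]
  act_t g := by
    change (Algebra.TensorProduct.map (AlgHom.id L L) (U.act g)) ((1 : L) ⊗ₜ[K] Φ.t) = _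
    rw [Algebra.TensorProduct.map_tmul, Φ.act_t, AlgHom.id_apply]
  gen := by
    have := Algebra.TensorProduct.adjoin_one_tmul_image_eq_top (A := L) _ Φ.gen
    rw [Set.image_insert_eq, ← Set.range_comp] at this
    exact this
  rel := by
    have h := Ideal.mem_map_of_mem (Algebra.TensorProduct.includeRight : U.A →ₐ[K] L ⊗[K] U.A) Φ.rel
    rw [Ideal.map_span, ← Set.range_comp, ← aeval_algHom_apply] at h
    change aeval ((1 : L) ⊗ₜ[K] Φ.t : L ⊗[K] U.A) (f.map (algebraMap K L)) ∈ _
    rw [aeval_map_algebraMap]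
    exact h
  hom M _ _ b hb v := by
    let _ : Algebra K M := Algebra.compHom M (algebraMap K L)
    have : IsScalarTower K L M := IsScalarTower.of_algebraMap_eq fun _ => rfl
    have : IsScalarTower K L (DualNumber M) := IsScalarTower.of_algebraMap_eq fun _ => rfl
    rw [aeval_map_algebraMap] at hb
    obtain ⟨θ, hy, ht⟩ := Φ.hom M b hb v
    refine ⟨Algebra.TensorProduct.lift (Algebra.ofId L (DualNumber M)) θ
      fun _ _ => Commute.all _ _, fun i => ?_, ?_⟩
    · refine (Algebra.TensorProduct.lift_tmul ..).trans ?_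
      rw [map_one, one_mul, hy]
    · refine (Algebra.TensorProduct.lift_tmul ..).trans ?_
      rw [map_one, one_mul, ht]

/-- A scheme with `G`-action covered by `G`-stable affine charts, and a family of charts with
coordinates which contain all fixed points, no two of them sharing a fixed point. -/
structure FixCharts (X : Action (Over (Spec (.of K))) G) (f : K[X]) (C : Type) where
  exists_chart : ∀ x : X.V.left, ∃ (U : AffineChart X) (q : Spec (.of U.A)), U.pt q = x
  chart : C → AffineChart X
  coords : ∀ c, FixCoords (chart c) f
  exists_pt : ∀ x ∈ fixedLocus X, ∃ (c : C) (q : Spec (.of (chart c).A)), (chart c).pt q = x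
  eq_of_pt_eq : ∀ c c' (q : Spec (.of (chart c).A)) (q' : Spec (.of (chart c').A)),
    q ∈ (chart c).fixedPrimes → (chart c).pt q = (chart c').pt q' → c = c'

namespace FixCharts

variable {f f' : K[X]} {C C' : Type} (Ψ : FixCharts X f C) (Ψ' : FixCharts Y f' C')

theorem exists_fixedPrime {x : X.V.left} (hx : x ∈ fixedLocus X) :
    ∃ (c : C) (q : Spec (.of (Ψ.chart c).A)), q ∈ (Ψ.chart c).fixedPrimes ∧
      (Ψ.chart c).pt q = x := by
  obtain ⟨c, q, rfl⟩ := Ψ.exists_pt x hx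
  exact ⟨c, q, ((Ψ.chart c).pt_mem_fixedLocus q).1 hx, rfl⟩

include Ψ in
theorem topologicalKrullDim_fixedLocus [Nonempty C] (hf : 0 < f.natDegree) :
    topologicalKrullDim (fixedLocus X) = 0 := by
  have hf0 : f ≠ 0 := fun h => by simp [h] at hf
  have hd : DiscreteTopology (fixedLocus X) := by
    refine discreteTopology_iff_isOpen_singleton.2 fun ⟨x, hx⟩ => ?_
    obtain ⟨c, q, hq, rfl⟩ := Ψ.exists_fixedPrime hx
    obtain ⟨V, hV, hxV, h⟩ := (Ψ.coords c).exists_isOpen hf0 hq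
    refine isOpen_induced_iff.2 ⟨V, hV, ?_⟩
    ext ⟨x', hx'⟩
    rw [Set.mem_preimage, Set.mem_singleton_iff, Subtype.mk_eq_mk]
    exact ⟨fun h' => h x' h' hx', fun h' => h' ▸ hxV⟩
  refine le_antisymm (topologicalKrullDim_zero_of_discreteTopology _) ?_
  have hdeg : f.degree ≠ 0 := fun h => by
    rw [natDegree_eq_of_degree_eq_some h] at hf
    exact lt_irrefl 0 hf
  let L := AlgebraicClosure K
  obtain ⟨b, hb⟩ := IsAlgClosed.exists_aeval_eq_zero L f hdeg
  obtain ⟨q, hq, -⟩ := (Ψ.coords (Classical.arbitrary C)).exists_fixedPrime hb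
  let x : fixedLocus X := ⟨_, ((Ψ.chart _).pt_mem_fixedLocus q).2 hq⟩
  have : Nonempty (TopologicalSpace.IrreducibleCloseds (fixedLocus X)) :=
    ⟨⟨{x}, isIrreducible_singleton, isClosed_discrete _⟩⟩
  exact Order.krullDim_nonneg

theorem exists_eval_eq (hs : f.Splits) (hf : f ≠ 0) {c : C} {q : Spec (.of (Ψ.chart c).A)}
    (hq : q ∈ (Ψ.chart c).fixedPrimes) :
    ∃ b : K, (Ψ.chart c).eval q (Ψ.coords c).t = algebraMap K _ b := by
  have := (Ψ.coords c).aeval_eval_t hq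
  obtain ⟨b, hb⟩ := hs.mem_range_of_isRoot hf (i := algebraMap K _)
    (x := (Ψ.chart c).eval q (Ψ.coords c).t) (by
      rw [IsRoot, eval_map_algebraMap]; exact this)
  exact ⟨b, hb.symm⟩

include Ψ in
theorem isRationalPoint (hs : f.Splits) (hf : f ≠ 0) {x : X.V.left} (hx : x ∈ fixedLocus X) :
    IsRationalPoint X.V x := by
  obtain ⟨c, q, hq, rfl⟩ := Ψ.exists_fixedPrime hx
  obtain ⟨b, hb⟩ := Ψ.exists_eval_eq hs hf hq
  exact (Ψ.coords c).isRationalPoint hq hb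

include Ψ in
theorem isNice [Nonempty C] (hs : f.Splits) (hf : 0 < f.natDegree) : IsNice X :=
  ⟨Ψ.topologicalKrullDim_fixedLocus hf, fun _ hx => Ψ.isRationalPoint hs
    (fun h => by simp [h] at hf) hx⟩

theorem exists_point (s : C × {b : K // f.eval b = 0}) :
    ∃ (q : Spec (.of (Ψ.chart s.1).A)), q ∈ (Ψ.chart s.1).fixedPrimes ∧
      (Ψ.chart s.1).eval q (Ψ.coords s.1).t = algebraMap K _ s.2.1 := by
  obtain ⟨q, hq, θ, hθ, h⟩ := (Ψ.coords s.1).exists_fixedPrime (L := K) (b := s.2.1)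
    (by rw [coe_aeval_eq_eval]; exact s.2.2)
  refine ⟨q, hq, ?_⟩
  rw [← sub_eq_zero, ← ((Ψ.chart s.1).eval q).commutes, ← map_sub, AffineChart.eval_eq_zero, ← h,
    map_sub, hθ, θ.commutes]
  exact sub_self _

/-- The prime ideal of the fixed point with `t = b` in the chart `c`. -/
def prime (s : C × {b : K // f.eval b = 0}) : Spec (.of (Ψ.chart s.1).A) :=
  (Ψ.exists_point s).choose

theorem prime_mem (s : C × {b : K // f.eval b = 0}) : Ψ.prime s ∈ (Ψ.chart s.1).fixedPrimes :=
  (Ψ.exists_point s).choose_spec.1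

theorem eval_prime (s : C × {b : K // f.eval b = 0}) :
    (Ψ.chart s.1).eval (Ψ.prime s) (Ψ.coords s.1).t = algebraMap K _ s.2.1 :=
  (Ψ.exists_point s).choose_spec.2

/-- The fixed point with `t = b` in the chart `c`. -/
def point (s : C × {b : K // f.eval b = 0}) : fixedLocus X :=
  ⟨(Ψ.chart s.1).pt (Ψ.prime s), ((Ψ.chart s.1).pt_mem_fixedLocus _).2 (Ψ.prime_mem s)⟩

/-- If `f` splits, the fixed points correspond to pairs of a chart and a root of `f`. -/
theorem point_bijective (hs : f.Splits) (hf : f ≠ 0) : Function.Bijective Ψ.point := by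
  constructor
  · rintro ⟨c, b⟩ ⟨c', b'⟩ h
    have h : (Ψ.chart c).pt (Ψ.prime (c, b)) = (Ψ.chart c').pt (Ψ.prime (c', b')) :=
      congrArg Subtype.val h
    obtain rfl := Ψ.eq_of_pt_eq c c' _ _ (Ψ.prime_mem (c, b)) h
    have h1 := (Ψ.chart c).pt_injective h
    have h2 := Ψ.eval_prime (c, b)
    have h3 := Ψ.eval_prime (c, b')
    rw [← h1] at h3
    have h4 := h2.symm.trans h3
    rw [Prod.mk.injEq]
    exact ⟨rfl, Subtype.ext ((algebraMap K _).injective h4)⟩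
  · rintro ⟨x, hx⟩
    obtain ⟨c, q, hq, rfl⟩ := Ψ.exists_fixedPrime hx
    obtain ⟨b, hb⟩ := Ψ.exists_eval_eq hs hf hq
    let s : C × {b : K // f.eval b = 0} := (c, ⟨b, (Ψ.coords c).aeval_eq_zero hq hb⟩)
    refine ⟨s, Subtype.ext (congrArg (Ψ.chart c).pt (PrimeSpectrum.ext ?_))⟩
    rw [(Ψ.coords c).span_eq hq hb]
    exact (Ψ.coords c).span_eq (Ψ.prime_mem s) (Ψ.eval_prime s)

/-- A bijection of the pairs of a chart and a root which respects the characters of the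
coordinates gives an equivalence of the fixed points with their tangent spaces. -/
theorem exists_equiv (hs : f.Splits) (hs' : f'.Splits) (hf : f.Separable) (hf' : f'.Separable)
    (E : C × {b : K // f.eval b = 0} ≃ C' × {b : K // f'.eval b = 0})
    (hE : ∀ s, ∃ e : (Ψ.coords s.1).ι ≃ (Ψ'.coords (E s).1).ι, ∀ i,
      (Ψ'.coords (E s).1).ψ (e i) = (Ψ.coords s.1).ψ i) :
    ∃ e : fixedLocus X ≃ fixedLocus Y,
      ∀ x, Nonempty ((tangentRep X x).Equiv (tangentRep Y (e x))) := by
  let P := Equiv.ofBijective _ (Ψ.point_bijective hs hf.ne_zero)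
  let P' := Equiv.ofBijective _ (Ψ'.point_bijective hs' hf'.ne_zero)
  refine ⟨P.symm.trans (E.trans P'), fun x => ?_⟩
  obtain ⟨s, rfl⟩ := P.surjective x
  obtain ⟨e, he⟩ := hE s
  rw [Equiv.trans_apply, Equiv.symm_apply_apply, Equiv.trans_apply]
  exact nonempty_equiv_dual ((Ψ.coords s.1).cotangentBasis hf (Ψ.prime_mem s) (Ψ.eval_prime s))
    ((Ψ'.coords (E s).1).cotangentBasis hf' (Ψ'.prime_mem (E s)) (Ψ'.eval_prime (E s)))
    (cotangentAct X (Ψ.point s)) (cotangentAct Y (Ψ'.point (E s))) _ _ (fun g => rfl) (fun g => rfl)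
    _ _ ((Ψ.coords s.1).cotangentAct_basis hf (Ψ.prime_mem s) (Ψ.eval_prime s))
    ((Ψ'.coords (E s).1).cotangentAct_basis hf' (Ψ'.prime_mem (E s)) (Ψ'.eval_prime (E s))) e he

/-- The base change of a family of charts. -/
def baseChange (L : Type u) [Field L] [Algebra K L] :
    FixCharts (NormVar.baseChange K L X) (f.map (algebraMap K L)) C where
  exists_chart z := by
    obtain ⟨U, q, h⟩ := Ψ.exists_chart (AffineChart.proj L X z)
    exact ⟨U.baseChangeChart L, U.exists_pt_of_proj_eq L z q h.symm⟩
  chart c := (Ψ.chart c).baseChangeChart L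
  coords c := (Ψ.coords c).baseChange L
  exists_pt z hz := by
    obtain ⟨U, q, h⟩ := Ψ.exists_chart (AffineChart.proj L X z)
    obtain ⟨q', rfl⟩ := U.exists_pt_of_proj_eq L z q h.symm
    have hq' := (AffineChart.pt_mem_fixedLocus _ q').1 hz
    have hx := (U.pt_mem_fixedLocus _).2 (U.baseChangeIncl_mem_fixedPrimes L hq')
    rw [← U.baseChangeChart_proj] at hx
    obtain ⟨c, q, hq⟩ := Ψ.exists_pt _ hx
    exact ⟨c, (Ψ.chart c).exists_pt_of_proj_eq L _ q hq.symm⟩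
  eq_of_pt_eq c c' q q' hq h := by
    refine Ψ.eq_of_pt_eq c c' _ ((Ψ.chart c').baseChangeIncl L q')
      ((Ψ.chart c).baseChangeIncl_mem_fixedPrimes L hq) ?_
    rw [← AffineChart.baseChangeChart_proj, ← AffineChart.baseChangeChart_proj, h]

theorem fixedPointEquivalentOver [Nonempty C] [Nonempty C'] (L : Type u) [Field L] [Algebra K L]
    (hL : Algebra.IsSeparable K L) (hs : (f.map (algebraMap K L)).Splits)
    (hs' : (f'.map (algebraMap K L)).Splits) (hf : f.Separable) (hf' : f'.Separable)
    (hd : 0 < f.natDegree) (hd' : 0 < f'.natDegree)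
    (hsm : fixedLocus X ⊆ smoothSet X.V) (hsm' : fixedLocus Y ⊆ smoothSet Y.V)
    (E : C × {b : L // (f.map (algebraMap K L)).eval b = 0} ≃
      C' × {b : L // (f'.map (algebraMap K L)).eval b = 0})
    (hE : ∀ s, ∃ e : (Ψ.coords s.1).ι ≃ (Ψ'.coords (E s).1).ι, ∀ i,
      (Ψ'.coords (E s).1).ψ (e i) = (Ψ.coords s.1).ψ i) :
    FixedPointEquivalentOver K L X Y :=
  ⟨Ψ.topologicalKrullDim_fixedLocus hd, Ψ'.topologicalKrullDim_fixedLocus hd', hsm, hsm', hL,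
    fun _ => (Ψ.baseChange L).isRationalPoint hs hf.map.ne_zero,
    fun _ => (Ψ'.baseChange L).isRationalPoint hs' hf'.map.ne_zero,
    (Ψ.baseChange L).exists_equiv (Ψ'.baseChange L) hs hs' hf.map hf'.map E fun s => by
      obtain ⟨e, he⟩ := hE s
      refine ⟨e, fun i => funext fun g => ?_⟩
      exact congrArg (algebraMap K L) (congrFun (he i) g)⟩

end FixCharts

theorem isSplittingField_of_adjoin_eq_top {p : ℕ} (hp : 0 < p) {ζ : K} (hζ : IsPrimitiveRoot ζ p)
    {w : K} {L : Type*} [Field L] [Algebra K L] {b : L} (hb : b ^ p = algebraMap K L w)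
    (hL : IntermediateField.adjoin K {b} = ⊤) : IsSplittingField K L (Polynomial.X ^ p - C w) where
  splits' := by
    rw [Polynomial.map_sub, Polynomial.map_pow, map_X, map_C]
    exact X_pow_sub_C_splits_of_isPrimitiveRoot (hζ.map_of_injective (algebraMap K L).injective) hb
  adjoin_rootSet' := by
    have hint : IsIntegral K b := ⟨Polynomial.X ^ p - C w, monic_X_pow_sub_C _ hp.ne', by
      simp [hb]⟩
    rw [eq_top_iff, ← IntermediateField.top_toSubalgebra, ← hL,
      IntermediateField.adjoin_simple_toSubalgebra_of_isAlgebraic hint.isAlgebraic]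
    refine Algebra.adjoin_mono ?_
    rw [Set.singleton_subset_iff, mem_rootSet]
    exact ⟨X_pow_sub_C_ne_zero hp _, by simp [hb]⟩

/-- The residue field of a fixed point is generated by the value of `t`, a root of `X ^ p - w`.
Since the base contains the `p`-th roots of unity, it is a splitting field of this polynomial,
and so is `L`. -/
theorem FixCharts.residueField_equiv {C : Type} {p : ℕ} (hp : 0 < p) {ζ : K}
    (hζ : IsPrimitiveRoot ζ p) {w : K} (Ψ : FixCharts X (Polynomial.X ^ p - Polynomial.C w) C)
    {L : Type*} [Field L] [Algebra K L] {b : L} (hb : b ^ p = algebraMap K L w)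
    (hL : IntermediateField.adjoin K {b} = ⊤) {x : X.V.left} (hx : x ∈ fixedLocus X) :
    Nonempty (X.V.left.residueField x ≃ₐ[K] L) := by
  obtain ⟨c, q, hq, rfl⟩ := Ψ.exists_fixedPrime hx
  set t := (Ψ.chart c).eval q (Ψ.coords c).t
  have ht : t ^ p = algebraMap K _ w := by
    have := (Ψ.coords c).aeval_eval_t hq
    rwa [map_sub, map_pow, aeval_X, aeval_C, sub_eq_zero] at this
  have htop : IntermediateField.adjoin K {t} = ⊤ := by
    rw [eq_top_iff]
    rintro z -
    obtain ⟨a, s, hs, h⟩ := (Ψ.chart c).exists_eval_mul q z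
    have h' : ∀ a, (Ψ.chart c).eval q a ∈ IntermediateField.adjoin K {t} := fun a =>
      IntermediateField.algebra_adjoin_le_adjoin K {t} ((Ψ.coords c).eval_mem_adjoin hq a)
    rw [eq_div_of_mul_eq (fun h => hs ((AffineChart.eval_eq_zero _ q s).1 h)) h]
    exact div_mem (h' a) (h' s)
  have h1 := isSplittingField_of_adjoin_eq_top hp hζ ht htop
  have h2 := isSplittingField_of_adjoin_eq_top hp hζ hb hL
  exact ⟨(IsSplittingField.algEquiv _ (Polynomial.X ^ p - Polynomial.C w)).trans
    (IsSplittingField.algEquiv _ (Polynomial.X ^ p - Polynomial.C w)).symm⟩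

end FixCharts

end

/-! ### The charts of a glued scheme -/

section

namespace GradedCharts

variable {k : Type u} [Field k] {X : GradedCharts k}

variable (X) in
/-- The underlying diagram of schemes of `X.diagram`. -/
abbrev schemeDiagram : X.Indexᵒᵖ ⥤ Scheme.{u} := X.diagram ⋙ Over.forget _

instance {i j : X.Indexᵒᵖ} (f : i ⟶ j) : IsOpenImmersion (X.schemeDiagram.map f) :=
  inferInstanceAs (IsOpenImmersion (X.diagram.map f).left)

instance : (X.schemeDiagram ⋙ Scheme.forget).IsLocallyDirected :=
  inferInstanceAs (X.diagram ⋙ Over.forget _ ⋙ Scheme.forget).IsLocallyDirected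

variable (X) in
/-- The glued scheme as a colimit of schemes. -/
def gluedIso : colimit X.schemeDiagram ≅ X.glued.left :=
  (preservesColimitIso (Over.forget _) X.diagram).symm

variable (X) in
/-- The inclusion of a chart in the colimit of schemes. -/
def schemeι (i : X.Indexᵒᵖ) : (X.diagram.obj i).left ⟶ colimit X.schemeDiagram :=
  colimit.ι X.schemeDiagram i

instance (i : X.Indexᵒᵖ) : IsOpenImmersion (X.schemeι i) :=
  inferInstanceAs (IsOpenImmersion (colimit.ι X.schemeDiagram i))

theorem ι_left (i : X.Indexᵒᵖ) : (colimit.ι X.diagram i).left = X.schemeι i ≫ X.gluedIso.hom :=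
  (ι_preservesColimitIso_inv (Over.forget _) X.diagram i).symm

instance (i : X.Indexᵒᵖ) : IsOpenImmersion (colimit.ι X.diagram i).left := by
  rw [ι_left]; infer_instance

theorem exists_ι (x : X.glued.left) :
    ∃ (i : X.Indexᵒᵖ) (q : (X.diagram.obj i).left), (colimit.ι X.diagram i).left q = x := by
  obtain ⟨i, q, h⟩ := Scheme.IsLocallyDirected.ι_jointly_surjective X.schemeDiagram
    (X.gluedIso.inv x)
  refine ⟨i, q, ?_⟩
  have h : X.schemeι i q = X.gluedIso.inv x := h
  rw [ι_left]
  change X.gluedIso.hom (X.schemeι i q) = x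
  rw [h, ← Scheme.Hom.comp_apply, Iso.inv_hom_id]
  rfl

theorem ι_left_eq_iff {i j : X.Indexᵒᵖ} {q : (X.diagram.obj i).left} {q' : (X.diagram.obj j).left} :
    (colimit.ι X.diagram i).left q = (colimit.ι X.diagram j).left q' ↔
      ∃ (l : X.Indexᵒᵖ) (fi : l ⟶ i) (fj : l ⟶ j) (x : (X.diagram.obj l).left),
        (X.diagram.map fi).left x = q ∧ (X.diagram.map fj).left x = q' := by
  rw [ι_left, ι_left, Scheme.Hom.comp_apply, Scheme.Hom.comp_apply,
    X.gluedIso.hom.isOpenEmbedding.injective.eq_iff]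
  exact Scheme.IsLocallyDirected.ι_eq_ι_iff X.schemeDiagram

variable (X) in
/-- The chart given by a single element of the index set. -/
abbrev single (c : X.C) : X.Indexᵒᵖ := Opposite.op ⟨{c}, Finset.singleton_nonempty c⟩

variable {G : Type u} [CommGroup G] (φ : G → (X.B →ₐ[k] X.B)) (h : ∀ g, X.IsScaling (φ g))
  (h1 : ∀ b, φ 1 b = b) (hm : ∀ g g' b, φ (g * g') b = φ g (φ g' b))

/-- The standard charts of the glued scheme. -/
def affineChart (c : X.C) : AffineChart (X.gluedAction G φ h h1 hm) where
  A := X.chartRing {c}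
  act g := chartMap (h g) (le_refl _)
  j := (colimit.ι X.diagram (X.single c)).left
  isOpen := inferInstanceAs (IsOpenImmersion (colimit.ι X.diagram (X.single c)).left)
  comp_hom := Over.w (colimit.ι X.diagram (X.single c))
  equivariant g := congrArg CommaMorphism.left (ι_gluedMap (h g) (X.single c))

theorem exists_affineChart (x : (X.gluedAction G φ h h1 hm).V.left) :
    ∃ (c : X.C) (q : Spec (.of (affineChart φ h h1 hm c).A)),
      (affineChart φ h h1 hm c).pt q = x := by
  obtain ⟨i, q, rfl⟩ := exists_ι x
  obtain ⟨c, hc⟩ := i.unop.2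
  let f : i ⟶ X.single c :=
    (homOfLE (Finset.singleton_subset_iff.2 hc) : (X.single c).unop ⟶ i.unop).op
  refine ⟨c, (X.diagram.map f).left q, ?_⟩
  change ((X.diagram.map f).left ≫ (colimit.ι X.diagram (X.single c)).left) q = _
  rw [← Over.comp_left, colimit.w]

variable {φ h h1 hm}

/-- A function on a chart which becomes invertible on the overlap with another chart does not vanish
at the points of the overlap. -/
theorem notMem_of_pt_eq {c c' : X.C} {q : Spec (.of (affineChart φ h h1 hm c).A)}
    {q' : Spec (.of (affineChart φ h h1 hm c').A)}
    (hq : (affineChart φ h h1 hm c).pt q = (affineChart φ h h1 hm c').pt q') (z : X.chartRing {c})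
    (hz : ∀ (s : Finset X.C) (hc : {c} ⊆ s), {c'} ⊆ s →
      IsUnit (chartMap (IsScaling.id (X := X)) hc z)) : z ∉ q.asIdeal := by
  obtain ⟨l, fi, fj, x, rfl, -⟩ := ι_left_eq_iff.1 hq
  intro hmem
  have hmem' : chartMap (IsScaling.id (X := X)) (leOfHom fi.unop) z ∈
    PrimeSpectrum.asIdeal x := hmem
  exact x.isPrime.ne_top (Ideal.eq_top_of_isUnit_mem _ hmem' (hz _ _ (leOfHom fj.unop)))

/-- A point of the chart `c` at which `f c'` does not vanish lies in the chart `c'`. -/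
theorem exists_pt_eq {c c' : X.C} {y y' : X.Loc {c}} (hyy : y * y' = 1)
    (hy : X.HasDeg {c} (X.w c') y) (hy' : X.HasDeg {c} (-X.w c') y') (v : X.chartRing {c})
    (hv : (v : X.Loc {c}) = algebraMap X.B (X.Loc {c}) (X.f c') * y')
    {q : Spec (.of (affineChart φ h h1 hm c).A)} (hq : v ∉ q.asIdeal) :
    ∃ q' : Spec (.of (affineChart φ h h1 hm c').A),
      (affineChart φ h h1 hm c').pt q' = (affineChart φ h h1 hm c).pt q := by
  rcases eq_or_ne c c' with rfl | hcc
  · exact ⟨q, rfl⟩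
  have hst : ({c} : Finset X.C) ⊆ {c, c'} := by simp
  have hst' : ({c'} : Finset X.C) ⊆ {c, c'} := by simp
  have hd : ({c, c'} : Finset X.C) \ {c} = {c'} := by
    ext d
    simp only [Finset.mem_sdiff, Finset.mem_insert, Finset.mem_singleton]
    constructor
    · rintro ⟨rfl | rfl, h⟩
      · exact absurd rfl h
      · rfl
    · rintro rfl
      exact ⟨Or.inr rfl, hcc.symm⟩
  have hden : X.den ({c, c'} \ {c}) = X.f c' := by rw [hd, den, Finset.prod_singleton]
  have hdeg : X.deg ({c, c'} \ {c}) = X.w c' := by rw [hd, deg, Finset.sum_singleton]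
  let _ := (chartMap (IsScaling.id (X := X)) hst).toRingHom.toAlgebra
  have := isLocalization_chartMap hst hyy (hdeg ▸ hy) (hdeg ▸ hy') v (by rw [hden]; exact hv)
  obtain ⟨x, hx⟩ : q ∈ Set.range (PrimeSpectrum.comap
      (chartMap (IsScaling.id (X := X)) hst).toRingHom) := by
    have h2 := PrimeSpectrum.localization_away_comap_range (X.chartRing {c, c'}) v
    refine h2.symm ▸ ?_
    exact hq
  let l : X.Indexᵒᵖ := Opposite.op ⟨{c, c'}, by simp⟩
  let fi : l ⟶ X.single c := (homOfLE hst : (X.single c).unop ⟶ l.unop).op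
  let fj : l ⟶ X.single c' := (homOfLE hst' : (X.single c').unop ⟶ l.unop).op
  exact ⟨(X.diagram.map fj).left x, ι_left_eq_iff.2 ⟨l, fj, fi, x, rfl, hx⟩⟩

end GradedCharts

end

/-! ### Affine coordinates on the charts of a tower -/

section

section TriangularSystem

variable {M N : Type*} [CommGroup M] [CommGroup N]

/-- The solution `u` of the triangular system `u j = a j * ∏ i < j, u i ^ D j i`. -/
def triSolve (a : ℕ → M) (D : ℕ → ℕ → ℤ) (j : ℕ) : M :=
  a j * ∏ i : Fin j, triSolve a D i ^ D j i
termination_by j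
decreasing_by exact i.2

theorem triSolve_eq (a : ℕ → M) (D : ℕ → ℕ → ℤ) (j : ℕ) :
    triSolve a D j = a j * ∏ i ∈ Finset.range j, triSolve a D i ^ D j i := by
  rw [triSolve, Finset.prod_range]

theorem triSolve_unique {a : ℕ → M} {D : ℕ → ℕ → ℤ} {u : ℕ → M} {m : ℕ}
    (hu : ∀ j < m, u j = a j * ∏ i ∈ Finset.range j, u i ^ D j i) :
    ∀ j < m, u j = triSolve a D j := by
  intro j
  induction j using Nat.strong_induction_on with
  | _ j ih =>
    intro hj
    rw [hu j hj, triSolve_eq]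
    congr 1
    refine Finset.prod_congr rfl fun i hi => ?_
    have := Finset.mem_range.1 hi
    rw [ih i this (this.trans hj)]

theorem map_triSolve (φ : M →* N) (a : ℕ → M) (D : ℕ → ℕ → ℤ) (j : ℕ) :
    φ (triSolve a D j) = triSolve (fun j => φ (a j)) D j := by
  refine triSolve_unique (m := j + 1) (u := fun j => φ (triSolve a D j)) (fun j _ => ?_) j
    j.lt_succ_self
  rw [triSolve_eq, map_mul, map_prod]
  simp only [map_zpow]

theorem triSolve_mul (a b : ℕ → M) (D : ℕ → ℕ → ℤ) (j : ℕ) :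
    triSolve (fun j => a j * b j) D j = triSolve a D j * triSolve b D j := by
  refine (triSolve_unique (m := j + 1) (u := fun j => triSolve a D j * triSolve b D j)
    (fun j _ => ?_) j j.lt_succ_self).symm
  simp only [mul_zpow, Finset.prod_mul_distrib]
  rw [triSolve_eq, triSolve_eq b]
  exact mul_mul_mul_comm _ _ _ _

theorem triSolve_one (D : ℕ → ℕ → ℤ) (j : ℕ) : triSolve (fun _ => (1 : M)) D j = 1 :=
  (triSolve_unique (m := j + 1) (u := fun _ => (1 : M)) (fun j _ => by simp) j j.lt_succ_self).symm

theorem triSolve_congr {a b : ℕ → M} {D D' : ℕ → ℕ → ℤ} {m : ℕ} (h : ∀ j < m, a j = b j)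
    (hD : ∀ j < m, ∀ i < j, D j i = D' j i) : ∀ j < m, triSolve a D j = triSolve b D' j := by
  refine triSolve_unique fun j hj => ?_
  rw [triSolve_eq, h j hj]
  congr 1
  refine Finset.prod_congr rfl fun i hi => ?_
  rw [hD j hj i (Finset.mem_range.1 hi)]

end TriangularSystem

open MvPolynomial

variable {k : Type u} [Field k] {p n : ℕ}

namespace Tower

variable (T : Tower k p n)

/-- A chart as a function on the natural numbers. -/
def Chart.toFun (c : T.Chart) (j : ℕ) : ℕ := if h : j < T.length then c ⟨j, h⟩ else 0

variable {T} in
theorem Chart.toFun_fin (c : T.Chart) (j : Fin T.length) : c.toFun T j = c j := by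
  simp [Chart.toFun]

/-- The character by which `G` acts on the fibre of `e_j` at the fixed point given by `c`. -/
def fib (c : ℕ → ℕ) : ℕ → (MuPow k p n →* kˣ) :=
  triSolve (fun j => (T.bundle j (c j)).chr) fun j i => (T.bundle j (c j)).deg i

/-- The character by which `G` acts on the fibre of a line bundle on the stage `m` of the tower
at the fixed point given by `c`. -/
def fibreChr (c : ℕ → ℕ) (m : ℕ) (L : LineBundle k p n) : MuPow k p n →* kˣ :=
  L.chr * ∏ i ∈ Finset.range m, T.fib c i ^ L.deg i

theorem fib_eq (c : ℕ → ℕ) (j : ℕ) : T.fib c j = T.fibreChr c j (T.bundle j (c j)) :=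
  triSolve_eq _ _ j

/-- The factor by which the torus element `u` rescales the coordinate `v`. -/
theorem prod_wt {M : Type*} [CommGroup M] (u : ℕ → M) (v : T.Coord) :
    ∏ i : Fin T.length, u i ^ T.wt v i =
      u v.1 * (∏ i ∈ Finset.range v.1, u i ^ (T.bundle v.1 v.2).deg i)⁻¹ := by
  have h : ∏ i : Fin T.length, u i ^ T.wt v i = ∏ i ∈ Finset.range T.length,
      (if i = v.1 then u i else if i < v.1 then (u i ^ (T.bundle v.1 v.2).deg i)⁻¹ else 1) := by
    rw [Finset.prod_range]
    refine Finset.prod_congr rfl fun i _ => ?_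
    simp only [wt, Fin.ext_iff, Fin.lt_def]
    split_ifs <;> simp
  rw [h, ← Finset.mul_prod_erase _ _ (Finset.mem_range.2 v.1.2), if_pos rfl]
  congr 1
  rw [← Finset.prod_inv_distrib]
  have hs : Finset.range v.1 ⊆ (Finset.range T.length).erase v.1 := fun i hi => by
    have := Finset.mem_range.1 hi
    exact Finset.mem_erase.2 ⟨this.ne, Finset.mem_range.2 (this.trans v.1.2)⟩
  rw [← Finset.prod_subset hs]
  · refine Finset.prod_congr rfl fun i hi => ?_
    have := Finset.mem_range.1 hi
    rw [if_neg this.ne, if_pos this]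
  · intro i hi hi'
    rw [if_neg (Finset.mem_erase.1 hi).1, if_neg fun h => hi' (Finset.mem_range.2 h)]

end Tower

namespace GradedCharts

variable {X : GradedCharts k}

/-- Homogeneous units of the localization. -/
def UnitDeg (s : Finset X.C) (d : X.D) (z : (X.Loc s)ˣ) : Prop :=
  X.HasDeg s d z ∧ X.HasDeg s (-d) (z⁻¹ : (X.Loc s)ˣ)

variable {s : Finset X.C} {d e : X.D} {z z' : (X.Loc s)ˣ}

theorem UnitDeg.of_eq (h : X.UnitDeg s d z) (hde : d = e) : X.UnitDeg s e z := hde ▸ h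

theorem UnitDeg.mul (h : X.UnitDeg s d z) (h' : X.UnitDeg s e z') :
    X.UnitDeg s (d + e) (z * z') :=
  ⟨by rw [Units.val_mul]; exact h.1.mul h'.1,
    by rw [mul_inv, Units.val_mul]; exact (h.2.mul h'.2).of_eq (neg_add _ _).symm⟩

theorem UnitDeg.inv (h : X.UnitDeg s d z) : X.UnitDeg s (-d) z⁻¹ :=
  ⟨h.2, by rw [inv_inv, neg_neg]; exact h.1⟩

theorem unitDeg_one : X.UnitDeg s 0 1 := by
  have : X.HasDeg s 0 1 := by
    rw [← map_one (algebraMap X.B (X.Loc s))]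
    exact hasDeg_algebraMap s X.one_mem
  exact ⟨this, by rw [neg_zero, inv_one]; exact this⟩

theorem UnitDeg.zpow (h : X.UnitDeg s d z) (m : ℤ) : X.UnitDeg s (m • d) (z ^ m) := by
  induction m using Int.induction_on with
  | zero => rw [zero_zsmul, zpow_zero]; exact unitDeg_one
  | succ m ih => rw [add_zsmul, one_zsmul, zpow_add_one]; exact ih.mul h
  | pred m ih => rw [sub_zsmul, one_zsmul, zpow_sub_one]; exact ih.mul h.inv

theorem UnitDeg.prod {ι : Type*} (t : Finset ι) {d : ι → X.D} {z : ι → (X.Loc s)ˣ}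
    (h : ∀ i ∈ t, X.UnitDeg s (d i) (z i)) : X.UnitDeg s (∑ i ∈ t, d i) (∏ i ∈ t, z i) := by
  classical
  induction t using Finset.induction_on with
  | empty => exact unitDeg_one
  | insert i t hi ih =>
    rw [Finset.sum_insert hi, Finset.prod_insert hi]
    exact (h i (Finset.mem_insert_self i t)).mul (ih fun j hj => h j (Finset.mem_insert_of_mem hj))

/-- A homogeneous divisor of the denominator is a homogeneous unit of the localization. -/
theorem exists_unitDeg {b b' : X.B} (hb : b ∈ X.H d) (hb' : b' ∈ X.H e) (h : b * b' = X.den s)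
    (hde : d + e = X.deg s) :
    ∃ z : (X.Loc s)ˣ, (z : X.Loc s) = algebraMap X.B (X.Loc s) b ∧ X.UnitDeg s d z := by
  have hu : algebraMap X.B (X.Loc s) b *
      (algebraMap X.B (X.Loc s) b' * IsLocalization.Away.invSelf (X.den s)) = 1 := by
    rw [← mul_assoc, ← map_mul, h, den_mul_inv]
  refine ⟨⟨_, _, hu, by rw [mul_comm, hu]⟩, rfl, hasDeg_algebraMap s hb, ?_⟩
  refine ((hasDeg_algebraMap s hb').mul (hasDeg_inv s)).of_eq ?_
  rw [← hde]; abel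

end GradedCharts

namespace Tower

variable (T : Tower k p n) (I : Ideal T.CoordRing)

/-- Restriction of functions to the cone over the closed subscheme given by `I`. -/
def toQuot : T.CoordRing →ₐ[k] (T.gradedCharts I).B := Ideal.Quotient.mkₐ k I

theorem toQuot_mem {d : Fin T.length → ℤ} {x : T.CoordRing}
    (hx : IsWeightedHomogeneous T.wt x d) : T.toQuot I x ∈ (T.gradedCharts I).H d :=
  ⟨x, hx, rfl⟩

/-- The coordinate `v` as an element of a localization. -/
def coordLoc (s : Finset (T.gradedCharts I).C) : T.CoordRing →ₐ[k] (T.gradedCharts I).Loc s :=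
  (IsScalarTower.toAlgHom k (T.gradedCharts I).B ((T.gradedCharts I).Loc s)).comp (T.toQuot I)

theorem exists_unit_coord {s : Finset (T.gradedCharts I).C} (c : T.Chart)
    (hc : ({c} : Finset (T.gradedCharts I).C) ⊆ s) (j : Fin T.length) :
    ∃ z : ((T.gradedCharts I).Loc s)ˣ, (z : (T.gradedCharts I).Loc s) =
      T.coordLoc I s (X ⟨j, c j⟩) ∧ (T.gradedCharts I).UnitDeg s (T.wt ⟨j, c j⟩) z := by
  refine GradedCharts.exists_unitDeg
    (b' := T.toQuot I (∏ i ∈ Finset.univ.erase j, X ⟨i, c i⟩) *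
      (T.gradedCharts I).den (s \ {c}))
    (e := @id (T.gradedCharts I).D (∑ i ∈ Finset.univ.erase j, T.wt ⟨i, c i⟩) +
      (T.gradedCharts I).deg (s \ {c}))
    (T.toQuot_mem I (isWeightedHomogeneous_X k T.wt _))
    ((T.gradedCharts I).mul_mem (T.toQuot_mem I (IsWeightedHomogeneous.prod _ _ _
      fun i _ => isWeightedHomogeneous_X k T.wt ⟨i, c i⟩)) ((T.gradedCharts I).den_mem _)) ?_ ?_
  · have h1 : (T.gradedCharts I).den {c} = T.toQuot I (T.chartEqn c) := Finset.prod_singleton _ _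
    have h2 : T.chartEqn c = X ⟨j, c j⟩ * ∏ i ∈ Finset.univ.erase j, X ⟨i, c i⟩ :=
      (Finset.mul_prod_erase _ _ (Finset.mem_univ j)).symm
    rw [← (T.gradedCharts I).den_sdiff hc, h1, h2, map_mul, mul_assoc]
    rfl
  · have h1 : (T.gradedCharts I).deg {c} = T.chartWt c := Finset.sum_singleton _ _
    have h2 : T.chartWt c = T.wt ⟨j, c j⟩ + ∑ i ∈ Finset.univ.erase j, T.wt ⟨i, c i⟩ :=
      (Finset.add_sum_erase _ _ (Finset.mem_univ j)).symm
    rw [← (T.gradedCharts I).deg_sdiff hc, h1, h2]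
    exact (add_assoc (G := (T.gradedCharts I).D) _ _ _).symm

variable (c : T.Chart)

/-- The coordinate which is invertible at step `j` of the chart `c`. -/
def coordUnit (j : Fin T.length) : ((T.gradedCharts I).Loc {c})ˣ :=
  (T.exists_unit_coord I c (le_refl _) j).choose

theorem coe_coordUnit (j : Fin T.length) : (T.coordUnit I c j : (T.gradedCharts I).Loc {c}) =
    T.coordLoc I {c} (X ⟨j, c j⟩) :=
  (T.exists_unit_coord I c (le_refl _) j).choose_spec.1

/-- A trivialization of `e_j` on the chart `c`. -/
def taut : ℕ → ((T.gradedCharts I).Loc {c})ˣ :=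
  triSolve (fun j => if h : j < T.length then T.coordUnit I c ⟨j, h⟩ else 1)
    fun j i => (T.bundle j (c.toFun T j)).deg i

/-- The homogeneous unit of degree `d` on the chart `c`. -/
def tautPow (d : Fin T.length → ℤ) : ((T.gradedCharts I).Loc {c})ˣ :=
  ∏ i : Fin T.length, T.taut I c i ^ d i

theorem tautPow_add (d e : Fin T.length → ℤ) :
    T.tautPow I c (d + e) = T.tautPow I c d * T.tautPow I c e := by
  simp only [tautPow, Pi.add_apply, zpow_add, Finset.prod_mul_distrib]

theorem tautPow_zero : T.tautPow I c 0 = 1 := by simp [tautPow]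

theorem tautPow_nsmul (m : ℕ) (d : Fin T.length → ℤ) :
    T.tautPow I c (m • d) = T.tautPow I c d ^ m := by
  induction m with
  | zero => rw [zero_nsmul, pow_zero, tautPow_zero]
  | succ m ih => rw [succ_nsmul, tautPow_add, ih, pow_succ]

theorem tautPow_sum {ι : Type*} (s : Finset ι) (d : ι → Fin T.length → ℤ) :
    T.tautPow I c (∑ i ∈ s, d i) = ∏ i ∈ s, T.tautPow I c (d i) := by
  classical
  induction s using Finset.induction_on with
  | empty => exact T.tautPow_zero I c
  | insert i s hi ih => rw [Finset.sum_insert hi, Finset.prod_insert hi, tautPow_add, ih]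

theorem tautPow_wt (j : Fin T.length) : T.tautPow I c (T.wt ⟨j, c j⟩) = T.coordUnit I c j := by
  rw [tautPow, prod_wt, mul_inv_eq_iff_eq_mul, taut, triSolve_eq, dif_pos j.2, Chart.toFun_fin]

/-- The trivialization of `e_j` is homogeneous of the degree of `e_j`, by induction along the
triangular system. -/
theorem unitDeg_taut (j : Fin T.length) :
    (T.gradedCharts I).UnitDeg {c} (Pi.single j 1 : Fin T.length → ℤ) (T.taut I c j) := by
  suffices H : ∀ (N : ℕ) (j : Fin T.length), (j : ℕ) = N →
      (T.gradedCharts I).UnitDeg {c} (Pi.single j 1 : Fin T.length → ℤ) (T.taut I c j) from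
    H _ j rfl
  intro N
  induction N using Nat.strong_induction_on with
  | _ N ih =>
    intro j hj
    have h1 := (T.exists_unit_coord I c (le_refl _) j).choose_spec.2
    change (T.gradedCharts I).UnitDeg {c} (T.wt ⟨j, c j⟩) (T.coordUnit I c j) at h1
    have h2 : T.taut I c j = T.coordUnit I c j *
        ∏ i : Fin j, T.taut I c i ^ (T.bundle j (c j)).deg i := by
      rw [taut, triSolve_eq, dif_pos j.2, Finset.prod_range, Chart.toFun_fin]
    have h3 := GradedCharts.UnitDeg.prod (X := T.gradedCharts I) (s := {c})
      (Finset.univ : Finset (Fin j))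
      (d := fun i => (T.bundle j (c j)).deg i •
        (Pi.single (⟨i, i.2.trans j.2⟩ : Fin T.length) 1 : Fin T.length → ℤ))
      (z := fun i => T.taut I c i ^ (T.bundle j (c j)).deg i)
      (fun i _ => (ih i (hj ▸ i.2) ⟨i, i.2.trans j.2⟩ rfl).zpow _)
    rw [h2]
    refine (h1.mul h3).of_eq ?_
    change T.wt ⟨j, c j⟩ + ∑ i : Fin j, (T.bundle j (c j)).deg i •
      (Pi.single (⟨i, i.2.trans j.2⟩ : Fin T.length) 1 : Fin T.length → ℤ) = Pi.single j 1
    funext l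
    rw [Pi.add_apply, Finset.sum_apply]
    simp only [Pi.smul_apply, smul_eq_mul, wt]
    rcases lt_trichotomy l j with hlj | rfl | hlj
    · rw [Finset.sum_eq_single (⟨l, hlj⟩ : Fin j)]
      · simp [hlj.ne, hlj]
      · intro i _ hi
        rw [Pi.single_eq_of_ne, mul_zero]
        intro h
        exact hi (Fin.ext (congrArg Fin.val h).symm)
      · intro h; exact absurd (Finset.mem_univ _) h
    · rw [Finset.sum_eq_zero]
      · simp
      · intro i _
        rw [Pi.single_eq_of_ne, mul_zero]
        exact fun h => i.2.ne (congrArg Fin.val h).symm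
    · rw [Finset.sum_eq_zero]
      · simp [hlj.ne', hlj.not_gt]
      · intro i _
        rw [Pi.single_eq_of_ne, mul_zero]
        intro h
        have h4 := congrArg Fin.val h
        have h5 := i.2
        have h6 : (j : ℕ) < l := hlj
        simp only at h4
        omega

theorem unitDeg_tautPow (d : Fin T.length → ℤ) :
    (T.gradedCharts I).UnitDeg {c} d (T.tautPow I c d) := by
  refine (GradedCharts.UnitDeg.prod _ fun i _ => (T.unitDeg_taut I c i).zpow (d i)).of_eq ?_
  refine .trans (Finset.sum_congr rfl fun i _ => ?_) (Finset.univ_sum_single d)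
  change d i • (Pi.single i 1 : Fin T.length → ℤ) = _
  rw [← Pi.single_smul, smul_eq_mul, mul_one]

/-- The affine coordinate on the chart `c` given by the homogeneous coordinate `v`. -/
def affCoord (v : T.Coord) : (T.gradedCharts I).chartRing {c} :=
  ⟨T.coordLoc I {c} (X v) * ((T.tautPow I c (T.wt v))⁻¹ : ((T.gradedCharts I).Loc {c})ˣ),
    ((GradedCharts.hasDeg_algebraMap _ (T.toQuot_mem I (isWeightedHomogeneous_X k T.wt v))).mul
      (T.unitDeg_tautPow I c (T.wt v)).2).of_eq (add_neg_cancel _)⟩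

theorem affCoord_chart (j : Fin T.length) : T.affCoord I c ⟨j, c j⟩ = 1 := by
  refine Subtype.ext ?_
  change T.coordLoc I {c} (X ⟨j, c j⟩) * _ = 1
  rw [← coe_coordUnit, tautPow_wt, Units.mul_inv]

/-- Substituting the affine coordinates in a homogeneous polynomial dehomogenizes it. -/
theorem aeval_affCoord {F : T.CoordRing} {d : Fin T.length → ℤ}
    (hF : IsWeightedHomogeneous T.wt F d) :
    ((aeval (T.affCoord I c) F : (T.gradedCharts I).chartRing {c}) : (T.gradedCharts I).Loc {c}) =
      T.coordLoc I {c} F * ((T.tautPow I c d)⁻¹ : ((T.gradedCharts I).Loc {c})ˣ) := by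
  have hval : ((aeval (T.affCoord I c) F : (T.gradedCharts I).chartRing {c}) :
      (T.gradedCharts I).Loc {c}) = aeval (fun v => ((T.affCoord I c v :
        (T.gradedCharts I).chartRing {c}) : (T.gradedCharts I).Loc {c})) F :=
    comp_aeval_apply (T.affCoord I c) ((T.gradedCharts I).chartRing {c}).val F
  have hx : T.coordLoc I {c} F = aeval (fun v => T.coordLoc I {c} (X v)) F := by
    conv_lhs => rw [← aeval_X_left_apply F]
    exact comp_aeval_apply _ _ _
  rw [hval, hx, aeval_def, aeval_def, eval₂_eq, eval₂_eq, Finset.sum_mul]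
  refine Finset.sum_congr rfl fun α hα => ?_
  rw [mul_assoc]
  congr 1
  have hd : d = ∑ v ∈ α.support, α v • T.wt v := by
    rw [← hF (mem_support_iff.1 hα), Finsupp.weight_apply, Finsupp.sum]
  rw [hd, tautPow_sum, ← Finset.prod_inv_distrib, Units.coe_prod, ← Finset.prod_mul_distrib]
  refine Finset.prod_congr rfl fun v _ => ?_
  rw [tautPow_nsmul, ← inv_pow, Units.val_pow_eq_pow_val, ← mul_pow]
  rfl

theorem coordLoc_chartEqn : T.coordLoc I {c} (T.chartEqn c) =
    (T.tautPow I c (T.chartWt c) : ((T.gradedCharts I).Loc {c})ˣ) := by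
  rw [chartWt, tautPow_sum, Units.coe_prod, chartEqn, map_prod]
  refine Finset.prod_congr rfl fun j _ => ?_
  rw [tautPow_wt, coe_coordUnit]

/-- The affine coordinates generate the coordinate algebra of the chart. -/
theorem exists_aeval_affCoord (z : (T.gradedCharts I).chartRing {c}) :
    ∃ F : T.CoordRing, aeval (T.affCoord I c) F = z := by
  obtain ⟨z, m, _, ⟨F, hF, rfl⟩, hz⟩ := z
  refine ⟨F, Subtype.ext ?_⟩
  rw [T.aeval_affCoord I c hF]
  have h1 : (T.gradedCharts I).deg {c} = T.chartWt c := Finset.sum_singleton _ _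
  have h2 : algebraMap (T.gradedCharts I).B ((T.gradedCharts I).Loc {c})
      ((T.gradedCharts I).den {c}) =
      (T.tautPow I c (T.chartWt c) : ((T.gradedCharts I).Loc {c})ˣ) := by
    rw [← coordLoc_chartEqn]
    exact congrArg _ (Finset.prod_singleton _ _)
  have h3 : T.coordLoc I {c} F = z *
      (T.tautPow I c (T.chartWt c) : ((T.gradedCharts I).Loc {c})ˣ) ^ m := by
    rw [← h2]; exact hz.symm
  have h4 : T.tautPow I c (m • (T.gradedCharts I).deg {c} + 0 : (T.gradedCharts I).D) =
      T.tautPow I c (T.chartWt c) ^ m := by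
    rw [h1, ← tautPow_nsmul]
    exact congrArg (T.tautPow I c) (add_zero _)
  rw [h3]
  refine (congrArg (fun t : ((T.gradedCharts I).Loc {c})ˣ => z *
      (T.tautPow I c (T.chartWt c) : ((T.gradedCharts I).Loc {c})ˣ) ^ m *
        ((t⁻¹ : ((T.gradedCharts I).Loc {c})ˣ) : (T.gradedCharts I).Loc {c})) h4).trans ?_
  rw [mul_assoc, ← Units.val_pow_eq_pow_val, Units.mul_inv, mul_one]

end Tower

end

/-! ### Maps from the charts, and the action on them -/

section

open MvPolynomial

variable {k : Type u} [Field k] {p n : ℕ}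

namespace GradedCharts

variable {X : GradedCharts k}

theorem UnitDeg.locMap {φ : X.B →ₐ[k] X.B} (h : X.IsScaling φ) {s t : Finset X.C} (hst : s ⊆ t)
    {d : X.D} {z : (X.Loc s)ˣ} (hz : X.UnitDeg s d z) :
    X.UnitDeg t d (Units.map (GradedCharts.locMap h hst : X.Loc s →* X.Loc t) z) :=
  ⟨hz.1.locMap h hst, by rw [← map_inv]; exact hz.2.locMap h hst⟩

/-- A unit of degree zero of a localization is a unit of the degree zero part. -/
theorem UnitDeg.isUnit {s : Finset X.C} {z : (X.Loc s)ˣ} (hz : X.UnitDeg s 0 z)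
    (a : X.chartRing s) (ha : (a : X.Loc s) = z) : IsUnit a :=
  IsUnit.of_mul_eq_one (⟨_, hz.2.of_eq neg_zero⟩ : X.chartRing s)
    (Subtype.ext (by
      change (a : X.Loc s) * ((z⁻¹ : (X.Loc s)ˣ) : X.Loc s) = 1
      rw [ha, Units.mul_inv]))

theorem isUnit_chartMap {s t : Finset X.C} (hst : s ⊆ t) {b : X.B} {d : X.D} {z : (X.Loc s)ˣ}
    (hz : X.UnitDeg s (-d) z) (a : X.chartRing s)
    (ha : (a : X.Loc s) = algebraMap X.B (X.Loc s) b * z) {y : (X.Loc t)ˣ}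
    (hy : (y : X.Loc t) = algebraMap X.B (X.Loc t) b) (hyd : X.UnitDeg t d y) :
    IsUnit (chartMap (IsScaling.id (X := X)) hst a) := by
  refine ((hyd.mul (hz.locMap (IsScaling.id (X := X)) hst)).of_eq (add_neg_cancel _)).isUnit _ ?_
  rw [coe_chartMap, ha, map_mul, locMap_algebraMap, Units.val_mul, hy]
  rfl

theorem exists_locHom {R : Type*} [CommRing R] [Algebra k R] (θ₀ : X.B →ₐ[k] R) {s : Finset X.C}
    (h : θ₀ (X.den s) = 1) :
    ∃ θ₁ : X.Loc s →ₐ[k] R, ∀ b, θ₁ (algebraMap X.B (X.Loc s) b) = θ₀ b :=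
  ⟨IsLocalization.Away.liftAlgHom (X.den s) (f := θ₀) (by rw [h]; exact isUnit_one),
    fun b => by simp⟩

end GradedCharts

namespace Tower

variable (T : Tower k p n) (I : Ideal T.CoordRing) (c : T.Chart)

theorem coe_affCoord (v : T.Coord) : (T.affCoord I c v : (T.gradedCharts I).Loc {c}) =
    T.coordLoc I {c} (X v) *
      ((T.tautPow I c (T.wt v))⁻¹ : ((T.gradedCharts I).Loc {c})ˣ) := rfl

/-- An equation `F` of the closed subscheme holds for the affine coordinates if `F` is
homogeneous in the sense of `h`: rescaling the coordinates by a torus element `u` changes `F` by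
a factor. -/
theorem aeval_affCoord_eq_zero {F : T.CoordRing} (hF : F ∈ I)
    (h : ∀ (R : Type u) [CommRing R] [Algebra k R] (x : T.Coord → R) (u : ℕ → Rˣ), ∃ z : R,
      aeval (fun v => x v * ((∏ i : Fin T.length, u i ^ T.wt v i : Rˣ) : R)) F =
        aeval x F * z) : aeval (T.affCoord I c) F = 0 := by
  refine Subtype.ext ?_
  obtain ⟨z, hz⟩ := h _ (fun v => T.coordLoc I {c} (X v)) fun j => (T.taut I c j)⁻¹
  refine (comp_aeval_apply (T.affCoord I c) ((T.gradedCharts I).chartRing {c}).val F).trans ?_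
  have h1 : aeval (fun v => T.coordLoc I {c} (X v)) F = T.coordLoc I {c} F := by
    conv_rhs => rw [← aeval_X_left_apply F]
    exact (comp_aeval_apply _ _ _).symm
  have h2 : T.coordLoc I {c} F = 0 := by
    have : T.toQuot I F = 0 := Ideal.Quotient.eq_zero_iff_mem.2 hF
    exact (congrArg (algebraMap _ _) this).trans (map_zero _)
  rw [h1, h2, zero_mul] at hz
  refine .trans ?_ hz
  congr 2
  funext v
  refine (T.coe_affCoord I c v).trans ?_
  rw [tautPow, ← Finset.prod_inv_distrib]
  simp only [inv_zpow]

variable {R : Type*} [CommRing R] [Algebra k R]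

/-- The universal property of the coordinate algebra of a chart. -/
theorem exists_algHom (r : T.Coord → R) (h1 : ∀ j, r ⟨j, c j⟩ = 1) (hI : ∀ F ∈ I, aeval r F = 0) :
    ∃ θ : (T.gradedCharts I).chartRing {c} →ₐ[k] R, ∀ v, θ (T.affCoord I c v) = r v := by
  let θ₀ : (T.gradedCharts I).B →ₐ[k] R := Ideal.Quotient.liftₐ I (aeval r) hI
  have hθ₀ : ∀ F, θ₀ (T.toQuot I F) = aeval r F := fun F => rfl
  have hden : θ₀ ((T.gradedCharts I).den {c}) = 1 := by
    have : (T.gradedCharts I).den {c} = T.toQuot I (T.chartEqn c) := Finset.prod_singleton _ _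
    rw [this, hθ₀, chartEqn, map_prod]
    exact Finset.prod_eq_one fun j _ => (aeval_X _ _).trans (h1 j)
  obtain ⟨θ₁, hθ⟩ := GradedCharts.exists_locHom θ₀ hden
  have hθ₁ : ∀ F, θ₁ (T.coordLoc I {c} F) = aeval r F := fun F => hθ (T.toQuot I F)
  -- the trivializations are mapped to the solution of a triangular system with constants `1`
  have ht : ∀ j, Units.map (θ₁ : (T.gradedCharts I).Loc {c} →* R) (T.taut I c j) = 1 := by
    intro j
    rw [taut, map_triSolve, ← triSolve_one (M := Rˣ)
      (fun j i => (T.bundle j (c.toFun T j)).deg i) j]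
    congr 1
    funext j
    split_ifs with hj
    · refine Units.ext ?_
      refine (congrArg θ₁ (T.coe_coordUnit I c ⟨j, hj⟩)).trans ?_
      rw [hθ₁, aeval_X]
      exact h1 _
    · exact map_one _
  refine ⟨θ₁.comp (Subalgebra.val _), fun v => ?_⟩
  change θ₁ (T.coordLoc I {c} (X v) *
    ((T.tautPow I c (T.wt v))⁻¹ : ((T.gradedCharts I).Loc {c})ˣ)) = r v
  have h2 : Units.map (θ₁ : (T.gradedCharts I).Loc {c} →* R) (T.tautPow I c (T.wt v))⁻¹ = 1 := by
    rw [map_inv, tautPow, map_prod]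
    simp only [map_zpow, ht, one_zpow, Finset.prod_const_one, inv_one]
  have h3 : θ₁ ((T.tautPow I c (T.wt v))⁻¹ : ((T.gradedCharts I).Loc {c})ˣ) = 1 :=
    congrArg Units.val h2
  rw [map_mul, h3, mul_one, hθ₁, aeval_X]

/-- The character of `G` on the affine coordinate `v` of the chart `c`. -/
def affChr (c : ℕ → ℕ) (v : ℕ × ℕ) : MuPow k p n →* kˣ :=
  T.fibreChr c v.1 (T.bundle v.1 v.2) * (T.fib c v.1)⁻¹

theorem affChr_eq (c : ℕ → ℕ) (j a : ℕ) : T.affChr c (j, a) = (T.bundle j a).chr *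
    ((T.fib c j)⁻¹ * ∏ i ∈ Finset.range j, T.fib c i ^ (T.bundle j a).deg i) := by
  have : ∀ x y z : MuPow k p n →* kˣ, x * y * z = x * (z * y) := fun x y z =>
    (mul_assoc x y z).trans (congrArg (x * ·) (mul_comm y z))
  exact this _ _ _

/-- `G` acts on the trivialization of `e_j` by its character on the fibre at the origin of the
chart. -/
theorem locMap_taut (h : ∀ g, I ≤ I.comap (T.act g)) (g : MuPow k p n) {j : ℕ} (hj : j < T.length) :
    Units.map (GradedCharts.locMap (T.isScaling I g (h g)) (le_refl {c}) :
      (T.gradedCharts I).Loc {c} →* (T.gradedCharts I).Loc {c}) (T.taut I c j) =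
    Units.map (algebraMap k ((T.gradedCharts I).Loc {c}) : k →* _) (T.fib (c.toFun T) j g) *
      T.taut I c j := by
  have e : T.fib (c.toFun T) j g = MonoidHom.eval g (T.fib (c.toFun T) j) := rfl
  rw [taut, map_triSolve, e, fib, map_triSolve, map_triSolve, ← triSolve_mul]
  refine triSolve_congr (m := T.length) (fun j hj => ?_) (fun _ _ _ _ => rfl) j hj
  rw [dif_pos hj]
  refine Units.ext ?_
  have h1 := T.coe_coordUnit I c ⟨j, hj⟩
  have h2 : T.act g (X ⟨⟨j, hj⟩, c ⟨j, hj⟩⟩) =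
      algebraMap k T.CoordRing ((T.bundle j (c.toFun T j)).chr g) * X ⟨⟨j, hj⟩, c ⟨j, hj⟩⟩ := by
    rw [act, aeval_X, Chart.toFun, dif_pos hj]
    rfl
  change GradedCharts.locMap (T.isScaling I g (h g)) (le_refl {c})
      (T.coordUnit I c ⟨j, hj⟩ : (T.gradedCharts I).Loc {c}) =
    algebraMap k ((T.gradedCharts I).Loc {c}) ((T.bundle j (c.toFun T j)).chr g) *
      (T.coordUnit I c ⟨j, hj⟩ : (T.gradedCharts I).Loc {c})
  rw [h1]
  refine (GradedCharts.locMap_algebraMap (T.isScaling I g (h g)) (le_refl {c})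
    (T.toQuot I (X ⟨⟨j, hj⟩, c ⟨j, hj⟩⟩))).trans ?_
  change T.coordLoc I {c} (T.act g (X ⟨⟨j, hj⟩, c ⟨j, hj⟩⟩)) = _
  rw [h2, map_mul, AlgHom.commutes]

theorem locMap_tautPow (h : ∀ g, I ≤ I.comap (T.act g)) (g : MuPow k p n)
    (d : Fin T.length → ℤ) :
    Units.map (GradedCharts.locMap (T.isScaling I g (h g)) (le_refl {c}) :
      (T.gradedCharts I).Loc {c} →* (T.gradedCharts I).Loc {c}) (T.tautPow I c d) =
    Units.map (algebraMap k ((T.gradedCharts I).Loc {c}) : k →* _)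
      ((∏ i : Fin T.length, T.fib (c.toFun T) i ^ d i : MuPow k p n →* kˣ) g) *
      T.tautPow I c d := by
  have e : (∏ i : Fin T.length, T.fib (c.toFun T) i ^ d i : MuPow k p n →* kˣ) g =
      ∏ i : Fin T.length, T.fib (c.toFun T) i g ^ d i := by
    rw [MonoidHom.finsetProd_apply]
    exact Finset.prod_congr rfl fun i _ => MonoidHom.zpow_apply ..
  rw [e, tautPow, map_prod, map_prod, ← Finset.prod_mul_distrib]
  refine Finset.prod_congr rfl fun i _ => ?_
  rw [map_zpow, map_zpow, locMap_taut _ _ _ _ _ i.2, mul_zpow]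

/-- The action on a chart is diagonal with respect to the affine coordinates. -/
theorem chartMap_affCoord (h : ∀ g, I ≤ I.comap (T.act g)) (g : MuPow k p n) (v : T.Coord) :
    GradedCharts.chartMap (T.isScaling I g (h g)) (le_refl {c}) (T.affCoord I c v) =
      (T.affChr (c.toFun T) (v.1, v.2) g : k) • T.affCoord I c v := by
  refine Subtype.ext ?_
  have h1 : GradedCharts.locMap (T.isScaling I g (h g)) (le_refl {c}) (T.coordLoc I {c} (X v)) =
      algebraMap k _ ((T.bundle v.1 v.2).chr g : k) * T.coordLoc I {c} (X v) := by
    refine (GradedCharts.locMap_algebraMap (T.isScaling I g (h g)) (le_refl {c})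
      (T.toQuot I (X v))).trans ?_
    have h2 : T.act g (X v) = algebraMap k T.CoordRing ((T.bundle v.1 v.2).chr g) * X v := by
      rw [act, aeval_X]
      rfl
    change T.coordLoc I {c} (T.act g (X v)) = _
    rw [h2, map_mul, AlgHom.commutes]
  have h2 := congrArg Units.val (congrArg Inv.inv (T.locMap_tautPow I c h g (T.wt v)))
  rw [← map_inv, mul_inv, ← map_inv, Units.val_mul] at h2
  have h3 : T.affChr (c.toFun T) (v.1, v.2) g = (T.bundle v.1 v.2).chr g *
      ((∏ i : Fin T.length, T.fib (c.toFun T) i ^ T.wt v i : MuPow k p n →* kˣ) g)⁻¹ := by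
    rw [T.prod_wt (T.fib (c.toFun T)) v, ← MonoidHom.inv_apply, ← MonoidHom.mul_apply,
      mul_inv, inv_inv]
    exact congrArg (fun χ : MuPow k p n →* kˣ => χ g) (T.affChr_eq _ _ _)
  change GradedCharts.locMap (T.isScaling I g (h g)) (le_refl {c}) (T.coordLoc I {c} (X v) *
      ((T.tautPow I c (T.wt v))⁻¹ : ((T.gradedCharts I).Loc {c})ˣ)) =
    (T.affChr (c.toFun T) (v.1, v.2) g : k) • (T.coordLoc I {c} (X v) *
      ((T.tautPow I c (T.wt v))⁻¹ : ((T.gradedCharts I).Loc {c})ˣ))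
  have h4 : GradedCharts.locMap (T.isScaling I g (h g)) (le_refl {c})
      ((T.tautPow I c (T.wt v))⁻¹ : ((T.gradedCharts I).Loc {c})ˣ) =
      algebraMap k ((T.gradedCharts I).Loc {c}) (((∏ i : Fin T.length,
        T.fib (c.toFun T) i ^ T.wt v i : MuPow k p n →* kˣ) g)⁻¹ : kˣ) *
      ((T.tautPow I c (T.wt v))⁻¹ : ((T.gradedCharts I).Loc {c})ˣ) := h2
  rw [map_mul, h1, h4, h3, Algebra.smul_def, Units.val_mul, map_mul]
  ring

variable {T I c}

/-- On the overlap with the chart `c'` the affine coordinates `(j, c' j)` are invertible. -/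
theorem isUnit_chartMap_affCoord {c' : T.Chart} (j : Fin T.length)
    {s : Finset (T.gradedCharts I).C} (hc : ({c} : Finset (T.gradedCharts I).C) ⊆ s)
    (hc' : ({c'} : Finset (T.gradedCharts I).C) ⊆ s) :
    IsUnit (GradedCharts.chartMap (GradedCharts.IsScaling.id (X := T.gradedCharts I)) hc
      (T.affCoord I c ⟨j, c' j⟩)) := by
  obtain ⟨z, hz, hzd⟩ := T.exists_unit_coord I c' hc' j
  exact GradedCharts.isUnit_chartMap hc (T.unitDeg_tautPow I c (T.wt ⟨j, c' j⟩)).inv _ rfl hz hzd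

variable {h : ∀ g, I ≤ I.comap (T.act g)}

variable (T I h) in
/-- The standard charts of a closed subscheme of a tower. -/
def affineChart (c : T.Chart) : AffineChart (T.subvariety I h) :=
  GradedCharts.affineChart _ _ _ _ c

theorem exists_affineChart (x : (T.subvariety I h).V.left) :
    ∃ (c : T.Chart) (q : Spec (.of (T.affineChart I h c).A)), (T.affineChart I h c).pt q = x :=
  GradedCharts.exists_affineChart _ _ _ _ x

/-- At a point which also lies in the chart `c'`, the coordinates `(j, c' j)` do not vanish. -/
theorem affCoord_notMem {c' : T.Chart} {q : Spec (.of (T.affineChart I h c).A)}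
    {q' : Spec (.of (T.affineChart I h c').A)}
    (hq : (T.affineChart I h c).pt q = (T.affineChart I h c').pt q') (j : Fin T.length) :
    T.affCoord I c ⟨j, c' j⟩ ∉ q.asIdeal :=
  GradedCharts.notMem_of_pt_eq hq _ fun _ hc hc' => isUnit_chartMap_affCoord j hc hc'

/-- A point lies in every chart whose coordinates do not vanish there. -/
theorem exists_pt_eq {c' : T.Chart} {q : Spec (.of (T.affineChart I h c).A)}
    (hq : ∀ j, T.affCoord I c ⟨j, c' j⟩ ∉ q.asIdeal) :
    ∃ q' : Spec (.of (T.affineChart I h c').A),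
      (T.affineChart I h c').pt q' = (T.affineChart I h c).pt q := by
  have h1 := T.unitDeg_tautPow I c (T.chartWt c')
  refine GradedCharts.exists_pt_eq (X := T.gradedCharts I) (c := c) (c' := c')
    (Units.mul_inv (T.tautPow I c (T.chartWt c'))) h1.1 h1.2
    (∏ j, T.affCoord I c ⟨j, c' j⟩) ?_ ?_
  · refine (map_prod ((T.gradedCharts I).chartRing {c}).val _ _).trans ?_
    refine (Finset.prod_mul_distrib (f := fun j => T.coordLoc I {c} (X ⟨j, c' j⟩))).trans ?_
    refine congrArg₂ (· * ·) (map_prod (T.coordLoc I {c}) _ _).symm ?_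
    rw [← Units.coe_prod, chartWt, tautPow_sum, Finset.prod_inv_distrib]
  · intro hmem
    obtain ⟨j, -, hj⟩ := (q.isPrime.prod_mem_iff).1 hmem
    exact hq j hj

end Tower

end

/-! ### Line bundles with forms on a tower -/

section

section Exchange

variable {M : Type*} [CommGroup M]

/-- The exchange property of lines modulo a subgroup, in an elementary abelian `p`-group. -/
theorem exchange {p : ℕ} (hp : p.Prime) {V : Subgroup M} {x y : M} (hx : x ∉ V)
    (hy : y ∉ V ⊔ Subgroup.zpowers x) (hyp : y ^ p = 1) : x ∉ V ⊔ Subgroup.zpowers y := by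
  intro h
  obtain ⟨v, hv, _, ⟨e, rfl⟩, hve⟩ := Subgroup.mem_sup.1 h
  simp only at hve
  by_cases he : (p : ℤ) ∣ e
  · obtain ⟨d, rfl⟩ := he
    rw [zpow_mul, zpow_natCast, hyp, one_zpow, mul_one] at hve
    exact hx (hve ▸ hv)
  · have hc : IsCoprime e (p : ℤ) :=
      ((Nat.prime_iff_prime_int.1 hp).coprime_iff_not_dvd.2 he).symm
    obtain ⟨r, s, hrs⟩ := hc
    refine hy ?_
    have h1 : y ^ e ∈ V ⊔ Subgroup.zpowers x := by
      have : y ^ e = v⁻¹ * x := by rw [← hve, inv_mul_cancel_left]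
      rw [this]
      exact mul_mem (inv_mem (Subgroup.mem_sup_left hv))
        (Subgroup.mem_sup_right (Subgroup.mem_zpowers x))
    have h2 : y = (y ^ e) ^ r := by
      have : y ^ (r * e + s * p) = y := by rw [hrs, zpow_one]
      rw [zpow_add, mul_comm s, zpow_mul y p, zpow_natCast, hyp, one_zpow, mul_one, mul_comm r,
        zpow_mul] at this
      exact this.symm
    rw [h2]
    exact zpow_mem h1 r

end Exchange

open MvPolynomial

variable {k : Type u} [Field k] {p n : ℕ}

/-- The characters of `G = μ_p ^ n`. -/
abbrev MuChr (k : Type u) [Field k] (p n : ℕ) : Type u := MuPow k p n →* kˣ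

theorem MuChr.pow_eq_one (χ : MuChr k p n) : χ ^ p = 1 := by
  refine MonoidHom.ext fun g => Units.ext ?_
  rw [MonoidHom.pow_apply, Units.val_pow_eq_pow_val]
  exact LineBundle.chr_pow ⟨0, χ⟩ g

namespace Tower

variable {T T' : Tower k p n}

/-- `c` gives a chart of the tower. -/
def Valid (T : Tower k p n) (c : ℕ → ℕ) : Prop := ∀ j < T.length, c j < (T.getD j []).length

/-- At every fixed point given by a chart, the bundles of the next step have nonzero rank and
pairwise different characters; then the charts are in bijection with the fixed points. -/
structure Good (T : Tower k p n) : Prop where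
  pos : ∀ j < T.length, 0 < (T.getD j []).length
  ne : ∀ c, T.Valid c → ∀ j < T.length, ∀ a < (T.getD j []).length,
    ∀ b < (T.getD j []).length, a ≠ b →
      T.fibreChr c j (T.bundle j a) ≠ T.fibreChr c j (T.bundle j b)

theorem row_append (h : T <+: T') {j : ℕ} (hj : j < T.length) :
    T'.getD j [] = T.getD j [] := by
  obtain ⟨E, rfl⟩ := h
  exact List.getD_append _ _ _ _ hj

theorem bundle_append (h : T <+: T') {j : ℕ} (hj : j < T.length) (a : ℕ) :
    T'.bundle j a = T.bundle j a := by rw [bundle, row_append h hj, bundle]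

theorem Valid.of_prefix {c : ℕ → ℕ} (hc : T'.Valid c) (h : T <+: T') : T.Valid c :=
  fun j hj => row_append h hj ▸ hc j (hj.trans_le h.length_le)

theorem fib_append (h : T <+: T') (c : ℕ → ℕ) {j : ℕ} (hj : j < T.length) :
    T'.fib c j = T.fib c j :=
  triSolve_congr (m := T.length) (fun j hj => by rw [bundle_append h hj])
    (fun j hj i _ => by rw [bundle_append h hj]) j hj

theorem fibreChr_append (h : T <+: T') (c : ℕ → ℕ) {m : ℕ} (hm : m ≤ T.length)
    (L : LineBundle k p n) : T'.fibreChr c m L = T.fibreChr c m L := by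
  refine congrArg (L.chr * ·) (Finset.prod_congr rfl fun i hi => ?_)
  rw [fib_append h c ((Finset.mem_range.1 hi).trans_le hm)]

theorem fibreChr_mul (c : ℕ → ℕ) (m : ℕ) (L M : FormedBundle k p n) :
    T.fibreChr c m (L.tensor M).toLineBundle =
      T.fibreChr c m L.toLineBundle * T.fibreChr c m M.toLineBundle := by
  refine (congrArg ((L.chr * M.chr) * ·) ?_).trans (mul_mul_mul_comm L.chr M.chr
    (∏ i ∈ Finset.range m, T.fib c i ^ L.deg i) (∏ i ∈ Finset.range m, T.fib c i ^ M.deg i))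
  rw [← Finset.prod_mul_distrib]
  exact Finset.prod_congr rfl fun i _ => zpow_add (T.fib c i) (L.deg i) (M.deg i)

theorem fibreChr_pow (c : ℕ → ℕ) (m : ℕ) (L : LineBundle k p n) (i : ℕ) :
    T.fibreChr c m (L.pow i) = T.fibreChr c m L ^ i := by
  refine .trans (congrArg (L.chr ^ i * ·) ?_) (mul_pow L.chr
    (∏ l ∈ Finset.range m, T.fib c l ^ L.deg l) i).symm
  rw [← Finset.prod_pow]
  refine Finset.prod_congr rfl fun l _ => ?_
  change T.fib c l ^ (i • L.deg l) = _
  rw [nsmul_eq_mul, mul_comm]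
  exact (zpow_mul (T.fib c l) (L.deg l) i).trans (zpow_natCast _ _)

theorem fibreChr_of_deg_eq_zero (c : ℕ → ℕ) (m : ℕ) {L : LineBundle k p n} (h : L.deg = 0) :
    T.fibreChr c m L = L.chr := by
  refine (congrArg (L.chr * ·) (Finset.prod_eq_one fun i _ => ?_)).trans (mul_one L.chr)
  rw [h]
  exact zpow_zero (T.fib c i)

/-- `L` is a line bundle on the tower `T`, and its form is homogeneous of degree `p * deg L`: if the
coordinates are rescaled by a torus element `u`, according to their degrees, then the form is
multiplied by the `p`-th power of the factor of `L`. -/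
structure On (T : Tower k p n) (L : FormedBundle k p n) : Prop where
  deg_eq_zero : ∀ i, T.length ≤ i → L.deg i = 0
  aeval_eq : ∀ (R : Type u) [CommRing R] [Algebra k R] (x x' : ℕ × ℕ → R) (u : ℕ → Rˣ),
    (∀ v : ℕ × ℕ, v.1 < T.length → x' v = x v *
      ((u v.1 * (∏ i ∈ Finset.range v.1, u i ^ (T.bundle v.1 v.2).deg i)⁻¹ : Rˣ) : R)) →
    aeval x' L.form = aeval x L.form * ((∏ i ∈ Finset.range T.length, u i ^ L.deg i : Rˣ) : R) ^ p

theorem On.of_prefix {L : FormedBundle k p n} (hL : T.On L) (h : T <+: T') : T'.On L where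
  deg_eq_zero i hi := hL.deg_eq_zero i (h.length_le.trans hi)
  aeval_eq R _ _ x x' u hx := by
    rw [hL.aeval_eq R x x' u fun v hv => by
      rw [← bundle_append h hv]; exact hx v (hv.trans_le h.length_le)]
    congr 3
    refine Finset.prod_subset (Finset.range_mono h.length_le) fun i _ hi => ?_
    rw [hL.deg_eq_zero i (not_lt.1 fun h => hi (Finset.mem_range.2 h)), zpow_zero]

theorem On.fibreChr_eq {L : FormedBundle k p n} (hL : T.On L) (h : T <+: T') (c : ℕ → ℕ) :
    T'.fibreChr c T'.length L.toLineBundle = T.fibreChr c T.length L.toLineBundle := by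
  refine .trans ?_ (fibreChr_append h c le_rfl L.toLineBundle)
  refine congrArg (L.chr * ·) ?_
  symm
  refine Finset.prod_subset (Finset.range_mono h.length_le) fun i _ hi => ?_
  rw [hL.deg_eq_zero i (not_lt.1 fun h => hi (Finset.mem_range.2 h))]
  exact zpow_zero (T'.fib c i)

theorem On.trivial : T.On .trivial where
  deg_eq_zero _ _ := rfl
  aeval_eq R _ _ x x' u _ := by
    simp [FormedBundle.trivial, LineBundle.trivial]

theorem On.tensor {L M : FormedBundle k p n} (hL : T.On L) (hM : T.On M) : T.On (L.tensor M) where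
  deg_eq_zero i hi := by
    change L.deg i + M.deg i = 0
    rw [hL.deg_eq_zero i hi, hM.deg_eq_zero i hi, add_zero]
  aeval_eq R _ _ x x' u hx := by
    have : ∏ i ∈ Finset.range T.length, u i ^ (L.deg i + M.deg i) =
        (∏ i ∈ Finset.range T.length, u i ^ L.deg i) *
          ∏ i ∈ Finset.range T.length, u i ^ M.deg i := by
      simp only [zpow_add, Finset.prod_mul_distrib]
    change aeval x' (L.form * M.form) = aeval x (L.form * M.form) *
      ((∏ i ∈ Finset.range T.length, u i ^ (L.deg i + M.deg i) : Rˣ) : R) ^ p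
    rw [this, map_mul, map_mul, hL.aeval_eq R x x' u hx, hM.aeval_eq R x x' u hx, Units.val_mul]
    ring

theorem On.base (a : Fin n → kˣ) (i : ℕ) : T.On (FormedBundle.base a i) := by
  unfold FormedBundle.base
  split_ifs
  · exact ⟨fun _ _ => rfl, fun R _ _ x x' u _ => by simp [FormedBundle.ofUnit]⟩
  · exact On.trivial

theorem bundle_append_length (T : Tower k p n) (Ms : List (LineBundle k p n)) (a : ℕ) :
    bundle (T ++ [Ms]) T.length a = Ms.getD a .trivial := bundle_last T Ms a

theorem On.tautological {L : FormedBundle k p n} (hL : T.On L) :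
    On (T ++ [[.trivial, L.toLineBundle]]) (.tautological T.length L) where
  deg_eq_zero i hi := by
    rw [List.length_append, List.length_singleton] at hi
    exact Pi.single_eq_of_ne (M := fun _ => ℤ) (by omega) 1
  aeval_eq R _ _ x x' u hx := by
    have hlen : (T ++ [[.trivial, L.toLineBundle]]).length = T.length + 1 := by simp
    have hL' := hL.aeval_eq R x x' u fun v hv => by
      rw [← bundle_append (List.prefix_append T [[.trivial, L.toLineBundle]]) hv]
      exact hx v (by omega)
    have h0 := hx (T.length, 0) (by simp)
    have h1 := hx (T.length, 1) (by simp)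
    simp only [bundle_append_length, List.getD_cons_zero, List.getD_cons_succ] at h0 h1
    have e0 : (LineBundle.trivial : LineBundle k p n).deg = 0 := rfl
    simp only [e0, Pi.zero_apply, zpow_zero, Finset.prod_const_one, inv_one, mul_one] at h0
    have hd : (∏ i ∈ Finset.range (T.length + 1),
        u i ^ (FormedBundle.tautological T.length L).deg i) = u T.length := by
      rw [Finset.prod_eq_single T.length]
      · change u T.length ^ (Pi.single T.length 1 : ℕ → ℤ) T.length = _
        rw [Pi.single_eq_same, zpow_one]
      · intro i _ hi
        change u i ^ (Pi.single T.length 1 : ℕ → ℤ) i = _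
        rw [Pi.single_eq_of_ne hi, zpow_zero]
      · simp
    rw [hlen, hd]
    change aeval x' (X (T.length, 0) ^ p - L.form * X (T.length, 1) ^ p) =
      aeval x (X (T.length, 0) ^ p - L.form * X (T.length, 1) ^ p) * _
    simp only [map_sub, map_mul, map_pow, aeval_X]
    rw [hL', h0, h1, Units.val_mul]
    set P := ∏ i ∈ Finset.range T.length, u i ^ L.deg i
    have hP : (P : R) * ((P⁻¹ : Rˣ) : R) = 1 := Units.mul_inv P
    have hPp : (P : R) ^ p * ((P⁻¹ : Rˣ) : R) ^ p = 1 := by rw [← mul_pow, hP, one_pow]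
    linear_combination (-(aeval x L.form * x (T.length, 1) ^ p * (u T.length : R) ^ p)) * hPp

end Tower

/-- The value of the form of `L` at the fixed point given by `c`, whose coordinates are `1` at
`(j, c j)` and `0` elsewhere. -/
def FormedBundle.value (L : FormedBundle k p n) (c : ℕ → ℕ) : k :=
  aeval (fun v : ℕ × ℕ => if v.2 = c v.1 then (1 : k) else 0) L.form

theorem FormedBundle.value_tensor (L M : FormedBundle k p n) (c : ℕ → ℕ) :
    (L.tensor M).value c = L.value c * M.value c := map_mul _ _ _

/-- The form of `L` does not vanish at the fixed points of `T` given by the charts. -/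
structure Tower.NonvanishingOn (T : Tower k p n) (L : FormedBundle k p n) : Prop
    extends T.On L where
  value_ne_zero : ∀ c, T.Valid c → L.value c ≠ 0

namespace Tower

variable {T T' : Tower k p n} {L M : FormedBundle k p n}

theorem NonvanishingOn.of_prefix (hL : T.NonvanishingOn L) (h : T <+: T') :
    T'.NonvanishingOn L :=
  ⟨hL.toOn.of_prefix h, fun c hc => hL.value_ne_zero c (hc.of_prefix h)⟩

theorem NonvanishingOn.trivial : T.NonvanishingOn .trivial :=
  ⟨On.trivial, fun c _ => by simp [FormedBundle.value, FormedBundle.trivial]⟩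

theorem NonvanishingOn.tensor (hL : T.NonvanishingOn L) (hM : T.NonvanishingOn M) :
    T.NonvanishingOn (L.tensor M) :=
  ⟨hL.toOn.tensor hM.toOn, fun c hc => by
    rw [FormedBundle.value_tensor]
    exact mul_ne_zero (hL.value_ne_zero c hc) (hM.value_ne_zero c hc)⟩

theorem NonvanishingOn.base (a : Fin n → kˣ) (i : ℕ) :
    T.NonvanishingOn (FormedBundle.base a i) := by
  refine ⟨On.base a i, fun c _ => ?_⟩
  unfold FormedBundle.base
  split_ifs
  · simp [FormedBundle.value, FormedBundle.ofUnit]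
  · simp [FormedBundle.value, FormedBundle.trivial]

theorem valid_append_iff {Ms : List (LineBundle k p n)} {c : ℕ → ℕ} :
    (T ++ [Ms]).Valid c ↔ T.Valid c ∧ c T.length < Ms.length := by
  have h0 : List.getD (T ++ [Ms]) T.length [] = Ms := by simp
  constructor
  · intro h
    refine ⟨h.of_prefix (List.prefix_append _ _), ?_⟩
    have := h T.length (by simp)
    rwa [h0] at this
  · rintro ⟨h, h'⟩ j hj
    rw [List.length_append, List.length_singleton] at hj
    rcases (Nat.lt_succ_iff_lt_or_eq.1 hj) with hj | rfl
    · rw [row_append (List.prefix_append _ _) hj]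
      exact h j hj
    · rwa [h0]

/-- Goodness of a tower with one more step. -/
theorem Good.append {Ms : List (LineBundle k p n)} (hT : T.Good) (h0 : 0 < Ms.length)
    (h : ∀ c, T.Valid c → ∀ a < Ms.length, ∀ b < Ms.length, a ≠ b →
      T.fibreChr c T.length (Ms.getD a .trivial) ≠ T.fibreChr c T.length (Ms.getD b .trivial)) :
    Good (T ++ [Ms]) := by
  have hr : List.getD (T ++ [Ms]) T.length [] = Ms := by simp
  have hpre : T <+: T ++ [Ms] := List.prefix_append _ _
  constructor
  · intro j hj
    rw [List.length_append, List.length_singleton] at hj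
    rcases (Nat.lt_succ_iff_lt_or_eq.1 hj) with hj | rfl
    · rw [row_append hpre hj]
      exact hT.pos j hj
    · rwa [hr]
  · intro c hc j hj a ha b hb hab
    rw [List.length_append, List.length_singleton] at hj
    obtain ⟨hc, -⟩ := valid_append_iff.1 hc
    rcases (Nat.lt_succ_iff_lt_or_eq.1 hj) with hj | rfl
    · rw [fibreChr_append hpre c hj.le, fibreChr_append hpre c hj.le, bundle_append hpre hj,
        bundle_append hpre hj]
      rw [row_append hpre hj] at ha hb
      exact hT.ne c hc j hj a ha b hb hab
    · rw [hr] at ha hb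
      rw [fibreChr_append hpre c le_rfl, fibreChr_append hpre c le_rfl, bundle_append_length,
        bundle_append_length]
      exact h c hc a ha b hb hab

end Tower

end

/-! ### The characters at the fixed points of `S` -/

section

open MvPolynomial

variable {k : Type u} [Field k] {p n : ℕ}

namespace Tower

variable {T T' : Tower k p n} {L M : FormedBundle k p n} {c : ℕ → ℕ}

/-- The character of `G` on the fibre of `L` at the fixed point of the last stage given by `c`. -/
def chrOn (T : Tower k p n) (c : ℕ → ℕ) (L : FormedBundle k p n) : MuChr k p n :=
  T.fibreChr c T.length L.toLineBundle

theorem On.chrOn_eq (hL : T.On L) (h : T <+: T') (c : ℕ → ℕ) : T'.chrOn c L = T.chrOn c L :=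
  hL.fibreChr_eq h c

theorem chrOn_tensor : T.chrOn c (L.tensor M) = T.chrOn c L * T.chrOn c M := fibreChr_mul c _ L M

theorem chrOn_trivial : T.chrOn c .trivial = 1 := fibreChr_of_deg_eq_zero c _ rfl

theorem chrOn_base (a : Fin n → kˣ) (i : ℕ) :
    T.chrOn c (FormedBundle.base a i) = (FormedBundle.base a i).chr := by
  refine fibreChr_of_deg_eq_zero c _ ?_
  unfold FormedBundle.base
  split_ifs <;> rfl

theorem chrOn_tautological :
    chrOn (T ++ [[.trivial, L.toLineBundle]]) c (.tautological T.length L) =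
      T.fibreChr c T.length (List.getD [.trivial, L.toLineBundle] (c T.length) .trivial) := by
  set T' : Tower k p n := T ++ [[.trivial, L.toLineBundle]] with hT'
  have hlen : T'.length = T.length + 1 := by simp [hT']
  have h1 : T'.fib c T.length =
      T.fibreChr c T.length (List.getD [.trivial, L.toLineBundle] (c T.length) .trivial) := by
    rw [fib_eq, bundle_append_length]
    exact fibreChr_append (List.prefix_append _ _) c le_rfl _
  rw [← h1, chrOn, fibreChr, hlen]
  have h2 : ∏ i ∈ Finset.range (T.length + 1),
      T'.fib c i ^ (FormedBundle.tautological T.length L).deg i = T'.fib c T.length := by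
    rw [Finset.prod_eq_single T.length]
    · change T'.fib c T.length ^ (Pi.single T.length 1 : ℕ → ℤ) T.length = _
      rw [Pi.single_eq_same]
      exact zpow_one (T'.fib c T.length)
    · intro i _ hi
      change T'.fib c i ^ (Pi.single T.length 1 : ℕ → ℤ) i = _
      rw [Pi.single_eq_of_ne hi]
      exact zpow_zero (T'.fib c i)
    · simp
  rw [h2]
  exact one_mul (T'.fib c T.length)

theorem NonvanishingOn.tautological (hp : p ≠ 0) (hL : T.NonvanishingOn L) :
    NonvanishingOn (T ++ [[.trivial, L.toLineBundle]]) (.tautological T.length L) := by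
  refine ⟨hL.toOn.tautological, fun c hc => ?_⟩
  obtain ⟨hc, hcN⟩ := valid_append_iff.1 hc
  have hv : (FormedBundle.tautological T.length L).value c =
      (if 0 = c T.length then (1 : k) else 0) ^ p -
        L.value c * (if 1 = c T.length then (1 : k) else 0) ^ p := by
    simp [FormedBundle.value, FormedBundle.tautological]
  rw [hv]
  have hcN : c T.length < 2 := hcN
  have : c T.length = 0 ∨ c T.length = 1 := by omega
  rcases this with h | h
  · simp [h, hp]
  · simpa [h, hp] using hL.value_ne_zero c hc

end Tower

/-- The construction `b`, applied to a good tower over `T₀`, gives a good tower over it with a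
line bundle whose form does not vanish at the fixed points, and on whose fibres there `G` acts by
characters in `V`. -/
def Builder.Spec (b : Builder k p n) (T₀ : Tower k p n) (V : (ℕ → ℕ) → Subgroup (MuChr k p n)) :
    Prop :=
  ∀ T, T₀ <+: T → Tower.Good T → T <+: (b T).1 ∧ (b T).1.Good ∧ (b T).1.NonvanishingOn (b T).2 ∧
    ∀ c, (b T).1.Valid c → (b T).1.chrOn c (b T).2 ∈ V c

namespace Builder.Spec

variable {b : Builder k p n} {T₀ : Tower k p n} {V W : (ℕ → ℕ) → Subgroup (MuChr k p n)}

theorem mono (h : b.Spec T₀ V) (hVW : ∀ c, V c ≤ W c) : b.Spec T₀ W := fun T hT hg =>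
  have H := h T hT hg
  ⟨H.1, H.2.1, H.2.2.1, fun c hc => hVW c (H.2.2.2 c hc)⟩

theorem trivial : Builder.Spec (fun T => (T, .trivial)) T₀ V := fun T _ hg =>
  ⟨List.prefix_refl T, hg, .trivial, fun c _ => Tower.chrOn_trivial (T := T) ▸ one_mem (V c)⟩

/-- Applying two constructions one after another and taking the tensor product. -/
theorem tensor {b' : Builder k p n} (h : b.Spec T₀ V) (h' : b'.Spec T₀ V) :
    Builder.Spec (fun T => ((b' (b T).1).1, (b T).2.tensor (b' (b T).1).2)) T₀ V := by
  intro T hT hg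
  obtain ⟨h1, h2, h3, h4⟩ := h T hT hg
  obtain ⟨h1', h2', h3', h4'⟩ := h' (b T).1 (hT.trans h1) h2
  refine ⟨h1.trans h1', h2', (h3.of_prefix h1').tensor h3', fun c hc => ?_⟩
  rw [Tower.chrOn_tensor, h3.toOn.chrOn_eq h1']
  exact mul_mem (h4 c (hc.of_prefix h1')) (h4' c hc)

theorem power (h : b.Spec T₀ V) (m : ℕ) : Builder.Spec (NormVar.power b m) T₀ V := by
  induction m with
  | zero => exact trivial
  | succ m ih => exact ih.tensor h

/-- The characters of `𝒪` and of `H ⊗ K` differ since the character of `H` is not in `V`. -/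
theorem lineStep (hp : p ≠ 0) (h : b.Spec T₀ V) {H : FormedBundle k p n}
    (hH : T₀.NonvanishingOn H) (hV : ∀ c, T₀.Valid c → T₀.chrOn c H ∉ V c) :
    Builder.Spec (NormVar.lineStep b H) T₀ fun c => V c ⊔ Subgroup.zpowers (T₀.chrOn c H) := by
  intro T hT hg
  obtain ⟨h1, h2, h3, h4⟩ := h T hT hg
  set x := b T with hx
  set L := H.tensor x.2 with hL
  have hHx : x.1.NonvanishingOn H := hH.of_prefix (hT.trans h1)
  have hLx : x.1.NonvanishingOn L := hHx.tensor h3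
  have hchr : ∀ c, x.1.chrOn c L = T₀.chrOn c H * x.1.chrOn c x.2 := fun c => by
    rw [hL, Tower.chrOn_tensor, hH.toOn.chrOn_eq (hT.trans h1)]
  have hne : ∀ c, x.1.Valid c → x.1.chrOn c L ≠ 1 := by
    intro c hc h
    refine hV c (hc.of_prefix (hT.trans h1)) ?_
    rw [hchr] at h
    have := eq_inv_of_mul_eq_one_left (a := T₀.chrOn c H) (b := x.1.chrOn c x.2) h
    rw [this]
    exact inv_mem (h4 c hc)
  have e0 : ∀ c, x.1.fibreChr c x.1.length LineBundle.trivial = 1 := fun c =>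
    Tower.chrOn_trivial (T := x.1)
  refine ⟨h1.trans (List.prefix_append _ _), h2.append (by simp) ?_, hLx.tautological hp, ?_⟩
  · intro c hc a ha b hb hab
    have ha : a < 2 := ha
    have hb : b < 2 := hb
    have : (a = 0 ∧ b = 1) ∨ (a = 1 ∧ b = 0) := by omega
    rcases this with ⟨rfl, rfl⟩ | ⟨rfl, rfl⟩
    · refine (e0 c).trans_ne (hne c hc).symm
    · refine ne_of_ne_of_eq (hne c hc) (e0 c).symm
  · intro c hc
    obtain ⟨hc, hcN⟩ := Tower.valid_append_iff.1 hc
    have hcN : c x.1.length < 2 := hcN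
    refine (Tower.chrOn_tautological (T := x.1) (L := L) (c := c)).symm ▸ ?_
    have : c x.1.length = 0 ∨ c x.1.length = 1 := by omega
    rcases this with h | h
    · rw [h]
      exact (e0 c).symm ▸ one_mem _
    · rw [h]
      change x.1.chrOn c L ∈ _
      rw [hchr]
      exact mul_mem (Subgroup.mem_sup_right (Subgroup.mem_zpowers _))
        (Subgroup.mem_sup_left (h4 c hc))

/-- The characters of `K_i` are in the span of those of `H_1, …, H_i`, provided that each of
these is not in the span of the preceding ones. -/
theorem modelQ (hp : p ≠ 0) {H : ℕ → FormedBundle k p n} {V : ℕ → Subgroup (MuChr k p n)} {r : ℕ}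
    (hH : ∀ i < r, T₀.NonvanishingOn (H (i + 1)))
    (hV : ∀ i < r, ∀ c, T₀.Valid c → T₀.chrOn c (H (i + 1)) ∉ V i)
    (hVs : ∀ i < r, ∀ c, V i ⊔ Subgroup.zpowers (T₀.chrOn c (H (i + 1))) ≤ V (i + 1)) :
    Builder.Spec (NormVar.modelQ H r) T₀ fun _ => V r := by
  induction r with
  | zero => exact trivial
  | succ r ih =>
    have ih := ih (fun i hi => hH i (by omega)) (fun i hi => hV i (by omega))
      (fun i hi => hVs i (by omega))
    exact (ih.mono fun c => le_sup_left.trans (hVs r r.lt_succ_self c)).tensor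
      (((ih.lineStep hp (hH r r.lt_succ_self) (hV r r.lt_succ_self)).mono
        (hVs r r.lt_succ_self)).power (p - 1))

end Builder.Spec

/-- The characters of `μ_p ^ n` which are trivial on the last `n - i` factors. -/
def firstChars (k : Type u) [Field k] (p n i : ℕ) : Subgroup (MuChr k p n) where
  carrier := {χ | ∀ g : MuPow k p n, (∀ j : Fin n, (j : ℕ) < i → g j = 1) → χ g = 1}
  one_mem' g _ := rfl
  mul_mem' {χ ψ} hχ hψ g hg := by rw [MonoidHom.mul_apply, hχ g hg, hψ g hg, one_mul]
  inv_mem' {χ} hχ g hg := by rw [MonoidHom.inv_apply, hχ g hg, inv_one]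

theorem firstChars_mono {i j : ℕ} (h : i ≤ j) : firstChars k p n i ≤ firstChars k p n j :=
  fun _ hχ g hg => hχ g fun l hl => hg l (hl.trans_le h)

theorem firstChars_zero : firstChars k p n 0 = ⊥ :=
  (Subgroup.eq_bot_iff_forall _).2 fun _ hχ =>
    MonoidHom.ext fun g => hχ g fun j hj => absurd hj (Nat.not_lt_zero j)

theorem base_chr_mem (a : Fin n → kˣ) (i : ℕ) :
    (FormedBundle.base a (i + 1)).chr ∈ firstChars k p n (i + 1) := by
  unfold FormedBundle.base
  split_ifs with h
  · intro g hg
    have : g ⟨i, by omega⟩ = 1 := hg ⟨i, by omega⟩ i.lt_succ_self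
    exact congrArg Subtype.val this
  · exact one_mem _

theorem base_chr_notMem {ζ : k} (hp : p.Prime) (hζ : IsPrimitiveRoot ζ p) (a : Fin n → kˣ) {i : ℕ}
    (hi : i < n) : (FormedBundle.base (p := p) a (i + 1)).chr ∉ firstChars k p n i := by
  intro h
  have : NeZero p := ⟨hp.ne_zero⟩
  have h1 := h (Pi.mulSingle ⟨i, hi⟩ hζ.toRootsOfUnity) fun j hj =>
    Pi.mulSingle_eq_of_ne (fun h => hj.ne (congrArg Fin.val h)) _
  rw [FormedBundle.base, dif_pos ⟨by omega, by omega⟩] at h1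
  have h2 : ((Pi.mulSingle (⟨i, hi⟩ : Fin n) hζ.toRootsOfUnity : MuPow k p n) ⟨i, hi⟩ : kˣ) = 1 :=
    h1
  rw [Pi.mulSingle_eq_same] at h2
  exact hζ.ne_one hp.one_lt (congrArg Units.val h2)

/-- The invariant of the sequence of moves: the characters of the two line bundles at the fixed
points are independent modulo `V`. -/
structure MoveInv (V : Subgroup (MuChr k p n))
    (s : Tower k p n × FormedBundle k p n × FormedBundle k p n) : Prop where
  good : s.1.Good
  fst : s.1.NonvanishingOn s.2.1
  snd : s.1.NonvanishingOn s.2.2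
  snd_notMem : ∀ c, s.1.Valid c → s.1.chrOn c s.2.2 ∉ V
  fst_notMem : ∀ c, s.1.Valid c → s.1.chrOn c s.2.1 ∉ V ⊔ Subgroup.zpowers (s.1.chrOn c s.2.2)

section
variable {ζ : k} (hp : p.Prime) (hζ : IsPrimitiveRoot ζ p) (a : Fin n → kˣ)
include hp hζ

/-- If the characters `A` and `B` of the two line bundles are independent modulo `V`, then so are
`B` and the character of the new line bundle: the latter differs from `A` by an element of the
span of `V` and `B`, and the exchange property applies. -/
theorem MoveInv.move {r : ℕ} (hr : r ≤ n)
    {s : Tower k p n × FormedBundle k p n × FormedBundle k p n}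
    (h : MoveInv (firstChars k p n r) s) :
    MoveInv (firstChars k p n r) (NormVar.move (FormedBundle.base a) (r + 2) s) := by
  set V := firstChars k p n r with hV
  obtain ⟨T, A, B⟩ := s
  obtain ⟨hg, hA, hB, hBV, hAV⟩ := h
  dsimp only at hg hA hB hBV hAV
  set H := Function.update (FormedBundle.base (p := p) a) (r + 1) B with hH
  have hHi : ∀ i < r, H (i + 1) = FormedBundle.base a (i + 1) := fun i hi =>
    Function.update_of_ne (by omega) _ _
  have hHr : H (r + 1) = B := Function.update_self _ _ _
  have hQ : Builder.Spec (modelQ H r) T fun _ => V := by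
    refine Builder.Spec.modelQ hp.ne_zero (V := firstChars k p n) (fun i hi => ?_)
      (fun i hi c _ => ?_) (fun i hi c => ?_)
    · rw [hHi i hi]; exact .base a _
    · rw [hHi i hi, Tower.chrOn_base]
      exact base_chr_notMem hp hζ a (by omega)
    · rw [hHi i hi, Tower.chrOn_base]
      exact sup_le (firstChars_mono i.le_succ) ((Subgroup.zpowers_le).2 (base_chr_mem a i))
  have hP : Builder.Spec (modelP H (r + 1)) T fun c => V ⊔ Subgroup.zpowers (T.chrOn c B) := by
    have := (hQ.lineStep hp.ne_zero (H := H (r + 1)) (hHr ▸ hB) (hHr ▸ hBV)).power (p - 1)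
    rw [hHr] at this
    rw [show modelP H (r + 1) = NormVar.power (NormVar.lineStep (modelQ H r) (H (r + 1))) (p - 1)
      from rfl, hHr]
    exact this
  obtain ⟨h1, h2, h3, h4⟩ := hP T (List.prefix_refl T) hg
  have key : ∀ c, (modelP H (r + 1) T).1.Valid c →
      (modelP H (r + 1) T).1.chrOn c (A.tensor (modelP H (r + 1) T).2) ∉
        V ⊔ Subgroup.zpowers (T.chrOn c B) := by
    intro c hc hmem
    refine hAV c (hc.of_prefix h1) ?_
    rw [Tower.chrOn_tensor, hA.toOn.chrOn_eq h1] at hmem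
    exact (Subgroup.mul_mem_cancel_right _ (h4 c hc)).1 hmem
  refine ⟨h2, hB.of_prefix h1, (hA.of_prefix h1).tensor h3, fun c hc hmem =>
    key c hc (Subgroup.mem_sup_left hmem), fun c hc => ?_⟩
  change (modelP H (r + 1) T).1.chrOn c B ∉ _
  rw [hB.toOn.chrOn_eq h1]
  exact exchange hp (hBV c (hc.of_prefix h1)) (key c hc) (MuChr.pow_eq_one _)

theorem MoveInv.iterate {r : ℕ} (hr : r ≤ n)
    {s : Tower k p n × FormedBundle k p n × FormedBundle k p n}
    (h : MoveInv (firstChars k p n r) s) (m : ℕ) :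
    MoveInv (firstChars k p n r) ((NormVar.move (FormedBundle.base a) (r + 2))^[m] s) := by
  induction m with
  | zero => exact h
  | succ m ih =>
    rw [Function.iterate_succ_apply']
    exact ih.move hp hζ a hr

/-- The invariant of the stages: at the fixed points the character of `J_m` is not in the span of
the characters of `H_1, …, H_{m-1}`. -/
theorem stage_spec (j : ℕ) (hj : j + 2 ≤ n) :
    (stage (FormedBundle.base (p := p) a) (j + 1)).1.Good ∧
    (stage (FormedBundle.base (p := p) a) (j + 1)).1.NonvanishingOn
      (stage (FormedBundle.base a) (j + 1)).2 ∧
    ∀ c, (stage (FormedBundle.base (p := p) a) (j + 1)).1.Valid c →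
      (stage (FormedBundle.base (p := p) a) (j + 1)).1.chrOn c
        (stage (FormedBundle.base a) (j + 1)).2 ∉ firstChars k p n (n - j - 2) := by
  have hm : n - j = n - j - 2 + 2 := by omega
  suffices H : MoveInv (firstChars k p n (n - j - 2))
      ((stage (FormedBundle.base (p := p) a) j).1,
        if j = 0 then FormedBundle.base a n else FormedBundle.base a (n - j - 1),
        (stage (FormedBundle.base (p := p) a) j).2) by
    have := H.iterate hp hζ a (by omega) p
    rw [← hm] at this
    exact ⟨this.good, this.snd, this.snd_notMem⟩
  have hb : ∀ (c : ℕ → ℕ) (T : Tower k p n) (i : ℕ), 1 ≤ i → i ≤ n →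
      T.chrOn c (FormedBundle.base a i) ∉ firstChars k p n (i - 1) := by
    intro c T i h1 h2
    rw [Tower.chrOn_base]
    obtain ⟨i, rfl⟩ : ∃ l, i = l + 1 := ⟨i - 1, by omega⟩
    exact base_chr_notMem hp hζ a (by omega)
  have hb' : ∀ (c : ℕ → ℕ) (T : Tower k p n) (i : ℕ), 1 ≤ i →
      T.chrOn c (FormedBundle.base a i) ∈ firstChars k p n i := by
    intro c T i h1
    rw [Tower.chrOn_base]
    obtain ⟨i, rfl⟩ : ∃ l, i = l + 1 := ⟨i - 1, by omega⟩
    exact base_chr_mem a i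
  induction j with
  | zero =>
    refine ⟨⟨fun j hj => absurd hj (Nat.not_lt_zero j),
      fun _ _ j hj => absurd hj (Nat.not_lt_zero j)⟩,
      .base a _, .base a _, fun c _ => ?_, fun c _ hmem => ?_⟩
    · have := hb c [] (n - 1) (by omega) (by omega)
      exact this
    · refine hb c [] n (by omega) le_rfl ((sup_le (firstChars_mono (by omega)) ?_) hmem)
      exact (Subgroup.zpowers_le).2 (hb' c [] (n - 1) (by omega))
  | succ j ih =>
    have hm' : n - j = n - j - 2 + 2 := by omega
    obtain ⟨h1, h2, h3⟩ : _ ∧ _ ∧ _ := by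
      have := (ih (by omega) hm').iterate hp hζ a (by omega) p
      rw [← hm'] at this
      exact (⟨this.good, this.snd, this.snd_notMem⟩ :
        (stage (FormedBundle.base (p := p) a) (j + 1)).1.Good ∧
        (stage (FormedBundle.base (p := p) a) (j + 1)).1.NonvanishingOn
          (stage (FormedBundle.base a) (j + 1)).2 ∧
        ∀ c, (stage (FormedBundle.base (p := p) a) (j + 1)).1.Valid c →
          (stage (FormedBundle.base (p := p) a) (j + 1)).1.chrOn c
            (stage (FormedBundle.base a) (j + 1)).2 ∉ firstChars k p n (n - j - 2))
    refine ⟨h1, ?_, h2, fun c hc hmem => h3 c hc (firstChars_mono (by omega) hmem),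
      fun c hc => ?_⟩
    · rw [if_neg (Nat.succ_ne_zero j)]; exact .base a _
    · rw [if_neg (Nat.succ_ne_zero j)]
      refine exchange hp ?_ (fun hmem => h3 c hc ?_) (MuChr.pow_eq_one _)
      · have := hb c (stage (FormedBundle.base (p := p) a) (j + 1)).1 (n - (j + 1) - 1) (by omega)
          (by omega)
        exact this
      · refine (sup_le (firstChars_mono (by omega)) ((Subgroup.zpowers_le).2 ?_)) hmem
        exact hb' c _ _ (by omega)

/-- The tower `S` is good, the form of `J` does not vanish at its fixed points, and there `G` acts
nontrivially on the fibres of `J`. -/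
theorem chainS_spec (hn : 2 ≤ n) : (chainS p a).Good ∧ (chainS p a).NonvanishingOn (chainJ p a) ∧
    ∀ c, (chainS p a).Valid c → (chainS p a).chrOn c (chainJ p a) ≠ 1 := by
  have := stage_spec hp hζ a (n - 2) (by omega)
  rw [show n - 2 + 1 = n - 1 by omega, show n - (n - 2) - 2 = 0 by omega, firstChars_zero] at this
  exact ⟨this.1, this.2.1, fun c hc h => this.2.2 c hc (Subgroup.mem_bot.2 h)⟩

end

end

/-! ### The norm form of a Kummer algebra -/

section

section NormForm

open Polynomial

variable {R S : Type*} [CommRing R] [CommRing S] {p : ℕ}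

/-- The matrix of multiplication by `u` on the basis `1, u, …, u ^ (p - 1)` of the algebra
`R[u] / (u ^ p - γ)`. -/
def rootMatrix (γ : R) (p : ℕ) : Matrix (Fin p) (Fin p) R := Matrix.of fun i j =>
  if (j : ℕ) + 1 = p then (if (i : ℕ) = 0 then γ else 0) else if (i : ℕ) = j + 1 then 1 else 0

/-- The norm of `∑ i < p, β i * u ^ i`, where `u ^ p = γ`. -/
def normForm (γ : R) (p : ℕ) (β : ℕ → R) : R :=
  (∑ i ∈ Finset.range p, β i • rootMatrix γ p ^ i).det

theorem map_rootMatrix (φ : R →+* S) (γ : R) : (rootMatrix γ p).map φ = rootMatrix (φ γ) p := by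
  ext i j
  simp only [rootMatrix, Matrix.map_apply, Matrix.of_apply]
  split_ifs <;> simp

theorem map_normForm (φ : R →+* S) (γ : R) (β : ℕ → R) :
    φ (normForm γ p β) = normForm (φ γ) p fun i => φ (β i) := by
  rw [normForm, RingHom.map_det]
  congr 1
  rw [map_sum]
  refine Finset.sum_congr rfl fun i _ => ?_
  rw [← map_rootMatrix, ← RingHom.mapMatrix_apply, ← map_pow]
  ext a b
  simp

theorem exists_basis_leftMulMatrix [Nontrivial R] (hp : p ≠ 0) (γ : R) :
    ∃ b : Module.Basis (Fin p) R (AdjoinRoot (X ^ p - C γ)),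
      Algebra.leftMulMatrix b (AdjoinRoot.root (X ^ p - C γ)) = rootMatrix γ p := by
  have hm : (X ^ p - C γ).Monic := monic_X_pow_sub_C γ hp
  let pb := AdjoinRoot.powerBasis' hm
  have hd : pb.dim = p := natDegree_X_pow_sub_C
  let b := pb.basis.reindex (finCongr hd)
  have hb : ∀ j : Fin p, b j = AdjoinRoot.root (X ^ p - C γ) ^ (j : ℕ) := fun j => by
    rw [Module.Basis.reindex_apply, PowerBasis.basis_eq_pow]
    rfl
  refine ⟨b, ?_⟩
  ext i j
  rw [Algebra.leftMulMatrix_eq_repr_mul, hb, ← pow_succ', rootMatrix, Matrix.of_apply]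
  split_ifs with h1 h2 h3
  · have : b ⟨0, by omega⟩ = 1 := by rw [hb, pow_zero]
    rw [h1, root_pow, ← mul_one (AdjoinRoot.of _ γ), ← this, ← AdjoinRoot.algebraMap_eq,
      ← Algebra.smul_def, map_smul, b.repr_self, Finsupp.smul_apply,
      show i = ⟨0, by omega⟩ from Fin.ext h2, Finsupp.single_eq_same, smul_eq_mul, mul_one]
  · have : b ⟨0, by omega⟩ = 1 := by rw [hb, pow_zero]
    rw [h1, root_pow, ← mul_one (AdjoinRoot.of _ γ), ← this, ← AdjoinRoot.algebraMap_eq,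
      ← Algebra.smul_def, map_smul, b.repr_self, Finsupp.smul_apply, Finsupp.single_eq_of_ne,
      smul_zero]
    exact fun h => h2 (congrArg Fin.val h)
  · rw [show AdjoinRoot.root (X ^ p - C γ) ^ ((j : ℕ) + 1) = b i by rw [hb, h3], b.repr_self,
      Finsupp.single_eq_same]
  · rw [show AdjoinRoot.root (X ^ p - C γ) ^ ((j : ℕ) + 1) = b ⟨j + 1, by omega⟩ by rw [hb],
      b.repr_self, Finsupp.single_eq_of_ne]
    exact fun h => h3 (congrArg Fin.val h)

theorem norm_eq_normForm (hp : p ≠ 0) (γ : R) (β : ℕ → R) :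
    Algebra.norm R (∑ i ∈ Finset.range p, algebraMap R (AdjoinRoot (X ^ p - C γ)) (β i) *
      AdjoinRoot.root (X ^ p - C γ) ^ i) = normForm γ p β := by
  nontriviality R
  obtain ⟨b, hM⟩ := exists_basis_leftMulMatrix hp γ
  rw [Algebra.norm_eq_matrix_det b, normForm, map_sum]
  congr 1
  refine Finset.sum_congr rfl fun i _ => ?_
  rw [map_mul, map_pow, hM, AlgHom.commutes, Algebra.smul_def]

theorem rootMatrix_pow_self (hp : p ≠ 0) (γ : R) :
    rootMatrix γ p ^ p = γ • (1 : Matrix (Fin p) (Fin p) R) := by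
  nontriviality R
  obtain ⟨b, hM⟩ := exists_basis_leftMulMatrix hp γ
  rw [← hM, ← map_pow, root_pow, ← AdjoinRoot.algebraMap_eq, AlgHom.commutes,
    Algebra.algebraMap_eq_smul_one]

/-- Rescaling of the generator `u` by `v`, and of the coefficients by `y`. -/
theorem normForm_scale (γ : R) (β : ℕ → R) (v : Rˣ) (y : R) :
    normForm (γ * v ^ p) p (fun i => β i * (y * ((v⁻¹ : Rˣ) : R) ^ i)) =
      normForm γ p β * y ^ p := by
  set D : Matrix (Fin p) (Fin p) R := Matrix.diagonal fun i => (v : R) ^ (i : ℕ) with hD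
  have hDu : IsUnit D.det := by
    rw [hD, Matrix.det_diagonal]
    exact IsUnit.prod_univ_iff.2 fun i => v.isUnit.pow _
  have h1 : SemiconjBy D (rootMatrix (γ * v ^ p) p) ((v : R) • rootMatrix γ p) := by
    change D * _ = _ * D
    ext i j
    rw [hD, Matrix.diagonal_mul, Matrix.mul_diagonal, Matrix.smul_apply, rootMatrix, rootMatrix,
      Matrix.of_apply, Matrix.of_apply]
    split_ifs with h1 h2 h3
    · have : (v : R) ^ p = v ^ (j : ℕ) * v := by rw [← pow_succ, h1]
      rw [h2, this, smul_eq_mul]; ring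
    · simp
    · rw [h3, smul_eq_mul]; ring
    · simp
  have h2 : D * ∑ i ∈ Finset.range p, (β i * (y * ((v⁻¹ : Rˣ) : R) ^ i)) •
      rootMatrix (γ * v ^ p) p ^ i =
      (y • ∑ i ∈ Finset.range p, β i • rootMatrix γ p ^ i) * D := by
    rw [Finset.mul_sum, Finset.smul_sum, Finset.sum_mul]
    refine Finset.sum_congr rfl fun i _ => ?_
    rw [Matrix.mul_smul, (h1.pow_right i).eq, _root_.smul_pow, Matrix.smul_mul, smul_smul,
      smul_smul, Matrix.smul_mul]
    congr 1
    have : ((v⁻¹ : Rˣ) : R) ^ i * (v : R) ^ i = 1 := by rw [← mul_pow, Units.inv_mul, one_pow]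
    linear_combination β i * y * this
  have h3 := congrArg Matrix.det h2
  rw [Matrix.det_mul, Matrix.det_mul, Matrix.det_smul, Fintype.card_fin, mul_comm] at h3
  have h4 := hDu.mul_right_cancel h3
  exact h4.trans (mul_comm _ _)

theorem normForm_single_zero (hp : p ≠ 0) (γ : R) {β : ℕ → R} (hβ : ∀ i, 0 < i → i < p → β i = 0) :
    normForm γ p β = β 0 ^ p := by
  rw [normForm, Finset.sum_eq_single 0]
  · rw [pow_zero, Matrix.det_smul, Matrix.det_one, Fintype.card_fin, mul_one]
  · intro i hi h0
    rw [hβ i (Nat.pos_of_ne_zero h0) (Finset.mem_range.1 hi), zero_smul]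
  · intro h
    exact absurd (Finset.mem_range.2 (Nat.pos_of_ne_zero hp)) h

/-- The norm of `u ^ i` is a unit, since `u ^ p = γ` is one. -/
theorem isUnit_normForm_single {γ : R} (hγ : IsUnit γ) {i : ℕ} (hi : i < p) {β : ℕ → R}
    (h1 : β i = 1) (hβ : ∀ j < p, j ≠ i → β j = 0) : IsUnit (normForm γ p β) := by
  have hp : p ≠ 0 := by omega
  rw [normForm, Finset.sum_eq_single i, h1, one_smul, Matrix.det_pow]
  · refine IsUnit.pow i (isUnit_pow_iff hp |>.1 ?_)
    rw [← Matrix.det_pow, rootMatrix_pow_self hp, Matrix.det_smul, Matrix.det_one, mul_one]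
    exact hγ.pow _
  · intro j hj h
    rw [hβ j (Finset.mem_range.1 hj) h, zero_smul]
  · intro h
    exact absurd (Finset.mem_range.2 hi) h

/-- Multiplication by `u ^ i` shifts the basis by `i` modulo `p`, up to scalars. -/
theorem rootMatrix_pow_apply (γ : R) (i : ℕ) (a b : Fin p) (h : ¬ (a : ℕ) ≡ b + i [MOD p]) :
    (rootMatrix γ p ^ i) a b = 0 := by
  induction i generalizing a with
  | zero =>
    rw [pow_zero, Matrix.one_apply_ne]
    rintro rfl
    exact h rfl
  | succ i ih =>
    rw [pow_succ', Matrix.mul_apply]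
    refine Finset.sum_eq_zero fun c _ => ?_
    by_cases hc : (c : ℕ) ≡ b + i [MOD p]
    · have : rootMatrix γ p a c = 0 := by
        rw [rootMatrix, Matrix.of_apply]
        split_ifs with h1 h2 h3
        · refine absurd ?_ h
          rw [h2, ← add_assoc]
          refine Nat.ModEq.trans ?_ (hc.add_right 1)
          rw [h1]
          exact (Nat.modEq_zero_iff_dvd.2 dvd_rfl).symm
        · rfl
        · refine absurd ?_ h
          rw [h3, ← add_assoc]
          exact hc.add_right 1
        · rfl
      rw [this, zero_mul]
    · rw [ih c hc, mul_zero]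

/-- The powers of `u` other than `1` have trace zero, so the norm is `β 0 ^ p` to first order. -/
theorem normForm_first_order (hp : p ≠ 0) (γ : R) {β : ℕ → R} {ε : R} (hε : ε ^ 2 = 0)
    (hu : IsUnit (β 0)) (hβ : ∀ i, 0 < i → i < p → ε ∣ β i) : normForm γ p β = β 0 ^ p := by
  obtain ⟨b, hb⟩ := hu
  choose! v hv using hβ
  set A : Matrix (Fin p) (Fin p) R :=
    ∑ i ∈ (Finset.range p).erase 0, ((b⁻¹ : Rˣ) * v i) • rootMatrix γ p ^ i with hA
  have htr : A.trace = 0 := by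
    rw [hA, Matrix.trace_sum]
    refine Finset.sum_eq_zero fun i hi => ?_
    obtain ⟨hi0, hip⟩ := Finset.mem_erase.1 hi
    rw [Matrix.trace_smul, Matrix.trace, Finset.sum_eq_zero, smul_zero]
    intro a _
    refine rootMatrix_pow_apply γ i a a fun h => ?_
    have h' : i ≡ 0 [MOD p] := (Nat.ModEq.add_left_cancel' (a : ℕ) (by simpa using h)).symm
    have := Nat.le_of_dvd (Nat.pos_of_ne_zero hi0) (Nat.modEq_zero_iff_dvd.1 h')
    have := Finset.mem_range.1 hip
    omega
  have h : ∑ i ∈ Finset.range p, β i • rootMatrix γ p ^ i = (b : R) • (1 + ε • A) := by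
    rw [← Finset.add_sum_erase _ _ (Finset.mem_range.2 (Nat.pos_of_ne_zero hp)), pow_zero, ← hb,
      smul_add, hA, Finset.smul_sum, Finset.smul_sum]
    congr 1
    refine Finset.sum_congr rfl fun i hi => ?_
    obtain ⟨hi0, hip⟩ := Finset.mem_erase.1 hi
    rw [hv i (Nat.pos_of_ne_zero hi0) (Finset.mem_range.1 hip), smul_smul, smul_smul]
    congr 1
    linear_combination (-(ε * v i)) * b.mul_inv
  rw [normForm, h, Matrix.det_smul, Fintype.card_fin, Matrix.det_one_add_smul, htr, hε, ← hb]
  ring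

end NormForm

open MvPolynomial

variable {k : Type u} [Field k] {p n : ℕ}

theorem aeval_kummerNorm {R : Type*} [CommRing R] [Algebra k R] (hp : p ≠ 0) (x : ℕ × ℕ → R)
    (γ : MvPolynomial (ℕ × ℕ) k) (N : ℕ) :
    aeval x (kummerNorm γ N p) = normForm (aeval x γ) p fun i => x (N, i) := by
  rw [kummerNorm, norm_eq_normForm hp]
  refine (map_normForm (aeval x : MvPolynomial (ℕ × ℕ) k →ₐ[k] R).toRingHom _ _).trans ?_
  congr 1
  funext i
  exact aeval_X x _

end

/-! ### Smoothness criterion and functions on the charts of a tower -/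

section

section Smooth

variable {k : Type u} [Field k] {A : Type u} [CommRing A] [Algebra k A]

/-- The infinitesimal lifting criterion for the smoothness of a principal open subscheme. -/
theorem smooth_localization (hA : Algebra.FiniteType k A) (h : A)
    (H : ∀ (B : Type u) [CommRing B] [Algebra k B] (J : Ideal B), J ^ 2 = ⊥ →
      ∀ g : A →ₐ[k] B ⧸ J, IsUnit (g h) → ∃ θ : A →ₐ[k] B, (Ideal.Quotient.mkₐ k J).comp θ = g) :
    Algebra.Smooth k (Localization.Away h) := by
  have h1 : Algebra.FinitePresentation k A := Algebra.FinitePresentation.of_finiteType.1 hA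
  have h2 : Algebra.FinitePresentation A (Localization.Away h) :=
    IsLocalization.Away.finitePresentation h
  refine ⟨.of_comp_surjective fun B _ _ J hJ f => ?_, .trans k A _⟩
  obtain ⟨θ, hθ⟩ := H B J hJ (f.comp (IsScalarTower.toAlgHom k A (Localization.Away h)))
    ((IsLocalization.Away.algebraMap_isUnit h).map f)
  have hu : IsUnit (θ h) := by
    rw [← IsNilpotent.isUnit_quotient_mk_iff (I := J) ⟨2, hJ⟩]
    have : Ideal.Quotient.mk J (θ h) = f (algebraMap A _ h) := DFunLike.congr_fun hθ h
    rw [this]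
    exact (IsLocalization.Away.algebraMap_isUnit h).map f
  refine ⟨IsLocalization.Away.liftAlgHom h hu, ?_⟩
  refine IsLocalization.algHom_ext (Submonoid.powers h) ?_
  refine AlgHom.ext fun a => ?_
  refine .trans ?_ (DFunLike.congr_fun hθ a)
  exact congrArg (Ideal.Quotient.mk J) (IsLocalization.Away.lift_eq (S := Localization.Away h)
    (g := (θ : A →+* B)) h hu a)

end Smooth

theorem AffineChart.mem_of_act_eq_smul {K : Type u} [Field K] {G : Type u} [Group G]
    {X : Action (Over (Spec (.of K))) G} {U : AffineChart X} {q : Spec (.of U.A)}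
    (hq : q ∈ U.fixedPrimes) {g : G} {y : U.A} {r : K} (hy : U.act g y = r • y) (hr : r ≠ 1) :
    y ∈ q.asIdeal := by
  have := hq g y
  rw [hy, ← one_smul K y, smul_smul, mul_one, ← sub_smul] at this
  have := Submodule.smul_of_tower_mem q.asIdeal (r - 1)⁻¹ this
  rwa [smul_smul, inv_mul_cancel₀ (sub_ne_zero.2 hr), one_smul] at this

open MvPolynomial

variable {k : Type u} [Field k] {p n : ℕ}

namespace Tower

variable {T : Tower k p n} {I : Ideal T.CoordRing}

/-- The coordinate `v` is one of the coordinates of the tower. -/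
def InRange (T : Tower k p n) (v : ℕ × ℕ) : Prop :=
  v.1 < T.length ∧ v.2 < (T.getD v.1 []).length

theorem inRange_iff (v : ℕ × ℕ) :
    T.InRange v ↔ ∃ h : v.1 < T.length, v.2 < (T.get ⟨v.1, h⟩).length := by
  constructor
  · rintro ⟨h1, h2⟩
    rw [List.getD_eq_getElem _ _ h1] at h2
    exact ⟨h1, h2⟩
  · rintro ⟨h1, h2⟩
    refine ⟨h1, ?_⟩
    rw [List.getD_eq_getElem _ _ h1]
    exact h2

theorem InRange.exists_coord {v : ℕ × ℕ} (h : T.InRange v) :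
    ∃ w : T.Coord, ((w.1 : ℕ), (w.2 : ℕ)) = v :=
  have h := (inRange_iff v).1 h
  ⟨⟨⟨v.1, h.1⟩, ⟨v.2, h.2⟩⟩, rfl⟩

theorem toCoordRing_X (w : T.Coord) : T.toCoordRing (X ((w.1 : ℕ), (w.2 : ℕ))) = X w := by
  rw [toCoordRing, aeval_X, dif_pos ⟨w.1.2, w.2.2⟩]

theorem toCoordRing_X_of_not {v : ℕ × ℕ} (h : ¬ T.InRange v) : T.toCoordRing (X v) = 0 := by
  rw [toCoordRing, aeval_X, dif_neg (fun h' => h ((inRange_iff v).2 h'))]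

theorem aeval_toCoordRing {R : Type*} [CommRing R] [Algebra k R] {x : ℕ × ℕ → R}
    (hx : ∀ v, ¬ T.InRange v → x v = 0) (F : MvPolynomial (ℕ × ℕ) k) :
    aeval (fun w : T.Coord => x (w.1, w.2)) (T.toCoordRing F) = aeval x F := by
  have : (aeval fun w : T.Coord => x (w.1, w.2)).comp T.toCoordRing = aeval x := by
    refine MvPolynomial.algHom_ext fun v => ?_
    rw [AlgHom.comp_apply, aeval_X]
    by_cases h : T.InRange v
    · obtain ⟨w, rfl⟩ := h.exists_coord
      rw [toCoordRing_X, aeval_X]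
    · rw [toCoordRing_X_of_not h, map_zero, hx v h]
  exact DFunLike.congr_fun this F

theorem Chart.valid (c : T.Chart) : T.Valid (c.toFun T) := fun j hj => by
  rw [Chart.toFun, dif_pos hj, List.getD_eq_getElem _ _ hj]
  exact (c ⟨j, hj⟩).2

/-- The chart given by a function on the natural numbers. -/
def Valid.chart {d : ℕ → ℕ} (hd : T.Valid d) : T.Chart := fun j => ⟨d j, by
  have := hd j j.2
  rwa [List.getD_eq_getElem _ _ j.2] at this⟩

theorem Valid.toFun_chart {d : ℕ → ℕ} (hd : T.Valid d) {j : ℕ} (hj : j < T.length) :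
    (hd.chart).toFun T j = d j := by
  rw [Chart.toFun, dif_pos hj]
  rfl

theorem fib_congr {c d : ℕ → ℕ} (h : ∀ j < T.length, c j = d j) {j : ℕ} (hj : j < T.length) :
    T.fib c j = T.fib d j :=
  triSolve_congr (m := T.length) (fun j hj => by rw [h j hj]) (fun j hj i _ => by rw [h j hj]) j hj

theorem affChr_congr {c d : ℕ → ℕ} (h : ∀ j < T.length, c j = d j) {v : ℕ × ℕ}
    (hv : v.1 < T.length) : T.affChr c v = T.affChr d v := by
  have : T.fibreChr c v.1 (T.bundle v.1 v.2) = T.fibreChr d v.1 (T.bundle v.1 v.2) :=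
    congrArg (_ * ·) (Finset.prod_congr rfl fun i hi => by
      rw [fib_congr h ((Finset.mem_range.1 hi).trans hv)])
  rw [affChr, affChr, this, fib_congr h hv]

theorem affChr_append {T' : Tower k p n} (h : T <+: T') (c : ℕ → ℕ) {v : ℕ × ℕ}
    (hv : v.1 < T.length) : T'.affChr c v = T.affChr c v := by
  rw [affChr, affChr, fib_append h c hv, bundle_append h hv, fibreChr_append h c hv.le]

theorem Good.affChr_ne_one (hT : T.Good) {c : ℕ → ℕ} (hc : T.Valid c) {v : ℕ × ℕ}
    (hv : T.InRange v) (hvc : v.2 ≠ c v.1) : T.affChr c v ≠ 1 := by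
  intro h
  refine hT.ne c hc v.1 hv.1 v.2 hv.2 (c v.1) (hc v.1 hv.1) hvc ?_
  rw [← fib_eq]
  exact mul_inv_eq_one (a := T.fibreChr c v.1 (T.bundle v.1 v.2)).1 h

variable (T I) in
/-- The affine coordinate `v` on a chart, which is zero if the tower has no coordinate `v`. -/
def coordFn (c : T.Chart) (v : ℕ × ℕ) : (T.gradedCharts I).chartRing {c} :=
  if h : ∃ h : v.1 < T.length, v.2 < (T.get ⟨v.1, h⟩).length then
    T.affCoord I c ⟨⟨v.1, h.1⟩, ⟨v.2, h.2⟩⟩ else 0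

variable {c : T.Chart}

theorem coordFn_coord (w : T.Coord) : T.coordFn I c (w.1, w.2) = T.affCoord I c w := by
  rw [coordFn, dif_pos ⟨w.1.2, w.2.2⟩]

theorem coordFn_of_not {v : ℕ × ℕ} (h : ¬ T.InRange v) : T.coordFn I c v = 0 := by
  rw [coordFn, dif_neg (fun h' => h ((inRange_iff v).2 h'))]

theorem coordFn_chart {j : ℕ} (hj : j < T.length) : T.coordFn I c (j, c.toFun T j) = 1 := by
  have := T.coordFn_coord (I := I) (c := c) ⟨⟨j, hj⟩, c ⟨j, hj⟩⟩
  rw [Chart.toFun, dif_pos hj, this, affCoord_chart]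

theorem adjoin_range_coordFn : Algebra.adjoin k (Set.range (T.coordFn I c)) = ⊤ := by
  refine eq_top_iff.2 fun z _ => ?_
  obtain ⟨F, rfl⟩ := T.exists_aeval_affCoord I c z
  have h : Algebra.adjoin k (Set.range (T.affCoord I c)) ≤
      Algebra.adjoin k (Set.range (T.coordFn I c)) := by
    refine Algebra.adjoin_mono ?_
    rintro _ ⟨w, rfl⟩
    exact ⟨_, coordFn_coord w⟩
  refine h ?_
  rw [Algebra.adjoin_range_eq_range_aeval]
  exact ⟨F, rfl⟩

theorem finiteType_chartRing : Algebra.FiniteType k ((T.gradedCharts I).chartRing {c}) := by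
  refine Algebra.FiniteType.of_surjective (aeval (T.affCoord I c) : T.CoordRing →ₐ[k] _) ?_
  exact T.exists_aeval_affCoord I c

variable (T) in
/-- If the coordinates are rescaled by a torus element `u`, according to their degrees, then `F` is
multiplied by a factor. -/
def Multihomogeneous (F : MvPolynomial (ℕ × ℕ) k) : Prop :=
  ∀ (R : Type u) [CommRing R] [Algebra k R] (x x' : ℕ × ℕ → R) (u : ℕ → Rˣ),
    (∀ v : ℕ × ℕ, v.1 < T.length → x' v = x v *
      ((u v.1 * (∏ i ∈ Finset.range v.1, u i ^ (T.bundle v.1 v.2).deg i)⁻¹ : Rˣ) : R)) →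
    ∃ z : R, aeval x' F = aeval x F * z

theorem aeval_coordFn {F : MvPolynomial (ℕ × ℕ) k} (hF : T.toCoordRing F ∈ I)
    (h : T.Multihomogeneous F) : aeval (T.coordFn I c) F = 0 := by
  refine (aeval_toCoordRing (T := T) (x := T.coordFn I c)
    (fun v hv => coordFn_of_not hv) F).symm.trans ?_
  simp only [coordFn_coord]
  refine T.aeval_affCoord_eq_zero I c hF fun R _ _ x u => ?_
  classical
  let x₁ : ℕ × ℕ → R := fun v => if h : ∃ h : v.1 < T.length, v.2 < (T.get ⟨v.1, h⟩).length then
    x ⟨⟨v.1, h.1⟩, ⟨v.2, h.2⟩⟩ else 0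
  let x₂ : ℕ × ℕ → R := fun v => x₁ v *
    ((u v.1 * (∏ i ∈ Finset.range v.1, u i ^ (T.bundle v.1 v.2).deg i)⁻¹ : Rˣ) : R)
  obtain ⟨z, hz⟩ := h R x₁ x₂ u fun _ _ => rfl
  have h1 : ∀ v, ¬ T.InRange v → x₁ v = 0 := fun v hv =>
    dif_neg fun h' => hv ((inRange_iff v).2 h')
  have h2 : ∀ w : T.Coord, x₁ (w.1, w.2) = x w := fun w => dif_pos ⟨w.1.2, w.2.2⟩
  refine ⟨z, ?_⟩
  rw [← aeval_toCoordRing (T := T) h1, ← aeval_toCoordRing (T := T) (x := x₂) fun v hv => by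
    simp only [x₂]; rw [h1 v hv, zero_mul]] at hz
  simp only [x₂, h2] at hz
  simp only [prod_wt]
  exact hz

theorem exists_algHom_coordFn {R : Type*} [CommRing R] [Algebra k R] {x : ℕ × ℕ → R}
    (hx : ∀ v, ¬ T.InRange v → x v = 0) (h1 : ∀ j < T.length, x (j, c.toFun T j) = 1)
    (hI : ∀ F ∈ I, aeval (fun w : T.Coord => x (w.1, w.2)) F = 0) :
    ∃ θ : (T.gradedCharts I).chartRing {c} →ₐ[k] R, ∀ v, θ (T.coordFn I c v) = x v := by
  obtain ⟨θ, hθ⟩ := T.exists_algHom I c (fun w => x (w.1, w.2))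
    (fun j => by rw [← h1 j j.2, Chart.toFun_fin]) hI
  refine ⟨θ, fun v => ?_⟩
  by_cases h : T.InRange v
  · obtain ⟨w, rfl⟩ := h.exists_coord
    rw [coordFn_coord, hθ]
  · rw [coordFn_of_not h, map_zero, hx v h]

variable {h : ∀ g, I ≤ I.comap (T.act g)}

theorem act_coordFn (g : MuPow k p n) (v : ℕ × ℕ) :
    (T.affineChart I h c).act g (T.coordFn I c v) =
      (T.affChr (c.toFun T) v g : k) • T.coordFn I c v := by
  by_cases hv : T.InRange v
  · obtain ⟨w, rfl⟩ := hv.exists_coord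
    rw [coordFn_coord]
    exact T.chartMap_affCoord I c h g w
  · rw [coordFn_of_not hv, smul_zero]
    exact map_zero _

theorem coordFn_mem_of_fixed {q : Spec (.of (T.affineChart I h c).A)}
    (hq : q ∈ (T.affineChart I h c).fixedPrimes) {v : ℕ × ℕ} (hv : T.affChr (c.toFun T) v ≠ 1) :
    T.coordFn I c v ∈ q.asIdeal := by
  obtain ⟨g, hg⟩ : ∃ g, (T.affChr (c.toFun T) v g : k) ≠ 1 := by
    by_contra! h
    exact hv (MonoidHom.ext fun g => Units.ext (h g))
  exact AffineChart.mem_of_act_eq_smul hq (act_coordFn g v) hg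

theorem coordFn_notMem {c' : T.Chart} {q : Spec (.of (T.affineChart I h c).A)}
    {q' : Spec (.of (T.affineChart I h c').A)}
    (hq : (T.affineChart I h c).pt q = (T.affineChart I h c').pt q') {j : ℕ} (hj : j < T.length) :
    T.coordFn I c (j, c'.toFun T j) ∉ q.asIdeal := by
  rw [Chart.toFun, dif_pos hj]
  have := T.coordFn_coord (I := I) (c := c) ⟨⟨j, hj⟩, c' ⟨j, hj⟩⟩
  rw [this]
  exact affCoord_notMem hq ⟨j, hj⟩

theorem exists_pt_eq_of_coordFn {c' : T.Chart} {q : Spec (.of (T.affineChart I h c).A)}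
    (hq : ∀ j < T.length, T.coordFn I c (j, c'.toFun T j) ∉ q.asIdeal) :
    ∃ q' : Spec (.of (T.affineChart I h c').A),
      (T.affineChart I h c').pt q' = (T.affineChart I h c).pt q := by
  refine exists_pt_eq fun j => ?_
  have h1 := hq j j.2
  rw [Chart.toFun_fin] at h1
  have := T.coordFn_coord (I := I) (c := c) ⟨j, c' j⟩
  rwa [← this]

end Tower

end

/-! ### Diagonalization of the action on a chart -/

section

open MvPolynomial

variable {k : Type u} [Field k] {p n : ℕ}

namespace Tower

section

variable {T : Tower k p n} {I : Ideal T.CoordRing} (h : ∀ g, I ≤ I.comap (T.act g)) (c : T.Chart)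

/-- The coordinates with respect to which the action is diagonalized on the chart `c`, apart from
the coordinate `τ`. -/
abbrev FixIndex (c : T.Chart) (τ : ℕ × ℕ) : Type :=
  {v : ℕ × ℕ // T.InRange v ∧ v.2 ≠ c.toFun T v.1 ∧ v ≠ τ}

theorem adjoin_insert_coordFn (τ : ℕ × ℕ) :
    Algebra.adjoin k (insert (T.coordFn I c τ)
      (Set.range fun v : T.FixIndex c τ => T.coordFn I c v)) = ⊤ := by
  refine top_le_iff.1 ((adjoin_range_coordFn (T := T) (I := I) (c := c)).symm.le.trans
    (Algebra.adjoin_le ?_))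
  rintro _ ⟨v, rfl⟩
  by_cases hv : T.InRange v
  · by_cases hvτ : v = τ
    · rw [hvτ]
      exact Algebra.subset_adjoin (Set.mem_insert _ _)
    · by_cases hvc : v.2 = c.toFun T v.1
      · have : T.coordFn I c v = 1 := by
          have := coordFn_chart (I := I) (c := c) hv.1
          rwa [← hvc] at this
        rw [this]
        exact one_mem _
      · exact Algebra.subset_adjoin (Set.mem_insert_of_mem _ ⟨⟨v, hv, hvc, hvτ⟩, rfl⟩)
  · rw [coordFn_of_not hv]
    exact zero_mem _

/-- The coordinates of a chart as data which describe its fixed points: all coordinates but `τ` have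
nontrivial characters. An index `τ` out of range stands for the function zero. -/
def fixCoords (τ : ℕ × ℕ) (f : Polynomial k)
    (hne : ∀ v, T.InRange v → v.2 ≠ c.toFun T v.1 → v ≠ τ → T.affChr (c.toFun T) v ≠ 1)
    (hτ : T.InRange τ → τ.2 ≠ c.toFun T τ.1 ∧ T.affChr (c.toFun T) τ = 1)
    (hτ0 : ¬ T.InRange τ → ∀ (L : Type u) [Field L] [Algebra k L] (b : L),
      Polynomial.aeval b f = 0 → b = 0)
    (rel : Polynomial.aeval (T.coordFn I c τ) f ∈
      Ideal.span (Set.range fun v : T.FixIndex c τ => T.coordFn I c v))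
    (hom : ∀ (L : Type u) [Field L] [Algebra k L] (b : L), Polynomial.aeval b f = 0 →
      ∀ x : ℕ × ℕ → DualNumber L, x τ = TrivSqZeroExt.inl b →
        (∀ v, ¬ T.InRange v → x v = 0) → (∀ j < T.length, x (j, c.toFun T j) = 1) →
        (∀ v, T.InRange v → v.2 ≠ c.toFun T v.1 → v ≠ τ → ∃ r, x v = TrivSqZeroExt.inr r) →
        ∀ F ∈ I, aeval (fun w : T.Coord => x (w.1, w.2)) F = 0) :
    FixCoords (T.affineChart I h c) f where
  ι := T.FixIndex c τ
  y v := T.coordFn I c v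
  t := T.coordFn I c τ
  ψ v g := T.affChr (c.toFun T) v g
  exists_ne_one v := by
    by_contra! hv
    exact hne v v.2.1 v.2.2.1 v.2.2.2 (MonoidHom.ext fun g => Units.ext (hv g))
  act_y g v := act_coordFn g v
  act_t g := by
    by_cases hr : T.InRange τ
    · refine (act_coordFn g τ).trans ?_
      rw [(hτ hr).2]
      exact one_smul k _
    · rw [coordFn_of_not hr]
      exact map_zero _
  gen := adjoin_insert_coordFn c τ
  rel := rel
  hom L _ _ b hb r := by
    classical
    let x : ℕ × ℕ → DualNumber L := Function.extend (fun v : T.FixIndex c τ => (v : ℕ × ℕ))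
      (fun v => TrivSqZeroExt.inr (r v))
      (fun v => if v = τ then TrivSqZeroExt.inl b else if T.InRange v then 1 else 0)
    have hx : ∀ v : T.FixIndex c τ, x v = TrivSqZeroExt.inr (r v) := fun v =>
      Subtype.val_injective.extend_apply _ _ v
    have hx' : ∀ v, ¬ (T.InRange v ∧ v.2 ≠ c.toFun T v.1 ∧ v ≠ τ) →
        x v = if v = τ then TrivSqZeroExt.inl b else if T.InRange v then 1 else 0 := fun v hv =>
      Function.extend_apply' _ _ _ fun ⟨w, hw⟩ => hv (hw ▸ w.2)
    have hxτ : x τ = TrivSqZeroExt.inl b := by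
      rw [hx' τ fun hv => hv.2.2 rfl, if_pos rfl]
    have hx0 : ∀ v, ¬ T.InRange v → x v = 0 := fun v hv => by
      by_cases hvτ : v = τ
      · rw [hvτ, hxτ, hτ0 (hvτ ▸ hv) L b hb, TrivSqZeroExt.inl_zero]
      · rw [hx' v fun h => hv h.1, if_neg hvτ, if_neg hv]
    have hx1 : ∀ j < T.length, x (j, c.toFun T j) = 1 := fun j hj => by
      have hr : T.InRange (j, c.toFun T j) := ⟨hj, c.valid j hj⟩
      rw [hx' _ fun h => h.2.1 rfl, if_neg, if_pos hr]
      rintro rfl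
      exact (hτ hr).1 rfl
    obtain ⟨θ, hθ⟩ := exists_algHom_coordFn (I := I) (c := c) hx0 hx1 (hom L b hb x hxτ hx0 hx1
      fun v h1 h2 h3 => ⟨_, hx ⟨v, h1, h2, h3⟩⟩)
    exact ⟨θ, fun v => (hθ v).trans (hx v), (hθ τ).trans hxτ⟩

end

/-! ### Towers with one more step -/

section

variable {S : Tower k p n} {Ms : List (LineBundle k p n)}

theorem inRange_append_iff {v : ℕ × ℕ} :
    InRange (S ++ [Ms]) v ↔ S.InRange v ∨ (v.1 = S.length ∧ v.2 < Ms.length) := by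
  have h0 : List.getD (S ++ [Ms]) S.length [] = Ms := by simp
  rw [InRange, List.length_append, List.length_singleton, Nat.lt_succ_iff_lt_or_eq, InRange]
  constructor
  · rintro ⟨hv | hv, h⟩
    · rw [row_append (List.prefix_append _ _) hv] at h
      exact .inl ⟨hv, h⟩
    · rw [hv, h0] at h
      exact .inr ⟨hv, h⟩
  · rintro (⟨hv, h⟩ | ⟨hv, h⟩)
    · rw [row_append (List.prefix_append _ _) hv]
      exact ⟨.inl hv, h⟩
    · rw [hv, h0]
      exact ⟨.inr rfl, h⟩

/-- The chart over the chart `c` in which the coordinate `i` of the last step is invertible. -/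
def extChart (c : S.Chart) {i : ℕ} (hi : i < Ms.length) : Chart (S ++ [Ms]) :=
  Valid.chart (d := Function.update (c.toFun S) S.length i) (valid_append_iff.2 ⟨fun j hj => by
    rw [Function.update_of_ne hj.ne]
    exact c.valid j hj, by rwa [Function.update_self]⟩)

variable {c : S.Chart} {i : ℕ} {hi : i < Ms.length}

theorem toFun_extChart_of_lt {j : ℕ} (hj : j < S.length) :
    (extChart c hi).toFun _ j = c.toFun S j := by
  rw [extChart, Valid.toFun_chart _ (by rw [List.length_append]; omega),
    Function.update_of_ne hj.ne]

theorem toFun_extChart_length : (extChart c hi).toFun _ S.length = i := by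
  rw [extChart, Valid.toFun_chart _ (by simp), Function.update_self]

theorem exists_eq_extChart (d : Chart (S ++ [Ms])) :
    ∃ (c : S.Chart) (i : ℕ) (hi : i < Ms.length), d = extChart c hi := by
  obtain ⟨hS, hN⟩ := valid_append_iff.1 d.valid
  refine ⟨hS.chart, _, hN, funext fun j => Fin.ext ?_⟩
  rw [← Chart.toFun_fin d, ← Chart.toFun_fin (extChart _ hN)]
  have hj : (j : ℕ) < S.length + 1 := j.2.trans_eq (by simp)
  rcases Nat.lt_succ_iff_lt_or_eq.1 hj with h | h
  · rw [toFun_extChart_of_lt h, hS.toFun_chart h]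
  · rw [h, toFun_extChart_length]

theorem Chart.ext_toFun {T : Tower k p n} {c d : T.Chart}
    (h : ∀ j < T.length, c.toFun T j = d.toFun T j) : c = d := by
  refine funext fun j => Fin.ext ?_
  rw [← c.toFun_fin, ← d.toFun_fin]
  exact h j j.2

theorem affChr_extChart_of_lt {v : ℕ × ℕ} (hv : v.1 < S.length) :
    affChr (S ++ [Ms]) ((extChart c hi).toFun _) v = S.affChr (c.toFun S) v := by
  rw [affChr_append (List.prefix_append S [Ms]) _ hv]
  exact affChr_congr (fun j hj => toFun_extChart_of_lt hj) hv

theorem affChr_extChart_length (a : ℕ) :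
    affChr (S ++ [Ms]) ((extChart c hi).toFun _) (S.length, a) =
      S.fibreChr (c.toFun S) S.length (Ms.getD a .trivial) *
        (S.fibreChr (c.toFun S) S.length (Ms.getD i .trivial))⁻¹ := by
  have h1 : ∀ L, fibreChr (S ++ [Ms]) ((extChart c hi).toFun _) S.length L =
      S.fibreChr (c.toFun S) S.length L := fun L => by
    rw [fibreChr_append (List.prefix_append S [Ms]) _ le_rfl]
    refine congrArg (_ * ·) (Finset.prod_congr rfl fun j hj => ?_)
    rw [fib_congr (fun j hj => toFun_extChart_of_lt hj) (Finset.mem_range.1 hj)]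
  rw [affChr, fib_eq, h1, h1, bundle_append_length, bundle_append_length, toFun_extChart_length]

end

end Tower

end

/-! ### The fixed points of `ℙ(𝒜)` -/

section

open MvPolynomial

variable {k : Type u} [Field k] {p n : ℕ}

theorem length_kummer (L : LineBundle k p n) : (kummer L).length = p := by simp [kummer]

theorem getD_kummer (L : LineBundle k p n) {a : ℕ} (ha : a < p) :
    (kummer L).getD a .trivial = L.pow a := by
  simp [kummer, ha]

namespace Tower

variable {S : Tower k p n} {J : FormedBundle k p n}

theorem fibreChr_kummer (c : ℕ → ℕ) {a : ℕ} (ha : a < p) :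
    S.fibreChr c S.length ((kummer J.toLineBundle).getD a .trivial) = S.chrOn c J ^ a := by
  rw [getD_kummer _ ha, fibreChr_pow]
  rfl

theorem fibreChr_kummer_append (c : ℕ → ℕ) {a : ℕ} (ha : a ≤ p) :
    S.fibreChr c S.length ((kummer J.toLineBundle ++ [LineBundle.trivial]).getD a .trivial) =
      S.chrOn c J ^ a := by
  rcases ha.lt_or_eq with ha | rfl
  · rw [List.getD_append _ _ _ _ (by rwa [length_kummer]), fibreChr_kummer c ha]
  · rw [List.getD_append_right _ _ _ _ (length_kummer _).le, length_kummer, Nat.sub_self,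
      MuChr.pow_eq_one]
    exact chrOn_trivial (T := S)

theorem pow_ne_pow (hp : p.Prime) {χ : MuChr k p n} (hχ : χ ≠ 1) {a b : ℕ} (hab : a < b)
    (hb : b < a + p) : χ ^ a ≠ χ ^ b := by
  have : Fact p.Prime := ⟨hp⟩
  have ho : orderOf χ = p := orderOf_eq_prime (MuChr.pow_eq_one χ) hχ
  intro h
  have h' := (pow_eq_pow_iff_modEq (x := χ)).1 h
  rw [ho] at h'
  have h1 := Nat.le_of_dvd (by omega) ((Nat.modEq_iff_dvd' hab.le).1 h')
  omega

/-- A tower of good bundles, followed by the projectivization of a Kummer algebra whose line bundle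
has nontrivial characters at the fixed points. -/
theorem good_append_kummer (hp : p.Prime) (hS : S.Good)
    (hχ : ∀ c, S.Valid c → S.chrOn c J ≠ 1) : Good (S ++ [kummer J.toLineBundle]) := by
  refine hS.append (by rw [length_kummer]; exact hp.pos) fun c hc a ha b hb hab => ?_
  rw [length_kummer] at ha hb
  rw [fibreChr_kummer c ha, fibreChr_kummer c hb]
  rcases hab.lt_or_gt with h | h
  · exact pow_ne_pow hp (hχ c hc) h (by omega)
  · exact (pow_ne_pow hp (hχ c hc) h (by omega)).symm

section Variety

variable {T : Tower k p n}

/-- The chart `c` contains exactly one fixed point, its origin. -/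
def originCoords (hT : T.Good) (c : T.Chart) :
    FixCoords (T.affineChart ⊥ (fun _ => bot_le) c) Polynomial.X :=
  have hr : ¬ T.InRange (T.length, 0) := fun h => lt_irrefl _ h.1
  T.fixCoords _ c (T.length, 0) _
    (fun _ hv hvc _ => hT.affChr_ne_one c.valid hv hvc)
    (fun h => absurd h hr)
    (fun _ L _ _ b hb => by rwa [Polynomial.aeval_X] at hb)
    (by rw [Polynomial.aeval_X, coordFn_of_not hr]; exact zero_mem _)
    (fun L _ _ b _ x _ _ _ _ F hF => by rw [Ideal.mem_bot.1 hF, map_zero])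

theorem Good.eq_of_pt_eq (hT : T.Good) {I : Ideal T.CoordRing} {h : ∀ g, I ≤ I.comap (T.act g)}
    {c c' : T.Chart} {q : Spec (.of (T.affineChart I h c).A)}
    {q' : Spec (.of (T.affineChart I h c').A)} (hq : q ∈ (T.affineChart I h c).fixedPrimes)
    (hqq : (T.affineChart I h c).pt q = (T.affineChart I h c').pt q') : c = c' := by
  refine Chart.ext_toFun fun j hj => ?_
  by_contra hne
  exact coordFn_notMem hqq hj (coordFn_mem_of_fixed hq
    (hT.affChr_ne_one c.valid (v := (j, c'.toFun T j)) ⟨hj, c'.valid j hj⟩ (Ne.symm hne)))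

variable {I : Ideal T.CoordRing} {c : T.Chart}

theorem algHom_ext_coordFn {R : Type*} [CommRing R] [Algebra k R]
    {f g : (T.gradedCharts I).chartRing {c} →ₐ[k] R}
    (h : ∀ v, f (T.coordFn I c v) = g (T.coordFn I c v)) : f = g := by
  refine AlgHom.ext_of_adjoin_eq_top adjoin_range_coordFn ?_
  rintro _ ⟨v, rfl⟩
  exact h v

/-- Lifting of the coordinates of a point of a chart along a surjection. -/
theorem exists_lift_coordFn {B : Type*} [CommRing B] [Algebra k B] {J' : Ideal B}
    (g : (T.gradedCharts I).chartRing {c} →ₐ[k] B ⧸ J') :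
    ∃ x : ℕ × ℕ → B, (∀ v, ¬ T.InRange v → x v = 0) ∧ (∀ j < T.length, x (j, c.toFun T j) = 1) ∧
      ∀ v, Ideal.Quotient.mk J' (x v) = g (T.coordFn I c v) := by
  classical
  choose s hs using Ideal.Quotient.mk_surjective (I := J')
  let x : ℕ × ℕ → B := fun v => if ¬ T.InRange v then 0 else
    if v.2 = c.toFun T v.1 then 1 else s (g (T.coordFn I c v))
  have hx0 : ∀ v, ¬ T.InRange v → x v = 0 := fun v hv => if_pos hv
  have hx1 : ∀ j < T.length, x (j, c.toFun T j) = 1 := fun j hj => by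
    have hr : T.InRange (j, c.toFun T j) := ⟨hj, c.valid j hj⟩
    exact (if_neg (not_not.2 hr)).trans (if_pos rfl)
  refine ⟨x, hx0, hx1, fun v => ?_⟩
  by_cases hv : T.InRange v
  · by_cases hvc : v.2 = c.toFun T v.1
    · have h1 := hx1 v.1 hv.1
      have h2 := coordFn_chart (I := I) (c := c) hv.1
      rw [← hvc] at h1 h2
      rw [h1, h2, map_one, map_one]
    · simp only [x]
      rw [if_neg (not_not.2 hv), if_neg hvc, hs]
  · rw [hx0 v hv, coordFn_of_not hv, map_zero, map_zero]

theorem smooth_affineChart (c : T.Chart) : Algebra.Smooth k (Localization.Away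
    (1 : (T.affineChart ⊥ (fun _ => bot_le) c).A)) := by
  refine smooth_localization (finiteType_chartRing (I := ⊥) (c := c)) 1 fun B _ _ J' _ g _ => ?_
  obtain ⟨x, hx0, hx1, hx⟩ := exists_lift_coordFn (I := ⊥) (c := c) g
  obtain ⟨θ, hθ⟩ := exists_algHom_coordFn (I := ⊥) (c := c) hx0 hx1
    fun F hF => by rw [Ideal.mem_bot.1 hF, map_zero]
  refine ⟨θ, algHom_ext_coordFn fun v => ?_⟩
  rw [AlgHom.comp_apply, hθ]
  exact hx v

theorem smooth_variety (x : (variety T).V.left) : x ∈ smoothSet (variety T).V := by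
  obtain ⟨c, q, rfl⟩ := exists_affineChart x
  exact AffineChart.pt_mem_smoothSet _ q 1 (fun h => q.isPrime.ne_top
    ((Ideal.eq_top_iff_one _).2 h)) (smooth_affineChart c)

end Variety

/-- The charts of `ℙ(𝒜)`: every chart contains exactly one fixed point. -/
def kummerCharts (hp : p.Prime) (hS : S.Good) (hχ : ∀ c, S.Valid c → S.chrOn c J ≠ 1) :
    FixCharts (variety (S ++ [kummer J.toLineBundle])) Polynomial.X (S.Chart × Fin p) where
  exists_chart x := by
    obtain ⟨c, q, hq⟩ := exists_affineChart x
    exact ⟨_, q, hq⟩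
  chart s := affineChart _ ⊥ (fun _ => bot_le)
    (extChart s.1 (i := s.2) (by rw [length_kummer]; exact s.2.2))
  coords s := originCoords (good_append_kummer hp hS hχ) _
  exists_pt x _ := by
    obtain ⟨d, q, hq⟩ := exists_affineChart x
    obtain ⟨c, i, hi, rfl⟩ := exists_eq_extChart d
    exact ⟨(c, ⟨i, by rwa [length_kummer] at hi⟩), q, hq⟩
  eq_of_pt_eq s s' q q' hq h := by
    have := (good_append_kummer hp hS hχ).eq_of_pt_eq hq h
    have h' := congrArg (Chart.toFun (S ++ [kummer J.toLineBundle])) this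
    refine Prod.ext (Chart.ext_toFun fun j hj => ?_) (Fin.ext ?_)
    · have := congrFun h' j
      rwa [toFun_extChart_of_lt hj, toFun_extChart_of_lt hj] at this
    · have := congrFun h' S.length
      rwa [toFun_extChart_length, toFun_extChart_length] at this

end Tower

end

/-! ### The norm hypersurface -/

section

open MvPolynomial

variable {k : Type u} [Field k] {p n : ℕ}

/-- The equation `N(β) = t ^ p * w`, where `β` and `t` are coordinates at step `N` of a tower. -/
def normEqn (J : FormedBundle k p n) (N : ℕ) (w : k) : MvPolynomial (ℕ × ℕ) k :=
  kummerNorm J.form N p - C w * X (N, p) ^ p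

section NormPoly

variable {R R' : Type*} [CommRing R] [CommRing R']

/-- The norm equation as a polynomial in the coordinate `β 0`. -/
def normPoly (γ : R) (p : ℕ) (β : ℕ → R) (w : R) : Polynomial R :=
  normForm (Polynomial.C γ) p (fun i => if i = 0 then Polynomial.X else Polynomial.C (β i)) -
    Polynomial.C w

theorem eval_normPoly (γ : R) (β : ℕ → R) (w s : R) :
    (normPoly γ p β w).eval s = normForm γ p (fun i => if i = 0 then s else β i) - w := by
  rw [normPoly, Polynomial.eval_sub, Polynomial.eval_C, ← Polynomial.coe_evalRingHom, map_normForm]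
  congr 2
  · simp
  · funext i
    split_ifs <;> simp

theorem eval_normPoly_self (γ : R) (β : ℕ → R) (w : R) :
    (normPoly γ p β w).eval (β 0) = normForm γ p β - w := by
  rw [eval_normPoly]
  congr 2
  funext i
  split_ifs with h
  · rw [h]
  · rfl

theorem map_normPoly (φ : R →+* R') (γ : R) (β : ℕ → R) (w : R) :
    (normPoly γ p β w).map φ = normPoly (φ γ) p (fun i => φ (β i)) (φ w) := by
  rw [normPoly, Polynomial.map_sub, Polynomial.map_C, ← Polynomial.coe_mapRingHom, map_normForm,
    normPoly]
  congr 2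
  · simp
  · funext i
    split_ifs <;> simp

theorem normPoly_of_eq_zero (hp : p ≠ 0) (γ : R) {β : ℕ → R} (hβ : ∀ i, 0 < i → i < p → β i = 0)
    (w : R) : normPoly γ p β w = Polynomial.X ^ p - Polynomial.C w := by
  rw [normPoly, normForm_single_zero hp, if_pos rfl]
  intro i h0 hi
  rw [if_neg h0.ne', hβ i h0 hi, Polynomial.C_0]

/-- The value at `s` of the derivative in the direction `β 0` is compatible with ring maps. -/
theorem map_eval_derivative_normPoly (φ : R →+* R') (γ : R) (β : ℕ → R) (w s : R) :
    φ ((normPoly γ p β w).derivative.eval s) =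
      (normPoly (φ γ) p (fun i => φ (β i)) (φ w)).derivative.eval (φ s) := by
  rw [← map_normPoly, Polynomial.derivative_map, Polynomial.eval_map_apply]

end NormPoly

theorem aeval_normEqn {R : Type*} [CommRing R] [Algebra k R] (hp : p ≠ 0) (J : FormedBundle k p n)
    (N : ℕ) (w : k) (x : ℕ × ℕ → R) : aeval x (normEqn J N w) =
      normForm (aeval x J.form) p (fun i => x (N, i)) - algebraMap k R w * x (N, p) ^ p := by
  rw [normEqn, map_sub, aeval_kummerNorm hp, map_mul, map_pow, aeval_X, aeval_C]

namespace Tower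

variable {S : Tower k p n} {J : FormedBundle k p n} {w : k}

/-- The form of a line bundle on `S` only involves the coordinates of `S`. -/
theorem On.aeval_congr (hJ : S.On J) {R : Type u} [CommRing R] [Algebra k R] {x x' : ℕ × ℕ → R}
    (h : ∀ v, v.1 < S.length → x' v = x v) : aeval x' J.form = aeval x J.form := by
  have := hJ.aeval_eq R x x' (fun _ => 1) fun v hv => by simp [h v hv]
  simpa using this

variable (S J) in
/-- The tower whose last stage is the bundle `ℙ(𝒜 ⊕ 𝒪)`. -/
abbrev ambient : Tower k p n := S ++ [kummer J.toLineBundle ++ [LineBundle.trivial]]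

theorem length_row : (kummer J.toLineBundle ++ [LineBundle.trivial]).length = p + 1 := by
  rw [List.length_append, length_kummer, List.length_singleton]

theorem lt_length_row : p < (kummer J.toLineBundle ++ [LineBundle.trivial]).length := by
  rw [length_row]
  exact Nat.lt_succ_self p

variable (J) in
/-- The chart over the chart `c` of `S` on which `t` is invertible. -/
abbrev normChart (c : S.Chart) : Chart (ambient S J) := extChart c (i := p) lt_length_row

theorem multihomogeneous_normEqn (hp : p ≠ 0) (hJ : S.On J) :
    Multihomogeneous (ambient S J) (normEqn J S.length w) := by
  intro R _ _ x x' u hx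
  set D := ∏ i ∈ Finset.range S.length, u i ^ J.deg i with hD
  have h1 : aeval x' J.form = aeval x J.form * (D : R) ^ p :=
    hJ.aeval_eq R x x' u fun v hv => by
      rw [← bundle_append (List.prefix_append S [kummer J.toLineBundle ++ [.trivial]]) hv]
      exact hx v (by rw [List.length_append]; omega)
  have h2 : ∀ a, x' (S.length, a) = x (S.length, a) * ((u S.length * (∏ i ∈ Finset.range S.length,
      u i ^ ((kummer J.toLineBundle ++ [LineBundle.trivial]).getD a .trivial).deg i)⁻¹ : Rˣ) : R) :=
    fun a => by
      rw [← bundle_append_length]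
      exact hx (S.length, a) (by simp)
  have h3 : ∀ a < p, x' (S.length, a) = x (S.length, a) *
      ((u S.length : R) * ((D⁻¹ : Rˣ) : R) ^ a) := fun a ha => by
    rw [h2, List.getD_append _ _ _ _ (by rwa [length_kummer]), getD_kummer _ ha]
    have : ∏ i ∈ Finset.range S.length, u i ^ (J.pow a).deg i = D ^ a := by
      rw [hD, ← Finset.prod_pow]
      refine Finset.prod_congr rfl fun i _ => ?_
      change u i ^ (a • J.deg i) = _
      rw [nsmul_eq_mul, mul_comm, zpow_mul, zpow_natCast]
    rw [this, ← inv_pow, Units.val_mul, Units.val_pow_eq_pow_val]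
  have h4 : x' (S.length, p) = x (S.length, p) * (u S.length : R) := by
    rw [h2, List.getD_append_right _ _ _ _ (length_kummer _).le, length_kummer, Nat.sub_self]
    have : ∏ i ∈ Finset.range S.length, u i ^ (LineBundle.trivial : LineBundle k p n).deg i = 1 :=
      Finset.prod_eq_one fun i _ => zpow_zero _
    change x (S.length, p) * ((u S.length * (∏ i ∈ Finset.range S.length,
      u i ^ (LineBundle.trivial : LineBundle k p n).deg i)⁻¹ : Rˣ) : R) = _
    rw [this, inv_one, mul_one]
  refine ⟨(u S.length : R) ^ p, ?_⟩
  rw [aeval_normEqn hp, aeval_normEqn hp, h1, h4, sub_mul, ← normForm_scale _ _ D]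
  congr 1
  · unfold normForm
    congr 1
    refine Finset.sum_congr rfl fun i hi => ?_
    exact congrArg (· • _) (h3 i (Finset.mem_range.1 hi))
  · ring

section

variable (S J w) in
/-- The ideal of the norm hypersurface. -/
abbrev normIdeal : Ideal (ambient S J).CoordRing :=
  Ideal.span {(ambient S J).toCoordRing (normEqn J S.length w)}

variable {h : ∀ g, normIdeal S J w ≤ (normIdeal S J w).comap ((ambient S J).act g)}
  {c : S.Chart} {i : ℕ} {hi : i < (kummer J.toLineBundle ++ [LineBundle.trivial]).length}

theorem aeval_normEqn_coordFn (hp : p ≠ 0) (hJ : S.On J) {d : Chart (ambient S J)} :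
    aeval (coordFn (ambient S J) (normIdeal S J w) d) (normEqn J S.length w) = 0 :=
  aeval_coordFn (Ideal.mem_span_singleton_self _) (multihomogeneous_normEqn hp hJ)

theorem exists_algHom_normIdeal {R : Type*} [CommRing R] [Algebra k R] {x : ℕ × ℕ → R}
    (hx : ∀ v, ¬ (ambient S J).InRange v → x v = 0) (hx' : aeval x (normEqn J S.length w) = 0) :
    ∀ F ∈ normIdeal S J w, aeval (fun v : (ambient S J).Coord => x (v.1, v.2)) F = 0 := by
  intro F hF
  obtain ⟨G, rfl⟩ := Ideal.mem_span_singleton'.1 hF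
  rw [map_mul, aeval_toCoordRing hx, hx', mul_zero]

theorem affChr_normChart (a : ℕ) (ha : a ≤ p) :
    affChr (ambient S J) ((extChart c hi).toFun _) (S.length, a) =
      S.chrOn (c.toFun S) J ^ a * (S.chrOn (c.toFun S) J ^ i)⁻¹ := by
  have hi' : i ≤ p := Nat.lt_succ_iff.1 (hi.trans_eq length_row)
  rw [affChr_extChart_length, fibreChr_kummer_append _ ha, fibreChr_kummer_append _ hi']

/-- The coordinates on the fibres have the characters `χ ^ a / χ ^ i`. As `χ` has order `p`, only
the ratio of `β 0` and `t` is invariant. -/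
theorem affChr_normChart_ne_one (hp : p.Prime) (hχ : S.chrOn (c.toFun S) J ≠ 1) {a : ℕ}
    (ha : a ≤ p) (hai : a ≠ i) (h0 : ¬ (a = 0 ∧ i = p)) (h0' : ¬ (a = p ∧ i = 0)) :
    affChr (ambient S J) ((extChart c hi).toFun _) (S.length, a) ≠ 1 := by
  have hi' : i ≤ p := Nat.lt_succ_iff.1 (hi.trans_eq length_row)
  rw [affChr_normChart a ha]
  intro h
  have h := mul_inv_eq_one (a := S.chrOn (c.toFun S) J ^ a).1 h
  rcases hai.lt_or_gt with hlt | hlt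
  · exact pow_ne_pow hp hχ hlt (by omega) h
  · exact pow_ne_pow hp hχ hlt (by omega) h.symm

/-- At a fixed point the coordinates of `S` are those of the origin of a chart. -/
theorem eval_coordFn_of_lt (hS : S.Good)
    {q : Spec (.of (affineChart (ambient S J) _ h (extChart c hi)).A)}
    (hq : q ∈ (affineChart (ambient S J) _ h (extChart c hi)).fixedPrimes) {v : ℕ × ℕ}
    (hv : v.1 < S.length) :
    (affineChart (ambient S J) _ h (extChart c hi)).eval q
      (coordFn (ambient S J) _ (extChart c hi) v) = if v.2 = c.toFun S v.1 then 1 else 0 := by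
  split_ifs with hvc
  · have h1 := coordFn_chart (T := ambient S J) (I := normIdeal S J w) (c := extChart c hi)
      (j := v.1) (by rw [List.length_append]; omega)
    rw [toFun_extChart_of_lt hv, ← hvc] at h1
    rw [h1]
    exact map_one _
  · by_cases hr : S.InRange v
    · refine (AffineChart.eval_eq_zero _ q _).2 (coordFn_mem_of_fixed hq ?_)
      rw [affChr_extChart_of_lt hv]
      exact hS.affChr_ne_one c.valid hr hvc
    · rw [coordFn_of_not]
      · exact map_zero _
      · rw [inRange_append_iff]
        rintro (h | h)
        · exact hr h
        · omega

theorem eval_coordFn_length (hp : p.Prime) (hχ : S.chrOn (c.toFun S) J ≠ 1)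
    {q : Spec (.of (affineChart (ambient S J) _ h (extChart c hi)).A)}
    (hq : q ∈ (affineChart (ambient S J) _ h (extChart c hi)).fixedPrimes) {a : ℕ}
    (ha : a ≤ p) (hai : a ≠ i) (h0 : ¬ (a = 0 ∧ i = p)) (h0' : ¬ (a = p ∧ i = 0)) :
    (affineChart (ambient S J) _ h (extChart c hi)).eval q
      (coordFn (ambient S J) _ (extChart c hi) (S.length, a)) = 0 := by
  exact (AffineChart.eval_eq_zero _ q _).2
    (coordFn_mem_of_fixed hq (affChr_normChart_ne_one hp hχ ha hai h0 h0'))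

theorem coordFn_extChart :
    coordFn (ambient S J) (normIdeal S J w) (extChart c hi) (S.length, i) = 1 := by
  have := coordFn_chart (T := ambient S J) (I := normIdeal S J w) (c := extChart c hi)
    (j := S.length) (by simp)
  rwa [toFun_extChart_length] at this

/-- The norm equation at a fixed point. -/
theorem eval_normEqn (hp : p ≠ 0) (hS : S.Good) (hJ : S.NonvanishingOn J)
    {q : Spec (.of (affineChart (ambient S J) _ h (extChart c hi)).A)}
    (hq : q ∈ (affineChart (ambient S J) _ h (extChart c hi)).fixedPrimes) :
    ∃ γ, IsUnit γ ∧ normForm γ p (fun a => (affineChart (ambient S J) _ h (extChart c hi)).eval q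
        (coordFn (ambient S J) _ (extChart c hi) (S.length, a))) =
      algebraMap k _ w * (affineChart (ambient S J) _ h (extChart c hi)).eval q
        (coordFn (ambient S J) _ (extChart c hi) (S.length, p)) ^ p := by
  have h1 : (affineChart (ambient S J) _ h (extChart c hi)).eval q
      (aeval (coordFn (ambient S J) _ (extChart c hi)) (normEqn J S.length w)) = 0 := by
    rw [aeval_normEqn_coordFn hp hJ.toOn]
    exact map_zero _
  have h2 := (comp_aeval_apply (coordFn (ambient S J) (normIdeal S J w) (extChart c hi))
    ((affineChart (ambient S J) _ h (extChart c hi)).eval q) (normEqn J S.length w)).symm.trans h1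
  rw [aeval_normEqn hp, sub_eq_zero] at h2
  have h3 : aeval (fun v : ℕ × ℕ => algebraMap k ((subvariety (ambient S J) _ h).V.left.residueField
      ((affineChart (ambient S J) _ h (extChart c hi)).pt q))
      (if v.2 = c.toFun S v.1 then (1 : k) else 0)) J.form =
      algebraMap k _ (J.value (c.toFun S)) :=
    aeval_algebraMap_apply _ _ _
  have h4 := hJ.toOn.aeval_congr
    (x := fun v => algebraMap k ((subvariety (ambient S J) _ h).V.left.residueField
      ((affineChart (ambient S J) _ h (extChart c hi)).pt q))
      (if v.2 = c.toFun S v.1 then (1 : k) else 0))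
    (x' := fun v => (affineChart (ambient S J) _ h (extChart c hi)).eval q
      (coordFn (ambient S J) (normIdeal S J w) (extChart c hi) v))
    fun v hv => (eval_coordFn_of_lt hS hq hv).trans (by split_ifs <;> simp)
  have h5 := (IsUnit.mk0 _ (hJ.value_ne_zero _ c.valid)).map (algebraMap k
    ((subvariety (ambient S J) _ h).V.left.residueField
      ((affineChart (ambient S J) _ h (extChart c hi)).pt q)))
  exact ⟨_, (congrArg IsUnit (h4.trans h3)).mpr h5, h2⟩

/-- Every fixed point has `t ≠ 0`. Indeed, the fixed points of `ℙ(𝒜 ⊕ 𝒪)` with `t = 0` are the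
powers of `u`, whose norm is not zero. -/
theorem exists_pt_normChart (hp : p.Prime) (hS : S.Good) (hJ : S.NonvanishingOn J)
    (hχ : ∀ c, S.Valid c → S.chrOn c J ≠ 1) {x : (subvariety (ambient S J) _ h).V.left}
    (hx : x ∈ fixedLocus (subvariety (ambient S J) _ h)) :
    ∃ (c : S.Chart) (q : Spec (.of (affineChart (ambient S J) _ h (normChart J c)).A)),
      (affineChart (ambient S J) _ h (normChart J c)).pt q = x := by
  obtain ⟨d, q, rfl⟩ := exists_affineChart x
  obtain ⟨c, i, hi, rfl⟩ := exists_eq_extChart d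
  have hi' : i ≤ p := Nat.lt_succ_iff.1 (hi.trans_eq length_row)
  refine ⟨c, ?_⟩
  rcases eq_or_ne i p with rfl | hip
  · exact ⟨q, rfl⟩
  have hq := (AffineChart.pt_mem_fixedLocus _ q).1 hx
  obtain ⟨γ, hγ, hN⟩ := eval_normEqn hp.ne_zero hS hJ hq
  have hχc := hχ _ c.valid
  have hone : (affineChart (ambient S J) _ h (extChart c hi)).eval q
      (coordFn (ambient S J) _ (extChart c hi) (S.length, i)) = 1 := by
    rw [coordFn_extChart]
    exact map_one _
  rcases Nat.eq_zero_or_pos i with rfl | hi0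
  · -- in the chart with `β 0 = 1` the equation is `1 = t ^ p * w`
    rw [normForm_single_zero hp.ne_zero γ fun a h0 ha =>
      eval_coordFn_length hp hχc hq ha.le h0.ne' (by omega) (by omega), hone, one_pow] at hN
    refine exists_pt_eq_of_coordFn fun j hj hmem => ?_
    have hmem := (AffineChart.eval_eq_zero _ q _).2 hmem
    revert hmem
    have hj' : j < S.length + 1 := hj.trans_eq (by simp)
    rcases Nat.lt_succ_iff_lt_or_eq.1 hj' with hj | rfl
    · rw [toFun_extChart_of_lt hj, eval_coordFn_of_lt hS hq hj, if_pos rfl]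
      exact one_ne_zero
    · rw [toFun_extChart_length]
      intro h0
      rw [h0, zero_pow hp.ne_zero, mul_zero] at hN
      exact one_ne_zero hN
  · -- in the other charts with `t = 0` the equation would be `N(u ^ i) = 0`
    have h1 := isUnit_normForm_single (p := p) hγ (by omega : i < p) hone fun a ha hai =>
      eval_coordFn_length hp hχc hq ha.le hai (by omega) (by omega)
    rw [hN, eval_coordFn_length hp hχc hq le_rfl hip.symm (by omega) (by omega),
      zero_pow hp.ne_zero, mul_zero] at h1
    exact absurd h1 not_isUnit_zero

end

end Tower

end

/-! ### Fixed points and smoothness of the norm hypersurface -/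

section

open MvPolynomial

variable {k : Type u} [Field k] {p n : ℕ}

section Ring

variable {R : Type*} [CommRing R]

theorem pow_sub_mem_of_normForm_eq (hp : p ≠ 0) {γ w : R} {β : ℕ → R} {𝔞 : Ideal R}
    (hβ : ∀ i, 0 < i → i < p → β i ∈ 𝔞) (h : normForm γ p β = w) : β 0 ^ p - w ∈ 𝔞 := by
  rw [← Ideal.Quotient.eq_zero_iff_mem, map_sub, ← h, map_normForm,
    normForm_single_zero hp _ fun i h0 hi => Ideal.Quotient.eq_zero_iff_mem.2 (hβ i h0 hi),
    map_pow, sub_self]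

/-- One step of Newton's method, which is exact modulo a square zero ideal. -/
theorem exists_eval_add_eq_zero {𝔞 : Ideal R} (h𝔞 : 𝔞 ^ 2 = ⊥) {P : Polynomial R} {s : R}
    (h : P.eval s ∈ 𝔞) (hd : IsUnit (P.derivative.eval s)) : ∃ δ ∈ 𝔞, P.eval (s + δ) = 0 := by
  obtain ⟨d, hd⟩ := hd
  refine ⟨-(P.eval s * (d⁻¹ : Rˣ)), neg_mem (𝔞.mul_mem_right _ h), ?_⟩
  have h2 : P.eval s ^ 2 = 0 := by
    rw [← Ideal.mem_bot, ← h𝔞]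
    exact Ideal.pow_mem_pow h 2
  obtain ⟨z, hz⟩ := P.binomExpansion s (-(P.eval s * (d⁻¹ : Rˣ)))
  rw [hz, ← hd, neg_sq, mul_pow, h2, zero_mul, mul_zero, add_zero]
  linear_combination -P.eval s * d.mul_inv

end Ring

namespace Tower

variable {S : Tower k p n} {J : FormedBundle k p n} {w : k}
  {h : ∀ g, normIdeal S J w ≤ (normIdeal S J w).comap ((ambient S J).act g)} {c : S.Chart}

theorem inRange_length {a : ℕ} (ha : a ≤ p) : (ambient S J).InRange (S.length, a) :=
  inRange_append_iff.2 (.inr ⟨rfl, by rw [length_row]; exact Nat.lt_succ_iff.2 ha⟩)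

theorem affChr_ne_one_of_normChart (hp : p.Prime) (hS : S.Good)
    (hχ : ∀ c, S.Valid c → S.chrOn c J ≠ 1) {v : ℕ × ℕ} (hv : (ambient S J).InRange v)
    (hvc : v.2 ≠ (normChart J c).toFun _ v.1) (hv0 : v ≠ (S.length, 0)) :
    affChr (ambient S J) ((normChart J c).toFun _) v ≠ 1 := by
  obtain ⟨j, a⟩ := v
  rcases inRange_append_iff.1 hv with hv' | ⟨rfl, ha⟩
  · rw [affChr_extChart_of_lt hv'.1]
    rw [toFun_extChart_of_lt hv'.1] at hvc
    exact hS.affChr_ne_one c.valid hv' hvc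
  · simp only at ha hvc
    rw [toFun_extChart_length] at hvc
    have ha' : a ≤ p := Nat.lt_succ_iff.1 (ha.trans_eq length_row)
    have h0 : a ≠ 0 := fun h => hv0 (by rw [h])
    exact affChr_normChart_ne_one hp (hχ _ c.valid) ha' hvc (by omega) (by have := hp.pos; omega)

/-- On the chart `t = 1` the norm equation reads `N(β) = w`. -/
theorem normForm_coordFn (hp : p ≠ 0) (hJ : S.On J) :
    normForm (aeval (coordFn (ambient S J) (normIdeal S J w) (normChart J c)) J.form) p
      (fun i => coordFn (ambient S J) (normIdeal S J w) (normChart J c) (S.length, i)) =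
      algebraMap k _ w := by
  have := aeval_normEqn_coordFn hp hJ (w := w) (d := normChart J c)
  rw [aeval_normEqn hp, coordFn_extChart, one_pow, mul_one] at this
  exact sub_eq_zero.1 this

theorem rel_normChart (hp : p ≠ 0) (hJ : S.On J) :
    Polynomial.aeval (coordFn (ambient S J) (normIdeal S J w) (normChart J c) (S.length, 0))
      (Polynomial.X ^ p - Polynomial.C w) ∈ Ideal.span (Set.range
        fun v : (ambient S J).FixIndex (normChart J c) (S.length, 0) =>
          coordFn (ambient S J) (normIdeal S J w) (normChart J c) v) := by
  rw [map_sub, map_pow, Polynomial.aeval_X, Polynomial.aeval_C]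
  refine pow_sub_mem_of_normForm_eq hp (fun i h0 hi => Ideal.subset_span ?_)
    (normForm_coordFn hp hJ)
  refine ⟨⟨(S.length, i), inRange_length hi.le, ?_, ?_⟩, rfl⟩
  · rw [toFun_extChart_length]
    exact hi.ne
  · exact fun h => h0.ne' (congrArg Prod.snd h)

/-- To first order at the points with `β = b`, `b ^ p = w`, the norm equation is `β 0 = b`. -/
theorem aeval_eq_zero_of_normIdeal (hp : p ≠ 0) (hw : w ≠ 0) (L : Type u) [Field L] [Algebra k L]
    (b : L) (hb : Polynomial.aeval b (Polynomial.X ^ p - Polynomial.C w) = 0)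
    (x : ℕ × ℕ → DualNumber L) (hx : x (S.length, 0) = TrivSqZeroExt.inl b)
    (hx0 : ∀ v, ¬ (ambient S J).InRange v → x v = 0)
    (hx1 : ∀ j < (ambient S J).length, x (j, (normChart J c).toFun _ j) = 1)
    (hxr : ∀ v, (ambient S J).InRange v → v.2 ≠ (normChart J c).toFun _ v.1 →
      v ≠ (S.length, 0) → ∃ r, x v = TrivSqZeroExt.inr r) :
    ∀ F ∈ normIdeal S J w, aeval (fun v : (ambient S J).Coord => x (v.1, v.2)) F = 0 := by
  rw [map_sub, map_pow, Polynomial.aeval_X, Polynomial.aeval_C, sub_eq_zero] at hb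
  have hb0 : b ≠ 0 := by
    rintro rfl
    rw [zero_pow hp, eq_comm, map_eq_zero] at hb
    exact hw hb
  have h1 := hx1 S.length (by simp)
  rw [toFun_extChart_length] at h1
  refine exists_algHom_normIdeal hx0 ?_
  rw [aeval_normEqn hp, h1, one_pow, mul_one, sub_eq_zero,
    normForm_first_order (ε := TrivSqZeroExt.inr 1) hp]
  · rw [hx]
    refine (map_pow (TrivSqZeroExt.inlHom L L) b p).symm.trans ?_
    rw [hb]
    rfl
  · rw [sq, TrivSqZeroExt.inr_mul_inr]
  · rw [hx]
    exact (IsUnit.mk0 _ hb0).map (TrivSqZeroExt.inlHom L L)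
  · intro i h0 hi
    obtain ⟨r, hr⟩ := hxr (S.length, i) (inRange_length hi.le) (by
      rw [toFun_extChart_length]
      exact hi.ne) fun h => h0.ne' (congrArg Prod.snd h)
    refine ⟨TrivSqZeroExt.inl r, ?_⟩
    rw [hr, TrivSqZeroExt.inr_mul_inl, MulOpposite.smul_eq_mul_unop, MulOpposite.unop_op, one_mul]

variable (h) in
/-- The charts of the norm hypersurface: on the chart over `c`, the fixed points are given by
`β 0 ^ p = w`. -/
def normCharts (hp : p.Prime) (hS : S.Good) (hJ : S.NonvanishingOn J)
    (hχ : ∀ c, S.Valid c → S.chrOn c J ≠ 1) (hw : w ≠ 0) :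
    FixCharts (subvariety (ambient S J) _ h) (Polynomial.X ^ p - Polynomial.C w) S.Chart where
  exists_chart x := by
    obtain ⟨c, q, hq⟩ := exists_affineChart x
    exact ⟨_, q, hq⟩
  chart c := affineChart (ambient S J) _ h (normChart J c)
  coords c := fixCoords h (normChart J c) (S.length, 0) _
    (fun _ hv hvc hv0 => affChr_ne_one_of_normChart hp hS hχ hv hvc hv0)
    (fun _ => by
      refine ⟨?_, ?_⟩
      · rw [toFun_extChart_length]
        exact hp.ne_zero.symm
      · rw [affChr_normChart 0 (Nat.zero_le p)]
        exact mul_inv_eq_one (a := S.chrOn (c.toFun S) J ^ 0).2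
          ((pow_zero (S.chrOn (c.toFun S) J)).trans
            (MuChr.pow_eq_one (S.chrOn (c.toFun S) J)).symm))
    (fun h0 => absurd (inRange_length (Nat.zero_le p)) h0)
    (rel_normChart hp.ne_zero hJ.toOn)
    (aeval_eq_zero_of_normIdeal hp.ne_zero hw)
  exists_pt _ hx := exists_pt_normChart hp hS hJ hχ hx
  eq_of_pt_eq c c' q q' hq hqq := by
    refine Chart.ext_toFun fun j hj => ?_
    by_contra hne
    have h1 := coordFn_notMem hqq (j := j) (by rw [List.length_append]; omega)
    rw [toFun_extChart_of_lt hj] at h1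
    refine h1 (coordFn_mem_of_fixed hq ?_)
    rw [affChr_extChart_of_lt hj]
    exact hS.affChr_ne_one c.valid ⟨hj, c'.valid j hj⟩ (Ne.symm hne)

variable (S J w) in
/-- The derivative of the norm equation in the direction of `β 0`, on the chart over `c`. -/
def normJacobian (c : S.Chart) :
    ((ambient S J).gradedCharts (normIdeal S J w)).chartRing {normChart J c} :=
  (normPoly (aeval (coordFn (ambient S J) (normIdeal S J w) (normChart J c)) J.form) p
    (fun i => coordFn (ambient S J) (normIdeal S J w) (normChart J c) (S.length, i))
    (algebraMap k _ w)).derivative.eval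
      (coordFn (ambient S J) (normIdeal S J w) (normChart J c) (S.length, 0))

theorem map_normJacobian {R : Type*} [CommRing R] [Algebra k R]
    (φ : ((ambient S J).gradedCharts (normIdeal S J w)).chartRing {normChart J c} →ₐ[k] R) :
    φ (normJacobian S J w c) = (normPoly (aeval (fun v => φ (coordFn (ambient S J)
      (normIdeal S J w) (normChart J c) v)) J.form) p (fun i => φ (coordFn (ambient S J)
        (normIdeal S J w) (normChart J c) (S.length, i))) (algebraMap k R w)).derivative.eval
      (φ (coordFn (ambient S J) (normIdeal S J w) (normChart J c) (S.length, 0))) := by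
  have h1 := map_eval_derivative_normPoly (p := p) (φ : _ →+* R)
    (aeval (coordFn (ambient S J) (normIdeal S J w) (normChart J c)) J.form)
    (fun i => coordFn (ambient S J) (normIdeal S J w) (normChart J c) (S.length, i))
    (algebraMap k _ w) (coordFn (ambient S J) (normIdeal S J w) (normChart J c) (S.length, 0))
  refine h1.trans ?_
  have h2 : φ (aeval (coordFn (ambient S J) (normIdeal S J w) (normChart J c)) J.form) =
      aeval (fun v => φ (coordFn (ambient S J) (normIdeal S J w) (normChart J c) v)) J.form :=
    comp_aeval_apply _ φ J.form
  have h3 : φ (algebraMap k _ w) = algebraMap k R w := φ.commutes w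
  rw [← h2, ← h3]
  rfl

/-- The norm hypersurface is smooth where the derivative of its equation in the direction of `β 0`
does not vanish. -/
theorem smooth_normJacobian (hp : p ≠ 0) (hJ : S.On J) : Algebra.Smooth k (Localization.Away
    (M := (affineChart (ambient S J) _ h (normChart J c)).A) (normJacobian S J w c)) := by
  classical
  -- lift the coordinates of the point `g` arbitrarily, and then correct the coordinate `β 0`
  refine smooth_localization (finiteType_chartRing (I := normIdeal S J w) (c := normChart J c)) _
    fun B _ _ J' hJ' g hg => ?_
  obtain ⟨x, hx0, hx1, hx⟩ := exists_lift_coordFn (I := normIdeal S J w) (c := normChart J c) g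
  have hxp := hx1 S.length (by simp)
  rw [toFun_extChart_length] at hxp
  have hγ : aeval (fun v => g (coordFn (ambient S J) (normIdeal S J w) (normChart J c) v)) J.form =
      Ideal.Quotient.mkₐ k J' (aeval x J.form) :=
    (congrArg (fun y => aeval y J.form) (funext fun v => (hx v).symm)).trans
      (comp_aeval_apply x (Ideal.Quotient.mkₐ k J') J.form).symm
  let P := normPoly (aeval x J.form) p (fun i => x (S.length, i)) (algebraMap k B w)
  have he : P.eval (x (S.length, 0)) ∈ J' := by
    rw [← Ideal.Quotient.eq_zero_iff_mem, eval_normPoly_self _ (fun i => x (S.length, i)),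
      map_sub, sub_eq_zero, map_normForm]
    have := congrArg g (normForm_coordFn (w := w) (c := c) hp hJ)
    rw [g.commutes] at this
    refine .trans ?_ this
    have h1 := map_normForm (p := p) (g : _ →+* B ⧸ J')
      (aeval (coordFn (ambient S J) (normIdeal S J w) (normChart J c)) J.form)
      (fun i => coordFn (ambient S J) (normIdeal S J w) (normChart J c) (S.length, i))
    refine .trans ?_ h1.symm
    refine congrArg₂ (fun γ β => normForm γ p β) ?_ (funext fun i => hx _)
    exact hγ.symm.trans (comp_aeval_apply _ g J.form).symm
  have hd : IsUnit (P.derivative.eval (x (S.length, 0))) := by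
    rw [← IsNilpotent.isUnit_quotient_mk_iff (I := J') ⟨2, hJ'⟩, map_eval_derivative_normPoly]
    refine (congrArg IsUnit ?_).mp hg
    refine (map_normJacobian g).trans ?_
    rw [hγ]
    refine congrArg₂ (fun β s => (normPoly _ p β _).derivative.eval s)
      (funext fun i => (hx _).symm) (hx _).symm
  -- a Newton step makes the lift satisfy the norm equation
  obtain ⟨δ, hδ, hPδ⟩ := exists_eval_add_eq_zero hJ' he hd
  let x' := Function.update x (S.length, 0) (x (S.length, 0) + δ)
  have hx' : ∀ v, v ≠ (S.length, 0) → x' v = x v := fun v hv => Function.update_of_ne hv _ _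
  have hx'' : x' (S.length, 0) = x (S.length, 0) + δ := Function.update_self ..
  have hp' : (S.length, p) ≠ (S.length, 0) := fun h => hp (congrArg Prod.snd h)
  obtain ⟨θ, hθ⟩ := exists_algHom_coordFn (I := normIdeal S J w) (c := normChart J c) (x := x')
    (fun v hv => by
      rw [hx' v, hx0 v hv]
      rintro rfl
      exact hv (inRange_length (Nat.zero_le p)))
    (fun j hj => by
      rw [hx', hx1 j hj]
      intro hj'
      obtain ⟨rfl, h0⟩ := Prod.mk.inj hj'
      rw [toFun_extChart_length] at h0
      exact hp h0)
    (exists_algHom_normIdeal (fun v hv => by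
      rw [hx' v, hx0 v hv]
      rintro rfl
      exact hv (inRange_length (Nat.zero_le p))) (by
      rw [aeval_normEqn hp, hx' _ hp', hxp, one_pow, mul_one,
        hJ.aeval_congr (x := x) fun v hv => hx' v (by rintro rfl; exact lt_irrefl _ hv), ← hPδ,
        eval_normPoly]
      congr 2
      funext i
      split_ifs with hi
      · rw [hi, hx'']
      · exact hx' _ fun h => hi (congrArg Prod.snd h)))
  refine ⟨θ, algHom_ext_coordFn fun v => ?_⟩
  rw [AlgHom.comp_apply, hθ]
  refine .trans ?_ (hx v)
  by_cases hv : v = (S.length, 0)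
  · rw [hv, hx'', map_add]
    exact (congrArg (_ + ·) (Ideal.Quotient.eq_zero_iff_mem.2 hδ)).trans (add_zero _)
  · rw [hx' v hv]
    rfl

/-- Where `β = β 0`, the norm equation is `β 0 ^ p = w`, with derivative `p * β 0 ^ (p - 1)`. -/
theorem map_normJacobian_ne_zero [CharZero k] (hp : p ≠ 0) (hJ : S.On J) (hw : w ≠ 0)
    {L : Type*} [Field L] [Algebra k L]
    (φ : ((ambient S J).gradedCharts (normIdeal S J w)).chartRing {normChart J c} →ₐ[k] L)
    (hβ : ∀ a, 0 < a → a < p → φ (coordFn (ambient S J) (normIdeal S J w) (normChart J c)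
      (S.length, a)) = 0) : φ (normJacobian S J w c) ≠ 0 := by
  intro h0
  have hN := congrArg φ (normForm_coordFn (w := w) (c := c) hp hJ)
  have h1 := map_normForm (p := p) (φ : _ →+* L)
    (aeval (coordFn (ambient S J) (normIdeal S J w) (normChart J c)) J.form)
    (fun i => coordFn (ambient S J) (normIdeal S J w) (normChart J c) (S.length, i))
  have h2 := (normForm_single_zero hp _ hβ).symm.trans (h1.symm.trans (hN.trans (φ.commutes w)))
  have h3 := (map_normJacobian φ).symm.trans h0
  rw [normPoly_of_eq_zero hp _ hβ, Polynomial.derivative_sub, Polynomial.derivative_C,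
    sub_zero, Polynomial.derivative_X_pow, Polynomial.eval_mul, Polynomial.eval_C,
    Polynomial.eval_pow, Polynomial.eval_X] at h3
  have hs : φ (coordFn (ambient S J) (normIdeal S J w) (normChart J c) (S.length, 0)) ≠ 0 := by
    intro hs
    rw [hs, zero_pow hp, eq_comm, map_eq_zero] at h2
    exact hw h2
  refine mul_ne_zero ?_ (pow_ne_zero _ hs) h3
  rw [← map_natCast (algebraMap k L), Ne, map_eq_zero]
  exact Nat.cast_ne_zero.2 hp

theorem fixedLocus_subset_smoothSet [CharZero k] (hp : p.Prime) (hS : S.Good)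
    (hJ : S.NonvanishingOn J) (hχ : ∀ c, S.Valid c → S.chrOn c J ≠ 1) (hw : w ≠ 0) :
    fixedLocus (subvariety (ambient S J) _ h) ⊆ smoothSet (subvariety (ambient S J) _ h).V := by
  intro x hx
  obtain ⟨c, q, hcq⟩ := exists_pt_normChart hp hS hJ hχ hx
  rw [← hcq] at hx ⊢
  have hq := (AffineChart.pt_mem_fixedLocus _ q).1 hx
  have hmem : (normJacobian S J w c : (affineChart (ambient S J) _ h (normChart J c)).A) ∉
      q.asIdeal := by
    intro hmem
    refine map_normJacobian_ne_zero hp.ne_zero hJ.toOn hw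
      ((affineChart (ambient S J) _ h (normChart J c)).eval q) (fun a h0 ha => ?_)
      ((AffineChart.eval_eq_zero _ q _).2 hmem)
    exact eval_coordFn_length hp (hχ _ c.valid) hq ha.le ha.ne (by omega) (by omega)
  have hs := smooth_normJacobian (h := h) (c := c) hp.ne_zero hJ.toOn
  exact AffineChart.pt_mem_smoothSet (affineChart (ambient S J) _ h (normChart J c)) q
    (normJacobian S J w c) hmem hs

end Tower

end

/-! ### The fixed point equivalence -/

section

variable {k : Type u} [Field k] {p n : ℕ}

/-- The `p`-th roots of `b ^ p` are the elements `ζ ^ i * b`. -/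
theorem exists_equiv_root_fin (hp : 0 < p) {ζ : k} (hζ : IsPrimitiveRoot ζ p) {b w : k}
    (hb : b ^ p = w) (hw : w ≠ 0) :
    Nonempty ({x : k // (Polynomial.X ^ p - Polynomial.C w).eval x = 0} ≃ Fin p) := by
  have hb0 : b ≠ 0 := by
    rintro rfl
    exact hw (hb.symm.trans (zero_pow hp.ne'))
  have : NeZero p := ⟨hp.ne'⟩
  have h : ∀ x, (Polynomial.X ^ p - Polynomial.C w).eval x = 0 ↔ x ^ p = w := fun x => by
    rw [Polynomial.eval_sub, Polynomial.eval_pow, Polynomial.eval_X, Polynomial.eval_C, sub_eq_zero]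
  have h' : ∀ i : Fin p, (ζ ^ (i : ℕ) * b) ^ p = w := fun i => by
    rw [mul_pow, ← pow_mul, mul_comm (i : ℕ), pow_mul, hζ.pow_eq_one, one_pow, one_mul, hb]
  let r : Fin p → {x : k // (Polynomial.X ^ p - Polynomial.C w).eval x = 0} := fun i =>
    ⟨ζ ^ (i : ℕ) * b, (h _).2 (h' i)⟩
  refine ⟨(Equiv.ofBijective r ⟨?_, ?_⟩).symm⟩
  · intro i j hij
    exact Fin.ext (hζ.pow_inj i.2 j.2 (mul_right_cancel₀ hb0 (congrArg Subtype.val hij)))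
  · rintro ⟨x, hx⟩
    obtain ⟨i, hi, hix⟩ := hζ.eq_pow_of_pow_eq_one (ξ := x / b) (by
      rw [div_pow, hb, (h x).1 hx, div_self hw])
    exact ⟨⟨i, hi⟩, Subtype.ext ((congrArg (· * b) hix).trans (div_mul_cancel₀ x hb0))⟩

theorem pow_ite_mul_inv_pow {G : Type*} [CommGroup G] {χ : G} (hχ : χ ^ p = 1) (a i : ℕ) :
    χ ^ (if a + i < p then a + i else a + i - p) * (χ ^ i)⁻¹ = χ ^ a * (χ ^ p)⁻¹ := by
  have h : χ ^ (if a + i < p then a + i else a + i - p) = χ ^ (a + i) := by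
    split_ifs with h
    · rfl
    · rw [← Nat.sub_add_cancel (not_lt.1 h), pow_add χ _ p, hχ, mul_one, Nat.add_sub_cancel]
  rw [h, pow_add, mul_inv_cancel_right, hχ, inv_one, mul_one]

namespace Tower

variable {S : Tower k p n} {J : FormedBundle k p n} {w : k} {c : S.Chart} {i : ℕ}

theorem mem_fixIndex_norm {v : ℕ × ℕ} :
    ((ambient S J).InRange v ∧ v.2 ≠ (normChart J c).toFun _ v.1 ∧ v ≠ (S.length, 0)) ↔
      (S.InRange v ∧ v.2 ≠ c.toFun S v.1) ∨ (v.1 = S.length ∧ 0 < v.2 ∧ v.2 < p) := by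
  obtain ⟨j, a⟩ := v
  rw [inRange_append_iff, length_row]
  by_cases hj : j < S.length
  · rw [toFun_extChart_of_lt hj]
    have : (j, a) ≠ (S.length, 0) := fun h => hj.ne (congrArg Prod.fst h)
    simp [hj.ne, this]
  · have : ¬ S.InRange (j, a) := fun h => hj h.1
    simp only [this, false_and, false_or, and_assoc]
    refine and_congr_right fun hj => ?_
    subst hj
    rw [toFun_extChart_length]
    simp only [ne_eq, Prod.mk.injEq, true_and]
    omega

theorem mem_fixIndex_kummer (hi : i < (kummer J.toLineBundle).length) {v : ℕ × ℕ} :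
    (InRange (S ++ [kummer J.toLineBundle]) v ∧ v.2 ≠ (extChart c hi).toFun _ v.1 ∧
      v ≠ (List.length (S ++ [kummer J.toLineBundle]), 0)) ↔
      (S.InRange v ∧ v.2 ≠ c.toFun S v.1) ∨ (v.1 = S.length ∧ v.2 < p ∧ v.2 ≠ i) := by
  obtain ⟨j, a⟩ := v
  rw [inRange_append_iff, length_kummer, List.length_append, List.length_singleton]
  by_cases hj : j < S.length
  · rw [toFun_extChart_of_lt hj]
    have : (j, a) ≠ (S.length + 1, 0) := fun h => by
      have := congrArg Prod.fst h
      omega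
    simp [hj.ne, this]
  · have : ¬ S.InRange (j, a) := fun h => hj h.1
    simp only [this, false_and, false_or, and_assoc]
    refine and_congr_right fun hj => ?_
    subst hj
    rw [toFun_extChart_length]
    simp

/-- At the fixed points over the chart `c`, the tangent spaces of the norm hypersurface and of
`ℙ(𝒜)` have the same characters. Along the fibres over `S` these are `χ ^ a` for `0 < a < p`, and
`χ ^ b / χ ^ i` for `b ≠ i`, respectively. -/
theorem exists_fixIndex_equiv (hi : i < (kummer J.toLineBundle).length) :
    ∃ e : (ambient S J).FixIndex (normChart J c) (S.length, 0) ≃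
      FixIndex (extChart c hi)
        (List.length (S ++ [kummer J.toLineBundle]), 0),
      ∀ v, affChr (S ++ [kummer J.toLineBundle]) ((extChart c hi).toFun _) (e v : ℕ × ℕ) =
        affChr (ambient S J) ((normChart J c).toFun _) (v : ℕ × ℕ) := by
  have hi' : i < p := hi.trans_eq (length_kummer _)
  -- on the last step `a` corresponds to `b = a + i` modulo `p`
  let f : ℕ × ℕ → ℕ × ℕ := fun v =>
    if v.1 = S.length then (v.1, if v.2 + i < p then v.2 + i else v.2 + i - p) else v
  let f' : ℕ × ℕ → ℕ × ℕ := fun v =>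
    if v.1 = S.length then (v.1, if i < v.2 then v.2 - i else v.2 + p - i) else v
  have hf : ∀ v : ℕ × ℕ, v.1 < S.length → f v = v := fun v hv => if_neg hv.ne
  have hf' : ∀ v : ℕ × ℕ, v.1 < S.length → f' v = v := fun v hv => if_neg hv.ne
  have hfN : ∀ a, f (S.length, a) = (S.length, if a + i < p then a + i else a + i - p) :=
    fun a => if_pos rfl
  have hfN' : ∀ a, f' (S.length, a) = (S.length, if i < a then a - i else a + p - i) :=
    fun a => if_pos rfl
  let e : (ambient S J).FixIndex (normChart J c) (S.length, 0) ≃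
      FixIndex (extChart c hi)
        (List.length (S ++ [kummer J.toLineBundle]), 0) :=
    { toFun := fun v => ⟨f v, (mem_fixIndex_kummer hi).2 (by
        obtain ⟨⟨j, a⟩, hv⟩ := v
        rcases mem_fixIndex_norm.1 hv with hv | ⟨rfl, h0, h1⟩
        · rw [hf _ hv.1.1]
          exact .inl hv
        · simp only at h0 h1
          rw [hfN]
          refine .inr ⟨rfl, ?_, ?_⟩ <;> simp only <;> split_ifs <;> omega)⟩
      invFun := fun v => ⟨f' v, mem_fixIndex_norm.2 (by
        obtain ⟨⟨j, a⟩, hv⟩ := v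
        rcases (mem_fixIndex_kummer hi).1 hv with hv | ⟨rfl, h0, h1⟩
        · rw [hf' _ hv.1.1]
          exact .inl hv
        · simp only at h0 h1
          rw [hfN']
          refine .inr ⟨rfl, ?_, ?_⟩ <;> simp only <;> split_ifs <;> omega)⟩
      left_inv := fun v => by
        obtain ⟨⟨j, a⟩, hv⟩ := v
        refine Subtype.ext ?_
        rcases mem_fixIndex_norm.1 hv with hv | ⟨rfl, h0, h1⟩
        · simp only
          rw [hf _ hv.1.1, hf' _ hv.1.1]
        · simp only at h0 h1 ⊢
          rw [hfN, hfN']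
          refine Prod.ext rfl ?_
          simp only
          split_ifs <;> omega
      right_inv := fun v => by
        obtain ⟨⟨j, a⟩, hv⟩ := v
        refine Subtype.ext ?_
        rcases (mem_fixIndex_kummer hi).1 hv with hv | ⟨rfl, h0, h1⟩
        · simp only
          rw [hf' _ hv.1.1, hf _ hv.1.1]
        · simp only at h0 h1 ⊢
          rw [hfN', hfN]
          refine Prod.ext rfl ?_
          simp only
          split_ifs <;> omega }
  refine ⟨e, ?_⟩
  rintro ⟨⟨j, a⟩, hv⟩
  change affChr _ _ (f (j, a)) = _
  rcases mem_fixIndex_norm.1 hv with hv | ⟨rfl, h0, h1⟩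
  · rw [hf _ hv.1.1, affChr_extChart_of_lt hv.1.1, affChr_extChart_of_lt hv.1.1]
  · simp only at h0 h1 ⊢
    rw [hfN, affChr_extChart_length, affChr_normChart a h1.le,
      fibreChr_kummer _ (by split_ifs <;> omega), fibreChr_kummer _ hi']
    exact pow_ite_mul_inv_pow (χ := S.chrOn (c.toFun S) J) (MuChr.pow_eq_one _) a i

theorem Good.nonempty_chart (hS : S.Good) : Nonempty S.Chart :=
  ⟨Valid.chart (d := fun _ => 0) hS.pos⟩

/-- The norm hypersurface and `ℙ(𝒜)` are fixed point equivalent over a field which contains a `p`-th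
root `b` of `w`: the fixed points over a chart of `S` are indexed by the roots `ζ ^ i * b` and by
`0 ≤ i < p`, respectively. -/
theorem fixedPointEquivalentOver [CharZero k] (hp : p.Prime) {ζ : k} (hζ : IsPrimitiveRoot ζ p)
    (hS : S.Good) (hJ : S.NonvanishingOn J) (hχ : ∀ c, S.Valid c → S.chrOn c J ≠ 1) (hw : w ≠ 0)
    (h : ∀ g, normIdeal S J w ≤ (normIdeal S J w).comap ((ambient S J).act g))
    {L : Type u} [Field L] [Algebra k L] (hL : Algebra.IsSeparable k L) {b : L}
    (hb : b ^ p = algebraMap k L w) :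
    FixedPointEquivalentOver k L (subvariety (ambient S J) _ h)
      (variety (S ++ [kummer J.toLineBundle])) := by
  have hζL := hζ.map_of_injective (algebraMap k L).injective
  have hmap : (Polynomial.X ^ p - Polynomial.C w).map (algebraMap k L) =
      Polynomial.X ^ p - Polynomial.C (algebraMap k L w) := by simp
  obtain ⟨E⟩ := exists_equiv_root_fin hp.pos hζL hb ((map_ne_zero _).2 hw)
  rw [← hmap] at E
  have : Unique {b : L // (Polynomial.X.map (algebraMap k L)).eval b = 0} :=
    { default := ⟨0, by simp⟩
      uniq := fun x => Subtype.ext (by simpa using x.2) }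
  have : Nonempty S.Chart := hS.nonempty_chart
  have : Nonempty (Fin p) := ⟨⟨0, hp.pos⟩⟩
  refine (normCharts h hp hS hJ hχ hw).fixedPointEquivalentOver (kummerCharts hp hS hχ) L hL ?_ ?_
    (Polynomial.separable_X_pow_sub_C w (Nat.cast_ne_zero.2 hp.ne_zero) hw) Polynomial.separable_X
    (by rw [Polynomial.natDegree_X_pow_sub_C]; exact hp.pos) (by simp)
    (fixedLocus_subset_smoothSet hp hS hJ hχ hw) (fun x _ => smooth_variety x)
    (((Equiv.refl S.Chart).prodCongr E).trans (Equiv.prodUnique _ _).symm) fun s => ?_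
  · rw [hmap]
    exact X_pow_sub_C_splits_of_isPrimitiveRoot hζL hb
  · rw [Polynomial.map_X]
    exact Polynomial.Splits.X
  · obtain ⟨e, he⟩ := exists_fixIndex_equiv (c := s.1) (J := J) (i := E s.2)
      (by rw [length_kummer]; exact (E s.2).2)
    exact ⟨e, fun v => funext fun g => congrArg (fun χ : MuChr k p n => (χ g : k)) (he v)⟩

end Tower

end

end NormVar

end

theorem mainTheorem10 {k : Type u} [Field k] [CharZero k] {p n : ℕ} (hp : p.Prime) (hp_odd : Odd p)
    (hn : 2 ≤ n) (ζ : k) (hζ : IsPrimitiveRoot ζ p) (a : Fin n → kˣ) (w : k) (hw : w ≠ 0)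
    {ℓ : Type u} [Field ℓ] [Algebra k ℓ] (b : ℓ) (hb : b ^ p = algebraMap k ℓ w)
    (hℓ : IntermediateField.adjoin k {b} = ⊤) :
    topologicalKrullDim (NormVar.fixedLocus (NormVar.normHypersurface p a w)) = 0 ∧
    (∀ x ∈ NormVar.fixedLocus (NormVar.normHypersurface p a w),
      Nonempty ((NormVar.normHypersurface p a w).V.left.residueField x ≃ₐ[k] ℓ)) ∧
    NormVar.IsNice (NormVar.baseChange k ℓ (NormVar.normHypersurface p a w)) ∧
    ((∃ c : k, c ^ p = w) → NormVar.IsNice (NormVar.normHypersurface p a w)) ∧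
    NormVar.fixedLocus (NormVar.normHypersurface p a w) ⊆
      NormVar.smoothSet (NormVar.normHypersurface p a w).V ∧
    NormVar.FixedPointEquivalentOver k ℓ (NormVar.normHypersurface p a w)
      (NormVar.projKummer p a) := by
  obtain ⟨hS, hJ, hχ⟩ := NormVar.chainS_spec hp hζ a hn
  have : Nonempty (NormVar.chainS p a).Chart := hS.nonempty_chart
  have hd : 0 < (Polynomial.X ^ p - Polynomial.C w).natDegree := by
    rw [Polynomial.natDegree_X_pow_sub_C]
    exact hp.pos
  have hs := NormVar.isSplittingField_of_adjoin_eq_top hp.pos hζ hb hℓ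
  have hfin := Polynomial.IsSplittingField.finiteDimensional ℓ (Polynomial.X ^ p - Polynomial.C w)
  let Ψ : NormVar.FixCharts (NormVar.normHypersurface p a w) (Polynomial.X ^ p - Polynomial.C w)
    (NormVar.chainS p a).Chart := NormVar.Tower.normCharts _ hp hS hJ hχ hw
  refine ⟨Ψ.topologicalKrullDim_fixedLocus hd,
    fun x hx => Ψ.residueField_equiv hp.pos hζ hb hℓ hx,
    (Ψ.baseChange ℓ).isNice hs.splits' (by rwa [Polynomial.natDegree_map]), ?_,
    NormVar.Tower.fixedLocus_subset_smoothSet hp hS hJ hχ hw,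
    NormVar.Tower.fixedPointEquivalentOver hp hζ hS hJ hχ hw _ inferInstance hb⟩
  rintro ⟨c, hc⟩
  exact Ψ.isNice (X_pow_sub_C_splits_of_isPrimitiveRoot hζ hc) hd
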